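/- All polygons and point sets are in the Euclidean plane, and point sets are in general position (no three points collinear). A corner of a simple polygon is a vertex whose interior angle is smaller than $\pi$; a pseudo-$k$-gon is a simple polygon with exactly $k$ corners, and a pseudo-triangle is a pseudo-$3$-gon. A diagonal of a simple polygon is a segment that joins two of its vertices and whose relative interior lies in the interior of the polygon. A pointgon $(R,P)$ consists of a simple polygon $R$ and a finite set $P$ of points consisting of the vertices of $R$ and possibly further points in the interior of $R$, called interior vertices. A pseudo-triangulation of $(R,P)$ is a connected non-crossing straight-line graph with vertex set $P$ that contains all sides of $R$, has all its edges in the closed region bounded by $R$, and whose bounded faces are all interiors of pseudo-triangles with sides in the graph. A diagonal flip in a pseudo-triangulation $T$ removes an edge $f$ of $T$ that is not a side of $R$ and for which $T-f$ is not a pseudo-triangulation of $(R,P)$, and inserts an edge $e\neq f$ such that $T-f+e$ is a pseudo-triangulation of $(R,P)$. (a) Let $T$ be a pseudo-triangulation of a pointgon $(R,P)$ and let $e$ be a segment between two distinct points of $P$ that is not an edge of $T$. If no endpoint of $e$ is an interior vertex of degree two in $T$, then at most one diagonal flip in $T$ inserts $e$. In every case, at most two diagonal flips in $T$ insert $e$.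 (b) The exception does occur: there are a pointgon $(R,P)$, a pseudo-triangulation $T$ of it, and a segment $e$ between two distinct points of $P$ that is not an edge of $T$ and has an endpoint that is an interior vertex of degree two in $T$, such that exactly two diagonal flips in $T$ insert $e$. (c) Every pseudo-$k$-gon with vertices in general position has at least $2(k-3)$ diagonals. -/

import Mathlib

open Topology

namespace PlanePT

/-- The Euclidean plane. -/
abbrev Plane : Type := EuclideanSpace ℝ (Fin 2)

/-- General position: no three distinct points are collinear. -/
def GeneralPosition (S : Set Plane) : Prop :=
  ∀ a ∈ S, ∀ b ∈ S, ∀ c ∈ S, a ≠ b → a ≠ c → b ≠ c → ¬ Collinear ℝ ({a, b, c} : Set Plane)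

section Polygons

variable {n : ℕ}

/-- A simple polygon: a cyclic sequence of at least three distinct points such that two distinct
sides can meet only in a common endpoint. -/
structure IsSimplePolygon (R : Polygon Plane n) : Prop where
  three_le : 3 ≤ n
  injective : Function.Injective R.vertices
  inter_subset : ∀ i j : Fin n, i ≠ j →
    R.edgeSet ℝ i ∩ R.edgeSet ℝ j ⊆
      ({R i, R (finRotate n i)} ∩ {R j, R (finRotate n j)} : Set Plane)

/-- The interior of a polygon: the points off the boundary whose connected component in the
complement of the boundary is bounded. -/
def inside (R : Polygon Plane n) : Set Plane :=
  {x | x ∉ R.boundary ℝ ∧ Bornology.IsBounded (connectedComponentIn (R.boundary ℝ)ᶜ x)}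

/-- The closed region of a polygon: interior together with boundary. -/
def region (R : Polygon Plane n) : Set Plane :=
  inside R ∪ R.boundary ℝ

/-- The `i`-th vertex is a corner (a convex vertex) of the polygon: the angle facing the interior
is smaller than `π`. The sum of the two vectors from the vertex to its two neighbours points
strictly into the angle smaller than `π` spanned by the two sides at the vertex, so the condition
says that it is this angle that faces the interior. -/
def IsCorner (R : Polygon Plane n) (i : Fin n) : Prop :=
  ∀ᶠ ε : ℝ in 𝓝[>] 0,
    R i + ε • ((R (finRotate n i) - R i) + (R ((finRotate n).symm i) - R i)) ∈ inside R

/-- A pseudo-`k`-gon: a simple polygon with exactly `k` corners. -/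
def IsPseudoGon (k : ℕ) (R : Polygon Plane n) : Prop :=
  IsSimplePolygon R ∧ {i : Fin n | IsCorner R i}.ncard = k

/-- The diagonals of a polygon: the (unordered) pairs of distinct vertices that are joined by a
segment through the interior. -/
def diagonals (R : Polygon Plane n) : Set (Sym2 (Fin n)) :=
  {d | ∃ i j : Fin n, i ≠ j ∧ d = s(i, j) ∧ openSegment ℝ (R i) (R j) ⊆ inside R}

end Polygons

section GeometricGraphs

variable {P : Finset Plane}

/-- The two points of the plane are joined by an edge of the geometric graph. -/
def Joined (G : SimpleGraph P) (a b : Plane) : Prop :=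
  ∃ (ha : a ∈ P) (hb : b ∈ P), G.Adj ⟨a, ha⟩ ⟨b, hb⟩

/-- The set of points of the plane covered by the vertices and edges of a geometric graph. -/
def drawing (G : SimpleGraph P) : Set Plane :=
  (P : Set Plane) ∪ {x | ∃ u v : P, G.Adj u v ∧ x ∈ segment ℝ (u : Plane) (v : Plane)}

/-- A geometric graph is non-crossing if any two edges without common endpoint are disjoint
closed segments. -/
def NonCrossing (G : SimpleGraph P) : Prop :=
  ∀ u v w z : P, G.Adj u v → G.Adj w z → u ≠ w → u ≠ z → v ≠ w → v ≠ z →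
    Disjoint (segment ℝ (u : Plane) (v : Plane)) (segment ℝ (w : Plane) (z : Plane))

/-- The bounded faces of a geometric graph: the bounded connected components of the complement of
the drawing. -/
def IsBoundedFace (G : SimpleGraph P) (F : Set Plane) : Prop :=
  ∃ x ∈ (drawing G)ᶜ, F = connectedComponentIn (drawing G)ᶜ x ∧ Bornology.IsBounded F

end GeometricGraphs

/-- A pointgon `(R, P)`: a simple polygon `R` and a finite set `P` of points in general position
that consists of the vertices of `R` and possibly further points in the interior of `R`. -/
structure Pointgon where
  /-- the number of vertices of the polygon -/
  n : ℕ
  /-- the polygon `R` -/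
  poly : Polygon Plane n
  /-- the point set `P` -/
  pts : Finset Plane
  simple : IsSimplePolygon poly
  vertices_mem : ∀ i, poly i ∈ pts
  mem_pts : ∀ p ∈ pts, (∃ i, p = poly i) ∨ p ∈ inside poly
  generalPosition : GeneralPosition (pts : Set Plane)

namespace Pointgon

variable (X : Pointgon)

/-- A vertex of the pointgon in the interior of the polygon. -/
def IsInteriorVertex (v : X.pts) : Prop :=
  (v : Plane) ∈ inside X.poly

/-- The pair of points is a side of the polygon. -/
def IsBoundaryEdge (f : Sym2 X.pts) : Prop :=
  ∃ i : Fin X.n, f.map (fun p : X.pts => (p : Plane)) = s(X.poly i, X.poly (finRotate X.n i))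

/-- A pseudo-triangulation of a pointgon `(R, P)`: a connected non-crossing geometric graph with
vertex set `P` that contains the sides of `R` and has all edges in the region of `R`, such that
every bounded face is the interior of a pseudo-triangle whose sides are edges of the graph. -/
structure IsPseudoTriangulation (T : SimpleGraph X.pts) : Prop where
  connected : T.Connected
  nonCrossing : NonCrossing T
  boundary : ∀ i : Fin X.n, Joined T (X.poly i) (X.poly (finRotate X.n i))
  subset_region : ∀ u v : X.pts, T.Adj u v →
    segment ℝ (u : Plane) (v : Plane) ⊆ region X.poly
  faces : ∀ F : Set Plane, IsBoundedFace T F →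
    ∃ (m : ℕ) (Q : Polygon Plane m), IsPseudoGon 3 Q ∧
      (∀ i : Fin m, Joined T (Q i) (Q (finRotate m i))) ∧ F = inside Q

/-- The diagonal flip in `T` that removes `f` and inserts `e`: `f` is an interior edge of `T` whose
removal does not give a pseudo-triangulation, and `e` is a different edge such that replacing `f`
by `e` gives a pseudo-triangulation. -/
structure IsDiagonalFlip (T : SimpleGraph X.pts) (f e : Sym2 X.pts) : Prop where
  mem : f ∈ T.edgeSet
  interior : ¬ X.IsBoundaryEdge f
  not_deletion : ¬ X.IsPseudoTriangulation (T.deleteEdges {f})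
  ne : e ≠ f
  result : X.IsPseudoTriangulation (T.deleteEdges {f} ⊔ SimpleGraph.fromEdgeSet {e})

/-- The number of diagonal flips in `T` that insert `e`. -/
noncomputable def numFlipsInserting (T : SimpleGraph X.pts) (e : Sym2 X.pts) : ℕ :=
  {f : Sym2 X.pts | X.IsDiagonalFlip T f e}.ncard

/-- One of the endpoints of `e` is an interior vertex that has degree two in `T`. -/
def HasInteriorDegreeTwoEnd (T : SimpleGraph X.pts) (e : Sym2 X.pts) : Prop :=
  ∃ v ∈ e, X.IsInteriorVertex v ∧ (T.neighborSet v).ncard = 2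

end Pointgon

end PlanePT

open PlanePT

/-! Call a vertex of a geometric graph pointed if all its edges lead into an open half-plane.

Part (a) rests on one fact, `IsPseudoTriangulation.of_delete`: if `u` is not pointed in a
pseudo-triangulation but becomes pointed when the inner edge `u u'` is removed, then the removal
leaves a pseudo-triangulation. Indeed `u` is a corner of both faces at `u u'`, since a reflex vertex
of a face is pointed, and it is no corner of their union. A count of corners shows that the two
faces have no vertices in common besides `u` and `u'` (`nodup_of_faces`), so that their union is a
simple polygon, and that it has three corners again (`card_corners_of_faces`).

Now let two flips in `T` insert `e`. No edge of `T` crosses `e`, because every edge of `T` survives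
one of the two flips. So `e` cuts a face of `T`, a pseudo-triangle, into two polygons with at least
three corners each. This needs three new corners, so one end `v` of `e` is a reflex vertex of the
face and a corner of both parts (`exists_reflex_end`). Thus `v` is pointed in `T`, but the two sides
`v p` and `v q` of the face and the segment `e` positively span the plane at `v`. In the result `T -
f + e` of a flip, `v` must be pointed: otherwise `of_delete`, applied to the removal of `e`, would
make `T - f` a pseudo-triangulation, which the definition of a diagonal flip forbids. Hence `f` is
`v p` or `v q`, so there are at most two flips. If both occur, a third edge at `v` would span the
plane together with `e` and one of `v p`, `v q`, and the flip that keeps these edges would leave `v`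
not pointed. So `v` has degree two, and it is an interior vertex, since a flip does not remove a
side of `R`.

For (b), take a triangle with one interior point `o`. The complete graph is a pseudo-triangulation,
and by `of_delete` so is the graph without any one of the three spokes. From the graph without the
spoke to `c`, this spoke is inserted by removing either of the other two, and removing one alone
leaves `o` with degree one, which is impossible.

For (c), let a polygon have `n` vertices, `k` corners and `d` diagonals; the claim is `2 k ≤ d + 6`,
by induction on `n`. If two diagonals cross, cut along one of them: the parts have at least `k + 2`
corners together, and besides the diagonals of the parts there are the cut and the diagonal that
crosses it. If no two diagonals cross, then `n - 3 ≤ d`, by repeated cutting. Moreover, at one end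
of every diagonal the two triangles on it form an angle larger than `π`, for otherwise their other
vertices would be joined by a crossing diagonal. Such an end is a reflex vertex at which the
diagonal is the only obstacle to being pointed (`Blocked`), and a vertex plays this role for at most
two diagonals. So `d ≤ 2 (n - k)`, and the two inequalities give the claim.

All of this uses the Jordan curve theorem for polygons, `SP.jordan`, which is proved with winding
numbers and includes the fact that the interior lies to the left of the sides of a counterclockwise
polygon. Convex position is expressed throughout by signs of `det`. -/

namespace PlanePT

/-! ### Orientation determinants, segments and general position -/

/-- Twice the signed area of the triangle `a b c`. -/
def det (a b c : Plane) : ℝ :=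
  (b 0 - a 0) * (c 1 - a 1) - (b 1 - a 1) * (c 0 - a 0)

lemma plane_ext {a b : Plane} (h0 : a 0 = b 0) (h1 : a 1 = b 1) : a = b := by
  ext i; fin_cases i
  · exact h0
  · exact h1

lemma det_rot (a b c : Plane) : det a b c = det b c a := by unfold det; ring
lemma det_swap (a b c : Plane) : det a b c = -det a c b := by unfold det; ring
lemma det_swap' (a b c : Plane) : det a b c = -det b a c := by unfold det; ring
@[simp] lemma det_self_left (a b : Plane) : det a a b = 0 := by unfold det; ring
@[simp] lemma det_self_right (a b : Plane) : det a b b = 0 := by unfold det; ring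
@[simp] lemma det_self_outer (a b : Plane) : det a b a = 0 := by unfold det; ring

@[fun_prop]
lemma continuous_det (a b : Plane) : Continuous (fun x : Plane => det a b x) := by
  unfold det; fun_prop

lemma coord_add_smul (a b : Plane) (t : ℝ) (i : Fin 2) : (a + t • b) i = a i + t * b i := by
  simp

lemma det_comb (a b x y : Plane) {s t : ℝ} (h : s + t = 1) :
    det a b (s • x + t • y) = s * det a b x + t * det a b y := by
  obtain rfl : s = 1 - t := by linarith
  simp [det]; ring

lemma mem_segment_iff {a b x : Plane} :
    x ∈ segment ℝ a b ↔ ∃ t : ℝ, 0 ≤ t ∧ t ≤ 1 ∧ x = a + t • (b - a) := by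
  rw [segment_eq_image']
  constructor
  · rintro ⟨t, ⟨h0, h1⟩, rfl⟩; exact ⟨t, h0, h1, rfl⟩
  · rintro ⟨t, h0, h1, rfl⟩; exact ⟨t, ⟨h0, h1⟩, rfl⟩

lemma mem_openSegment_iff {a b x : Plane} :
    x ∈ openSegment ℝ a b ↔ ∃ t : ℝ, 0 < t ∧ t < 1 ∧ x = a + t • (b - a) := by
  rw [openSegment_eq_image']
  constructor
  · rintro ⟨t, ⟨h0, h1⟩, rfl⟩; exact ⟨t, h0, h1, rfl⟩
  · rintro ⟨t, h0, h1, rfl⟩; exact ⟨t, ⟨h0, h1⟩, rfl⟩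

lemma det_eq_zero_of_mem_segment {a b x : Plane} (h : x ∈ segment ℝ a b) : det a b x = 0 := by
  obtain ⟨t, -, -, rfl⟩ := mem_segment_iff.1 h
  simp [det]; ring

lemma exists_param_of_det_eq_zero {a b x : Plane} (hab : a ≠ b) (h : det a b x = 0) :
    ∃ t : ℝ, x = a + t • (b - a) := by
  by_cases h0 : b 0 - a 0 = 0
  · have h1 : b 1 - a 1 ≠ 0 := by
      intro h1
      exact hab (plane_ext (by linarith) (by linarith))
    refine ⟨(x 1 - a 1) / (b 1 - a 1), plane_ext ?_ ?_⟩
    · have : (b 1 - a 1) * (x 0 - a 0) = 0 := by unfold det at h; rw [h0] at h; linarith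
      rcases mul_eq_zero.1 this with h' | h'
      · exact absurd h' h1
      · simp [h0]; linarith
    · simp; field_simp; ring
  · refine ⟨(x 0 - a 0) / (b 0 - a 0), plane_ext ?_ ?_⟩
    · simp; field_simp; ring
    · unfold det at h
      simp; field_simp; linarith

lemma collinear_iff_det {a b c : Plane} :
    Collinear ℝ ({a, b, c} : Set Plane) ↔ det a b c = 0 := by
  by_cases hab : a = b
  · subst hab; simp [collinear_pair]
  rw [collinear_iff_of_mem (p₀ := a) (by simp)]
  constructor
  · rintro ⟨v, hv⟩
    obtain ⟨r, hr⟩ := hv b (by simp)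
    obtain ⟨s, hs⟩ := hv c (by simp)
    rw [hr, hs]; simp [det]; ring
  · intro h
    obtain ⟨t, ht⟩ := exists_param_of_det_eq_zero hab h
    refine ⟨b - a, ?_⟩
    intro p hp
    simp only [Set.mem_insert_iff, Set.mem_singleton_iff] at hp
    rcases hp with rfl | rfl | rfl
    · exact ⟨0, by simp⟩
    · exact ⟨1, by simp⟩
    · exact ⟨t, by rw [ht]; simp [add_comm]⟩

lemma GeneralPosition.det_ne {S : Set Plane} (h : GeneralPosition S) {a b c : Plane}
    (ha : a ∈ S) (hb : b ∈ S) (hc : c ∈ S) (hab : a ≠ b) (hac : a ≠ c) (hbc : b ≠ c) :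
    det a b c ≠ 0 := fun h0 => h a ha b hb c hc hab hac hbc (collinear_iff_det.2 h0)

lemma generalPosition_iff_det {S : Set Plane} : GeneralPosition S ↔
    ∀ a ∈ S, ∀ b ∈ S, ∀ c ∈ S, a ≠ b → a ≠ c → b ≠ c → det a b c ≠ 0 := by
  simp only [GeneralPosition, collinear_iff_det, ne_eq]

lemma GeneralPosition.mono {S S' : Set Plane} (h : GeneralPosition S) (hs : S' ⊆ S) :
    GeneralPosition S' := fun a ha b hb c hc => h a (hs ha) b (hs hb) c (hs hc)

/-- In general position, a point of the set on a segment between two points of the set is an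
endpoint. -/
lemma GeneralPosition.eq_or_eq_of_mem_segment {S : Set Plane} (h : GeneralPosition S)
    {a b x : Plane} (ha : a ∈ S) (hb : b ∈ S) (hx : x ∈ S) (hm : x ∈ segment ℝ a b) :
    x = a ∨ x = b := by
  by_contra! hne
  by_cases hab : a = b
  · subst hab; rw [segment_same] at hm; exact hne.1 hm
  · exact h.det_ne ha hb hx hab hne.1.symm hne.2.symm (det_eq_zero_of_mem_segment hm)

lemma segment_inter_of_det_ne {a b c x : Plane} (h : det a b c ≠ 0)
    (h1 : x ∈ segment ℝ a b) (h2 : x ∈ segment ℝ a c) : x = a := by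
  obtain ⟨t, -, -, rfl⟩ := mem_segment_iff.1 h1
  have h3 := det_eq_zero_of_mem_segment h2
  have : t * det a b c = 0 := by
    rw [← neg_eq_zero, ← h3]; simp [det]; ring
  rcases mul_eq_zero.1 this with h' | h'
  · simp [h']
  · exact absurd h' h

/-! ### Exposed points and half-planes at a point -/

/-- The inner product in coordinates. -/
def dotp (w v : Plane) : ℝ := w 0 * v 0 + w 1 * v 1

/-- `x` sees all other points of `V` in an open half-plane. -/
def Exposed (V : Set Plane) (x : Plane) : Prop :=
  x ∈ V ∧ ∃ w : Plane, ∀ y ∈ V, y ≠ x → 0 < dotp w (y - x)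

lemma Exposed.mono {V V' : Set Plane} {x : Plane} (h : Exposed V x) (hs : V' ⊆ V) (hx : x ∈ V') :
    Exposed V' x := ⟨hx, h.2.imp fun _ hw y hy hne => hw y (hs hy) hne⟩

/-- The squared distance in coordinates. -/
def sqd (c x : Plane) : ℝ := (x 0 - c 0) ^ 2 + (x 1 - c 1) ^ 2

/-- The disc around `c` through `x` contains `V` and lies, except for `x`, strictly on the inner
side of its tangent at `x`; so `c - x` is the required normal. -/
lemma exposed_of_farthest {V : Set Plane} {c x : Plane} (hx : x ∈ V)
    (h : ∀ y ∈ V, sqd c y ≤ sqd c x) : Exposed V x := by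
  refine ⟨hx, c - x, fun y hy hne => ?_⟩
  have h1 := h y hy
  have h2 : 0 < (y 0 - x 0) ^ 2 + (y 1 - x 1) ^ 2 := by
    by_contra hle
    have e0 : y 0 - x 0 = 0 := by nlinarith [sq_nonneg (y 0 - x 0), sq_nonneg (y 1 - x 1)]
    have e1 : y 1 - x 1 = 0 := by nlinarith [sq_nonneg (y 0 - x 0), sq_nonneg (y 1 - x 1)]
    exact hne (plane_ext (by linarith) (by linarith))
  simp only [dotp, sqd, PiLp.sub_apply] at *
  nlinarith

/-- A finite set not contained in a line has at least three exposed points. -/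
lemma exists_exposed_avoiding {V : Finset Plane} {z : Plane} (a b : Plane) (hz : z ∈ V)
    (hab : a ≠ b) (hdet : det a b z ≠ 0) :
    ∃ x, Exposed (V : Set Plane) x ∧ x ≠ a ∧ x ≠ b := by
  set D := det a b z with hD
  -- `K` is so large that `z` is farther from the centre below than the equidistant points `a` and
  -- `b`; a farthest point is then exposed and is neither of the two.
  obtain ⟨K, hK⟩ : ∃ K : ℝ, K * D ^ 2 > (sqd a b) / 4 + 1 := by
    refine ⟨((sqd a b) / 4 + 2) / D ^ 2, ?_⟩
    have : D ^ 2 ≠ 0 := pow_ne_zero 2 hdet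
    rw [div_mul_cancel₀ _ this]; linarith
  -- the centre lies on the perpendicular bisector, far on the other side
  set c : Plane := !₂[(a 0 + b 0) / 2 + (K / 2) * D * (b 1 - a 1), (a 1 + b 1) / 2 - (K / 2) * D * (b 0 - a 0)] with hc
  have hc0 : c 0 = (a 0 + b 0) / 2 + (K / 2) * D * (b 1 - a 1) := by simp [hc]
  have hc1 : c 1 = (a 1 + b 1) / 2 - (K / 2) * D * (b 0 - a 0) := by simp [hc]
  obtain ⟨x, hx, hmax⟩ := V.exists_max_image (sqd c) ⟨z, hz⟩
  have hab' : sqd c a = sqd c b := by simp only [sqd, hc0, hc1]; ring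
  have hza : sqd c a < sqd c z := by
    have e : sqd c z - sqd c a
        = (z 0 - (a 0 + b 0) / 2) ^ 2 + (z 1 - (a 1 + b 1) / 2) ^ 2 - sqd a b / 4 + K * D * det a b z := by
      simp only [sqd, hc0, hc1, det]; ring
    have : K * D * det a b z = K * D ^ 2 := by rw [← hD]; ring
    nlinarith [sq_nonneg (z 0 - (a 0 + b 0) / 2), sq_nonneg (z 1 - (a 1 + b 1) / 2)]
  refine ⟨x, exposed_of_farthest hx (fun y hy => hmax y hy), ?_, ?_⟩
  · rintro rfl; linarith [hmax z hz]
  · rintro rfl; linarith [hmax z hz]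

/-- No line contains `V`, so there is always an exposed point different from two given points. This
is used three times, each time avoiding the points found so far. -/
lemma exists_three_exposed {V : Finset Plane} {a b c : Plane} (ha : a ∈ V) (hb : b ∈ V)
    (hc : c ∈ V) (h : det a b c ≠ 0) :
    ∃ x y z, Exposed (V : Set Plane) x ∧ Exposed (V : Set Plane) y ∧ Exposed (V : Set Plane) z ∧
      x ≠ y ∧ x ≠ z ∧ y ≠ z := by
  have hline : ∀ x y : Plane, x ≠ y → ∃ z ∈ V, det x y z ≠ 0 := by
    intro x y hxy
    by_contra! hall
    obtain ⟨r, hr⟩ := exists_param_of_det_eq_zero hxy (hall a ha)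
    obtain ⟨s, hs⟩ := exists_param_of_det_eq_zero hxy (hall b hb)
    obtain ⟨t, ht⟩ := exists_param_of_det_eq_zero hxy (hall c hc)
    apply h
    rw [hr, hs, ht]; simp [det]; ring
  have hab : a ≠ b := by rintro rfl; simp at h
  obtain ⟨x, hx, -, -⟩ := exists_exposed_avoiding a b hc hab h
  obtain ⟨x', hx'⟩ : ∃ x', x ≠ x' := by
    by_cases hxa : x = a
    · exact ⟨b, hxa ▸ hab⟩
    · exact ⟨a, hxa⟩
  obtain ⟨w, hw, hwd⟩ := hline x x' hx'
  obtain ⟨y, hy, hyx, -⟩ := exists_exposed_avoiding x x' hw hx' hwd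
  obtain ⟨w, hw, hwd⟩ := hline x y hyx.symm
  obtain ⟨z, hz, hzx, hzy⟩ := exists_exposed_avoiding x y hw hyx.symm hwd
  exact ⟨x, y, z, hx, hy, hz, hyx.symm, hzx.symm, hzy.symm⟩

/-- Three vectors in the plane are linearly dependent, and Cramer's rule gives determinants as
coefficients. -/
lemma det_dotp_identity (v a b c : Plane) (w : Plane) :
    det v b c * dotp w (a - v) + det v c a * dotp w (b - v) + det v a b * dotp w (c - v) = 0 := by
  simp [det, dotp]; ring

/-- Three vectors that positively span the plane do not lie in an open half-plane. -/
lemma not_halfplane_of_spanning {v a b c w : Plane} (h1 : 0 < det v a b) (h2 : 0 < det v b c)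
    (h3 : 0 < det v c a) (ha : 0 < dotp w (a - v)) (hb : 0 < dotp w (b - v))
    (hc : 0 < dotp w (c - v)) : False := by
  have := det_dotp_identity v a b c w
  nlinarith [mul_pos h2 ha, mul_pos h3 hb, mul_pos h1 hc]

/-- The normal of the line `p q`, with the factor `D` that turns it away from `v`; both products
become `D ^ 2`. -/
lemma exists_halfplane_of_det_ne {v p q : Plane} (h : det v p q ≠ 0) :
    ∃ w : Plane, 0 < dotp w (p - v) ∧ 0 < dotp w (q - v) := by
  set D := det v p q with hD
  refine ⟨!₂[D * ((q 1 - v 1) - (p 1 - v 1)), -(D * ((q 0 - v 0) - (p 0 - v 0)))], ?_, ?_⟩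
  · have : dotp !₂[D * ((q 1 - v 1) - (p 1 - v 1)), -(D * ((q 0 - v 0) - (p 0 - v 0)))] (p - v) = D * det v p q := by
      simp [dotp, det]; ring
    rw [this, ← hD]; exact mul_self_pos.2 h
  · have : dotp !₂[D * ((q 1 - v 1) - (p 1 - v 1)), -(D * ((q 0 - v 0) - (p 0 - v 0)))] (q - v) = D * det v p q := by
      simp [dotp, det]; ring
    rw [this, ← hD]; exact mul_self_pos.2 h

/-- Cramer's rule for `r - v` in terms of `p - v` and `q - v`. -/
lemma det_smul_identity (v p q r : Plane) (w : Plane) :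
    det v p q * dotp w (r - v) = det v r q * dotp w (p - v) + det v p r * dotp w (q - v) := by
  simp [det, dotp]; ring

/-- A half-plane containing two vectors contains the closed cone spanned by them. -/
lemma dotp_pos_of_mem_cone {v p q r w : Plane} (h : det v p q ≠ 0) (hr : r ≠ v)
    (h1 : 0 ≤ det v r q * det v p q) (h2 : 0 ≤ det v p r * det v p q)
    (hp : 0 < dotp w (p - v)) (hq : 0 < dotp w (q - v)) : 0 < dotp w (r - v) := by
  have e := det_smul_identity v p q r w
  have hD : 0 < det v p q * det v p q := mul_self_pos.2 h
  have key : det v p q * det v p q * dotp w (r - v)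
      = det v r q * det v p q * dotp w (p - v) + det v p r * det v p q * dotp w (q - v) := by
    linear_combination det v p q * e
  rcases h1.lt_or_eq with h1' | h1'
  · have : 0 < det v p q * det v p q * dotp w (r - v) := by
      rw [key]; exact add_pos_of_pos_of_nonneg (mul_pos h1' hp) (mul_nonneg h2 hq.le)
    exact pos_of_mul_pos_right this hD.le
  rcases h2.lt_or_eq with h2' | h2'
  · have : 0 < det v p q * det v p q * dotp w (r - v) := by
      rw [key]; exact add_pos_of_nonneg_of_pos (mul_nonneg h1 hp.le) (mul_pos h2' hq)
    exact pos_of_mul_pos_right this hD.le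
  -- Both coefficients in Cramer's rule vanish now, so `r` would be `v`.
  exfalso
  have z1 : det v r q = 0 := (mul_eq_zero.1 h1'.symm).resolve_right h
  have z2 : det v p r = 0 := (mul_eq_zero.1 h2'.symm).resolve_right h
  apply hr
  have f0 : det v p q * (r 0 - v 0) = det v r q * (p 0 - v 0) + det v p r * (q 0 - v 0) := by
    unfold det; ring
  have f1 : det v p q * (r 1 - v 1) = det v r q * (p 1 - v 1) + det v p r * (q 1 - v 1) := by
    unfold det; ring
  rw [z1, z2, zero_mul, zero_mul, add_zero] at f0 f1
  exact plane_ext (by linarith [(mul_eq_zero.1 f0).resolve_left h])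
    (by linarith [(mul_eq_zero.1 f1).resolve_left h])

/-! ### Closed polygons as cyclic lists of points -/

/-- The consecutive pairs of a list of points. -/
def pathEdges : List Plane → List (Plane × Plane)
  | a :: b :: l => (a, b) :: pathEdges (b :: l)
  | _ => []

/-- The directed sides of the closed polygon with the given cyclic list of vertices. -/
def cycEdges : List Plane → List (Plane × Plane)
  | [] => []
  | a :: l => pathEdges (a :: l ++ [a])

@[simp] lemma pathEdges_nil : pathEdges [] = [] := rfl
@[simp] lemma pathEdges_singleton (a : Plane) : pathEdges [a] = [] := rfl
@[simp] lemma pathEdges_cons_cons (a b : Plane) (l : List Plane) :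
    pathEdges (a :: b :: l) = (a, b) :: pathEdges (b :: l) := rfl

lemma pathEdges_append (l₁ : List Plane) (b : Plane) (l₂ : List Plane) :
    pathEdges (l₁ ++ b :: l₂) = pathEdges (l₁ ++ [b]) ++ pathEdges (b :: l₂) := by
  induction l₁ with
  | nil => simp
  | cons a l ih =>
    cases l with
    | nil => simp
    | cons c l => simpa using ih

lemma cycEdges_cons (a : Plane) (l : List Plane) :
    cycEdges (a :: l) = pathEdges (a :: l ++ [a]) := rfl

/-- Choosing two vertices `a` and `b` decomposes the polygon into a path from `a` to `b` and a path
back; cutting along the chord closes up each of the two paths. -/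
lemma cycEdges_two (a : Plane) (l₁ : List Plane) (b : Plane) (l₂ : List Plane) :
    cycEdges (a :: l₁ ++ b :: l₂) = pathEdges (a :: l₁ ++ [b]) ++ pathEdges (b :: l₂ ++ [a]) := by
  have := pathEdges_append (a :: l₁) b (l₂ ++ [a])
  simpa [cycEdges] using this

lemma cycEdges_chord (a : Plane) (l : List Plane) (b : Plane) :
    cycEdges (a :: l ++ [b]) = pathEdges (a :: l ++ [b]) ++ [(b, a)] := by
  have := cycEdges_two a l b []
  simpa using this

lemma cycEdges_rotate_perm (a : Plane) (l : List Plane) :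
    (cycEdges (l ++ [a])).Perm (cycEdges (a :: l)) := by
  cases l with
  | nil => simp
  | cons b l =>
    have h1 := cycEdges_two b l a []
    have h2 := cycEdges_two a [] b l
    simp only [List.nil_append, List.cons_append, pathEdges_cons_cons, pathEdges_singleton] at h1 h2 ⊢
    rw [h1, h2]
    exact List.perm_append_comm

lemma cycEdges_append_perm (l₁ l₂ : List Plane) :
    (cycEdges (l₁ ++ l₂)).Perm (cycEdges (l₂ ++ l₁)) := by
  induction l₁ generalizing l₂ with
  | nil => simp
  | cons a l ih =>
    have h1 := (cycEdges_rotate_perm a (l ++ l₂)).symm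
    have h2 := ih (l₂ ++ [a])
    simp only [List.append_assoc, List.cons_append, List.nil_append] at h1 h2 ⊢
    exact h1.trans h2

lemma pathEdges_map_fst (a : Plane) (l : List Plane) (b : Plane) :
    (pathEdges (a :: l ++ [b])).map Prod.fst = a :: l := by
  induction l generalizing a with
  | nil => simp
  | cons c l ih => simpa using ih c

lemma pathEdges_map_snd (a : Plane) (l : List Plane) :
    (pathEdges (a :: l)).map Prod.snd = l := by
  induction l generalizing a with
  | nil => simp
  | cons c l ih => simpa using ih c

lemma cycEdges_map_fst (L : List Plane) : (cycEdges L).map Prod.fst = L := by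
  cases L with
  | nil => rfl
  | cons a l => exact pathEdges_map_fst a l a

lemma cycEdges_map_snd (L : List Plane) : ((cycEdges L).map Prod.snd).Perm L := by
  cases L with
  | nil => exact List.Perm.nil
  | cons a l =>
    have : (cycEdges (a :: l)).map Prod.snd = l ++ [a] := by
      simpa [cycEdges] using pathEdges_map_snd a (l ++ [a])
    rw [this]
    exact List.perm_append_comm (l₂ := [a])

lemma cycEdges_nodup {L : List Plane} (h : L.Nodup) : (cycEdges L).Nodup :=
  List.Nodup.of_map Prod.fst (by rwa [cycEdges_map_fst])

lemma fst_mem_of_mem_cycEdges {L : List Plane} {e : Plane × Plane} (h : e ∈ cycEdges L) :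
    e.1 ∈ L := by
  have := List.mem_map_of_mem (f := Prod.fst) h
  rwa [cycEdges_map_fst] at this

lemma snd_mem_of_mem_cycEdges {L : List Plane} {e : Plane × Plane} (h : e ∈ cycEdges L) :
    e.2 ∈ L := (cycEdges_map_snd L).mem_iff.1 (List.mem_map_of_mem (f := Prod.snd) h)

lemma exists_next {L : List Plane} {v : Plane} (h : v ∈ L) : ∃ q, (v, q) ∈ cycEdges L := by
  rw [← cycEdges_map_fst L] at h
  obtain ⟨⟨a, b⟩, he, rfl⟩ := List.mem_map.1 h
  exact ⟨b, he⟩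

lemma exists_prev {L : List Plane} {v : Plane} (h : v ∈ L) : ∃ p, (p, v) ∈ cycEdges L := by
  rw [← (cycEdges_map_snd L).mem_iff] at h
  obtain ⟨⟨a, b⟩, he, rfl⟩ := List.mem_map.1 h
  exact ⟨a, he⟩

lemma next_unique {L : List Plane} (hL : L.Nodup) {v q q' : Plane} (h : (v, q) ∈ cycEdges L)
    (h' : (v, q') ∈ cycEdges L) : q = q' := by
  have hn : ((cycEdges L).map Prod.fst).Nodup := by rwa [cycEdges_map_fst]
  have := List.inj_on_of_nodup_map hn h h' rfl
  exact (Prod.mk.inj this).2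

lemma prev_unique {L : List Plane} (hL : L.Nodup) {v p p' : Plane} (h : (p, v) ∈ cycEdges L)
    (h' : (p', v) ∈ cycEdges L) : p = p' := by
  have hn : ((cycEdges L).map Prod.snd).Nodup := (cycEdges_map_snd L).nodup_iff.2 hL
  have := List.inj_on_of_nodup_map hn h h' rfl
  exact (Prod.mk.inj this).1

/-- Every polygon can be rotated so that a given vertex comes first. -/
lemma exists_rotation {L : List Plane} {a : Plane} (h : a ∈ L) :
    ∃ l, (a :: l).Perm L ∧ (cycEdges (a :: l)).Perm (cycEdges L) := by
  obtain ⟨s, t, rfl⟩ := List.append_of_mem h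
  refine ⟨t ++ s, ?_, ?_⟩
  · exact (List.perm_append_comm (l₁ := s) (l₂ := a :: t)).symm
  · exact cycEdges_append_perm (a :: t) s

/-- Makes a given side the closing one, which is the position of the chord in the two parts of a cut
polygon. -/
lemma exists_rotation_edge {L : List Plane} {a b : Plane} (hL : L.Nodup) (h2 : 2 ≤ L.length)
    (h : (a, b) ∈ cycEdges L) :
    ∃ l, (b :: l ++ [a]).Perm L ∧ (cycEdges (b :: l ++ [a])).Perm (cycEdges L) := by
  obtain ⟨l, hl, hc⟩ := exists_rotation (snd_mem_of_mem_cycEdges h)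
  simp only at hl hc
  have hlen : (b :: l).length = L.length := hl.length_eq
  rcases List.eq_nil_or_concat l with rfl | ⟨l', c, rfl⟩
  · simp at hlen; omega
  · have hmem : (c, b) ∈ cycEdges L := by
      rw [← hc.mem_iff]
      have := cycEdges_chord b l' c
      simp only [List.cons_append, List.concat_eq_append] at this ⊢
      rw [this]; simp
    have hca := prev_unique hL h hmem
    subst hca
    exact ⟨l', by simpa using hl, by simpa using hc⟩

lemma pathEdges_reverse (L : List Plane) :
    pathEdges L.reverse = ((pathEdges L).map Prod.swap).reverse := by
  induction L with
  | nil => rfl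
  | cons a l ih =>
    cases l with
    | nil => rfl
    | cons b l =>
      have := pathEdges_append l.reverse b [a]
      simp only [List.reverse_cons, List.append_assoc, List.cons_append, List.nil_append] at ih this ⊢
      rw [this, ih]; simp

lemma cycEdges_reverse_perm (L : List Plane) :
    (cycEdges L.reverse).Perm ((cycEdges L).map Prod.swap) := by
  cases L with
  | nil => simp [cycEdges]
  | cons a l =>
    have h1 : (cycEdges (a :: l).reverse).Perm (cycEdges (a :: l.reverse)) := by
      rw [List.reverse_cons]; exact cycEdges_rotate_perm a l.reverse
    refine h1.trans ?_
    have h2 : a :: l.reverse ++ [a] = (a :: l ++ [a]).reverse := by simp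
    rw [cycEdges_cons, cycEdges_cons, h2, pathEdges_reverse]
    exact List.reverse_perm _

lemma mem_cycEdges_reverse {L : List Plane} {a b : Plane} :
    (a, b) ∈ cycEdges L.reverse ↔ (b, a) ∈ cycEdges L := by
  rw [(cycEdges_reverse_perm L).mem_iff, List.mem_map]
  constructor
  · rintro ⟨⟨c, d⟩, h, he⟩
    simp only [Prod.swap_prod_mk, Prod.mk.injEq] at he
    obtain ⟨rfl, rfl⟩ := he; exact h
  · intro h; exact ⟨(b, a), h, rfl⟩

/-! ### Boundary, interior and simple polygons -/

/-- The boundary of the closed polygon with the given cyclic list of vertices. -/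
def bd (L : List Plane) : Set Plane := {x | ∃ e ∈ cycEdges L, x ∈ segment ℝ e.1 e.2}

lemma bd_congr {L L' : List Plane} (h : (cycEdges L).Perm (cycEdges L')) : bd L = bd L' := by
  ext x; simp only [bd, Set.mem_ofPred_eq, h.mem_iff]

lemma bd_reverse (L : List Plane) : bd L.reverse = bd L := by
  ext x
  constructor
  · rintro ⟨⟨a, b⟩, he, hx⟩
    exact ⟨(b, a), mem_cycEdges_reverse.1 he, by rwa [segment_symm]⟩
  · rintro ⟨⟨a, b⟩, he, hx⟩
    exact ⟨(b, a), mem_cycEdges_reverse.2 he, by rwa [segment_symm]⟩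

lemma mem_bd_of_mem {L : List Plane} {v : Plane} (h : v ∈ L) : v ∈ bd L := by
  obtain ⟨q, hq⟩ := exists_next h
  exact ⟨(v, q), hq, left_mem_segment ℝ v q⟩

lemma isCompact_segment' (a b : Plane) : IsCompact (segment ℝ a b) := by
  rw [segment_eq_image]
  exact isCompact_Icc.image (by fun_prop)

lemma isCompact_bd (L : List Plane) : IsCompact (bd L) := by
  have : bd L = ⋃ e ∈ (cycEdges L).toFinset, segment ℝ e.1 e.2 := by
    ext x; simp [bd]
  rw [this]
  exact (cycEdges L).toFinset.isCompact_biUnion fun e _ => isCompact_segment' e.1 e.2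

lemma isClosed_bd (L : List Plane) : IsClosed (bd L) := (isCompact_bd L).isClosed

lemma isPreconnected_segment (a b : Plane) : IsPreconnected (segment ℝ a b) :=
  (convex_segment a b).isPreconnected

/-- The point `a` is listed separately because a path with one vertex has no edges. -/
lemma isPreconnected_pathEdges (a : Plane) (l : List Plane) :
    IsPreconnected ({x | x = a ∨ ∃ e ∈ pathEdges (a :: l), x ∈ segment ℝ e.1 e.2} : Set Plane) := by
  induction l generalizing a with
  | nil => simpa using isPreconnected_singleton
  | cons b l ih =>
    have : ({x | x = a ∨ ∃ e ∈ pathEdges (a :: b :: l), x ∈ segment ℝ e.1 e.2} : Set Plane)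
        = segment ℝ a b ∪ {x | x = b ∨ ∃ e ∈ pathEdges (b :: l), x ∈ segment ℝ e.1 e.2} := by
      ext x
      simp only [Set.mem_ofPred_eq, pathEdges_cons_cons, List.mem_cons, exists_eq_or_imp,
        Set.mem_union]
      constructor
      · rintro (rfl | h | h)
        · exact Or.inl (left_mem_segment ℝ _ _)
        · exact Or.inl h
        · exact Or.inr (Or.inr h)
      · rintro (h | rfl | h)
        · exact Or.inr (Or.inl h)
        · exact Or.inr (Or.inl (right_mem_segment ℝ _ _))
        · exact Or.inr (Or.inr h)
    rw [this]
    exact (isPreconnected_segment a b).union b (right_mem_segment ℝ _ _) (Or.inl rfl) (ih b)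

lemma isPreconnected_bd (L : List Plane) : IsPreconnected (bd L) := by
  cases L with
  | nil => simpa [bd, cycEdges] using isPreconnected_empty
  | cons a l =>
    have := isPreconnected_pathEdges a (l ++ [a])
    convert this using 1
    ext x
    constructor
    · intro h; exact Or.inr h
    · rintro (rfl | h)
      · exact mem_bd_of_mem (by simp)
      · exact h

/-- The points off `B` that lie in a bounded component of the complement of `B`. -/
def ins (B : Set Plane) : Set Plane :=
  {x | x ∉ B ∧ Bornology.IsBounded (connectedComponentIn Bᶜ x)}

lemma inside_eq_ins {n : ℕ} (R : Polygon Plane n) : inside R = ins (R.boundary ℝ) := rfl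

lemma isOpen_ins {B : Set Plane} (hB : IsClosed B) : IsOpen (ins B) := by
  rw [isOpen_iff_forall_mem_open]
  rintro x ⟨hx, hb⟩
  refine ⟨connectedComponentIn Bᶜ x, ?_, hB.isOpen_compl.connectedComponentIn,
    mem_connectedComponentIn hx⟩
  intro y hy
  exact ⟨connectedComponentIn_subset _ _ hy, by rwa [← connectedComponentIn_eq hy]⟩

/-- A simple polygon with vertices in general position. -/
structure SP (L : List Plane) : Prop where
  nodup : L.Nodup
  three_le : 3 ≤ L.length
  gp : GeneralPosition {x | x ∈ L}
  simple : ∀ e ∈ cycEdges L, ∀ e' ∈ cycEdges L, e ≠ e' →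
    segment ℝ e.1 e.2 ∩ segment ℝ e'.1 e'.2 ⊆ ({e.1, e.2} ∩ {e'.1, e'.2} : Set Plane)

lemma SP.congr {L L' : List Plane} (h : SP L) (hp : L'.Perm L)
    (hc : (cycEdges L').Perm (cycEdges L)) : SP L' where
  nodup := hp.nodup_iff.2 h.nodup
  three_le := by rw [hp.length_eq]; exact h.three_le
  gp := by
    have : {x | x ∈ L'} = {x | x ∈ L} := by ext x; exact hp.mem_iff
    rw [this]; exact h.gp
  simple := fun e he e' he' => h.simple e (hc.mem_iff.1 he) e' (hc.mem_iff.1 he')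

lemma SP.reverse {L : List Plane} (h : SP L) : SP L.reverse where
  nodup := List.nodup_reverse.2 h.nodup
  three_le := by simpa using h.three_le
  gp := by simpa using h.gp
  simple := by
    rintro ⟨a, b⟩ he ⟨c, d⟩ he' hne
    have := h.simple (b, a) (mem_cycEdges_reverse.1 he) (d, c) (mem_cycEdges_reverse.1 he')
      (by rintro h; simp only [Prod.mk.injEq] at h; exact hne (by rw [h.1, h.2]))
    simp only at this ⊢
    rwa [segment_symm, segment_symm ℝ c d, Set.pair_comm a b, Set.pair_comm c d]

lemma fst_ne_snd_of_mem_cycEdges {L : List Plane} (hL : L.Nodup) (h2 : 2 ≤ L.length)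
    {a b : Plane} (h : (a, b) ∈ cycEdges L) : a ≠ b := by
  obtain ⟨l, hl, -⟩ := exists_rotation_edge hL h2 h
  have := hl.nodup_iff.2 hL
  rintro rfl
  simp at this

lemma SP.edge_ne {L : List Plane} (h : SP L) {a b : Plane} (he : (a, b) ∈ cycEdges L) : a ≠ b :=
  fst_ne_snd_of_mem_cycEdges h.nodup (by have := h.three_le; omega) he

lemma swap_notMem_of_nodup {L : List Plane} (hL : L.Nodup) (h3 : 3 ≤ L.length) {a b : Plane}
    (he : (a, b) ∈ cycEdges L) : (b, a) ∉ cycEdges L := by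
  intro he'
  obtain ⟨l, hl, hc⟩ := exists_rotation_edge hL (by omega) he
  rw [← hc.mem_iff] at he'
  have hn := hl.nodup_iff.2 hL
  have hlen := hl.length_eq
  cases l with
  | nil => simp at hlen; omega
  | cons c l =>
    have h2 : (b, c) ∈ cycEdges (b :: c :: l ++ [a]) := by simp [cycEdges]
    have := next_unique hn he' h2
    subst this
    simp at hn

lemma SP.swap_notMem {L : List Plane} (h : SP L) {a b : Plane} (he : (a, b) ∈ cycEdges L) :
    (b, a) ∉ cycEdges L := swap_notMem_of_nodup h.nodup h.three_le he

lemma SP.prev_ne_next {L : List Plane} (h : SP L) {p v q : Plane} (hp : (p, v) ∈ cycEdges L)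
    (hq : (v, q) ∈ cycEdges L) : p ≠ q := by
  rintro rfl; exact h.swap_notMem hp hq

lemma SP.det_ne {L : List Plane} (h : SP L) {a b c : Plane}
    (ha : a ∈ L) (hb : b ∈ L) (hc : c ∈ L) (hab : a ≠ b) (hac : a ≠ c) (hbc : b ≠ c) :
    det a b c ≠ 0 := h.gp.det_ne ha hb hc hab hac hbc

lemma SP.det_ne_of_edges {L : List Plane} (h : SP L) {p v q : Plane} (hp : (p, v) ∈ cycEdges L)
    (hq : (v, q) ∈ cycEdges L) : det p v q ≠ 0 :=
  h.det_ne (fst_mem_of_mem_cycEdges hp) (snd_mem_of_mem_cycEdges hp) (snd_mem_of_mem_cycEdges hq)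
    (h.edge_ne hp) (h.prev_ne_next hp hq) (h.edge_ne hq)

/-! ### Winding numbers -/

/-- The plane as the complex numbers. -/
def toC (x : Plane) : ℂ := ⟨x 0, x 1⟩

@[simp] lemma toC_re (x : Plane) : (toC x).re = x 0 := rfl
@[simp] lemma toC_im (x : Plane) : (toC x).im = x 1 := rfl

lemma toC_injective : Function.Injective toC := fun _ _ h =>
  plane_ext (congrArg Complex.re h) (congrArg Complex.im h)

@[fun_prop]
lemma continuous_toC : Continuous toC := by
  have : toC = fun x : Plane => ((x 0 : ℝ) : ℂ) + ((x 1 : ℝ) : ℂ) * Complex.I := by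
    funext x; apply Complex.ext <;> simp
  rw [this]; fun_prop

lemma norm_toC (x : Plane) : ‖toC x‖ = ‖x‖ := by
  rw [Complex.norm_def, EuclideanSpace.norm_eq, Complex.normSq_apply]
  congr 1
  simp [Fin.sum_univ_two, sq]

/-- The position ratio of the endpoints of an edge seen from `x`. -/
noncomputable def ratio (p q x : Plane) : ℂ := (toC q - toC x) / (toC p - toC x)

/-- The oriented angle, as a fraction of a full turn, under which `x` sees the directed edge. -/
noncomputable def turn (p q x : Plane) : ℝ := Complex.arg (ratio p q x) / (2 * Real.pi)

/-- The winding number of a closed polygon around `x`. -/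
noncomputable def wind (L : List Plane) (x : Plane) : ℝ :=
  ((cycEdges L).map fun e => turn e.1 e.2 x).sum

lemma ratio_re (p q x : Plane) : (ratio p q x).re =
    ((q 0 - x 0) * (p 0 - x 0) + (q 1 - x 1) * (p 1 - x 1)) / ((p 0 - x 0) ^ 2 + (p 1 - x 1) ^ 2) := by
  simp [ratio, Complex.div_re, Complex.normSq_apply]; ring

lemma ratio_im (p q x : Plane) : (ratio p q x).im =
    det p q x / ((p 0 - x 0) ^ 2 + (p 1 - x 1) ^ 2) := by
  simp [ratio, Complex.div_im, Complex.normSq_apply, det]; ring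

lemma sqd_pos {p x : Plane} (h : p ≠ x) : 0 < (p 0 - x 0) ^ 2 + (p 1 - x 1) ^ 2 := by
  by_contra hle
  have e0 : p 0 - x 0 = 0 := by nlinarith [sq_nonneg (p 0 - x 0), sq_nonneg (p 1 - x 1)]
  have e1 : p 1 - x 1 = 0 := by nlinarith [sq_nonneg (p 0 - x 0), sq_nonneg (p 1 - x 1)]
  exact h (plane_ext (by linarith) (by linarith))

/-- The ratio is real and not positive only if `p` and `q` lie in opposite directions from `x` or
one of them is `x`, that is, if `x` is on the segment. Off the edge, `turn` therefore avoids the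
branch cut of `Complex.arg`. -/
lemma ratio_mem_slitPlane {p q x : Plane} (h : x ∉ segment ℝ p q) :
    ratio p q x ∈ Complex.slitPlane := by
  have hp : p ≠ x := by rintro rfl; exact h (left_mem_segment ℝ _ _)
  have hpos := sqd_pos hp
  rw [Complex.mem_slitPlane_iff]
  by_contra! hcon
  obtain ⟨hre, him⟩ := hcon
  rw [ratio_im, div_eq_zero_iff] at him
  have hdet : det p q x = 0 := him.resolve_right hpos.ne'
  rw [ratio_re, div_le_iff₀ hpos, zero_mul] at hre
  apply h
  by_cases hpq : p = q
  · subst hpq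
    exfalso; nlinarith
  obtain ⟨t, rfl⟩ := exists_param_of_det_eq_zero hpq hdet
  have hq := sqd_pos (Ne.symm hpq)
  simp only [coord_add_smul, PiLp.sub_apply] at hre
  have key : (1 - t) * (-t) * ((q 0 - p 0) ^ 2 + (q 1 - p 1) ^ 2) ≤ 0 := by
    refine le_trans (le_of_eq ?_) hre; ring
  have : (1 - t) * (-t) ≤ 0 := nonpos_of_mul_nonpos_left key hq
  rw [mem_segment_iff]
  refine ⟨t, ?_, ?_, rfl⟩ <;> nlinarith

lemma continuousAt_ratio {p q x : Plane} (h : p ≠ x) : ContinuousAt (ratio p q) x := by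
  unfold ratio
  refine ContinuousAt.div (by fun_prop) (by fun_prop) ?_
  rw [sub_ne_zero]; exact fun h' => h (toC_injective h')

lemma continuousAt_turn {p q x : Plane} (h : x ∉ segment ℝ p q) : ContinuousAt (turn p q) x := by
  have hp : p ≠ x := by rintro rfl; exact h (left_mem_segment ℝ _ _)
  have h1 : ContinuousAt (fun y => Complex.arg (ratio p q y)) x :=
    ContinuousAt.comp (f := ratio p q) (Complex.continuousAt_arg (ratio_mem_slitPlane h))
      (continuousAt_ratio hp)
  exact h1.div_const _

/-- Inversion changes the sign of the argument except on the branch cut, hence the condition on `x`.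
-/
lemma turn_swap {p q x : Plane} (h : x ∉ segment ℝ p q) : turn q p x = -turn p q x := by
  have e : ratio q p x = (ratio p q x)⁻¹ := by unfold ratio; rw [inv_div]
  unfold turn
  rw [e, Complex.arg_inv, if_neg (Complex.mem_slitPlane_iff_arg.1 (ratio_mem_slitPlane h)).1]
  ring

/-- Every summand is a difference of two arguments up to an integer number of turns, and the
differences telescope. -/
lemma turn_sum_path (x a : Plane) (l : List Plane) (b : Plane) (h : ∀ v ∈ a :: l ++ [b], v ≠ x) :
    ∃ k : ℤ, ((pathEdges (a :: l ++ [b])).map fun e => turn e.1 e.2 x).sum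
      = (Complex.arg (toC b - toC x) - Complex.arg (toC a - toC x)) / (2 * Real.pi) + k := by
  have step : ∀ p q : Plane, p ≠ x → q ≠ x → ∃ k : ℤ,
      turn p q x = (Complex.arg (toC q - toC x) - Complex.arg (toC p - toC x)) / (2 * Real.pi) + k := by
    intro p q hp hq
    have := Complex.arg_div_coe_angle (x := toC q - toC x) (y := toC p - toC x)
      (sub_ne_zero.2 fun h' => hq (toC_injective h')) (sub_ne_zero.2 fun h' => hp (toC_injective h'))
    rw [← Real.Angle.coe_sub, Real.Angle.angle_eq_iff_two_pi_dvd_sub] at this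
    obtain ⟨k, hk⟩ := this
    refine ⟨k, ?_⟩
    unfold turn ratio
    have hpi := Real.pi_pos
    field_simp
    linarith
  induction l generalizing a with
  | nil =>
    obtain ⟨k, hk⟩ := step a b (h a (by simp)) (h b (by simp))
    exact ⟨k, by simpa using hk⟩
  | cons c l ih =>
    obtain ⟨k, hk⟩ := step a c (h a (by simp)) (h c (by simp))
    obtain ⟨m, hm⟩ := ih c (fun v hv => h v (by simp at hv ⊢; tauto))
    refine ⟨k + m, ?_⟩
    simp only [List.cons_append, pathEdges_cons_cons, List.map_cons, List.sum_cons] at hm ⊢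
    rw [hk, hm]; push_cast; ring

lemma exists_int_wind {L : List Plane} {x : Plane} (h : x ∉ L) : ∃ k : ℤ, wind L x = k := by
  cases L with
  | nil => exact ⟨0, by simp [wind, cycEdges]⟩
  | cons a l =>
    obtain ⟨k, hk⟩ := turn_sum_path x a l a (by
      intro v hv; rintro rfl; apply h; simp at hv ⊢; tauto)
    exact ⟨k, by simpa [wind, cycEdges] using hk⟩

lemma wind_congr {L L' : List Plane} (h : (cycEdges L).Perm (cycEdges L')) (x : Plane) :
    wind L x = wind L' x := (h.map _).sum_eq

lemma wind_reverse {L : List Plane} {x : Plane} (h : x ∉ bd L) :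
    wind L.reverse x = -wind L x := by
  have key : ∀ E : List (Plane × Plane), (∀ e ∈ E, x ∉ segment ℝ e.1 e.2) →
      ((E.map Prod.swap).map fun e => turn e.1 e.2 x).sum
        = -(E.map fun e => turn e.1 e.2 x).sum := by
    intro E
    induction E with
    | nil => simp
    | cons e E ih =>
      intro hE
      have h1 := turn_swap (hE e (by simp))
      have h2 := ih fun e' he' => hE e' (by simp [he'])
      simp only [List.map_cons, List.sum_cons, Prod.fst_swap, Prod.snd_swap]
      rw [h1, h2]; ring
  unfold wind
  rw [((cycEdges_reverse_perm L).map _).sum_eq]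
  exact key _ fun e he hx => h ⟨e, he, hx⟩

lemma continuousAt_list_sum {E : List (Plane × Plane)} {x : Plane}
    (h : ∀ e ∈ E, x ∉ segment ℝ e.1 e.2) :
    ContinuousAt (fun y => (E.map fun e => turn e.1 e.2 y).sum) x := by
  induction E with
  | nil => simpa using continuousAt_const
  | cons e E ih =>
    simp only [List.map_cons, List.sum_cons]
    exact (continuousAt_turn (h e (by simp))).add (ih fun e' he' => h e' (by simp [he']))

lemma continuousAt_wind {L : List Plane} {x : Plane} (h : x ∉ bd L) : ContinuousAt (wind L) x :=
  continuousAt_list_sum fun e he hx => h ⟨e, he, hx⟩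

/-- Off the boundary the winding number is continuous with values in the discrete set of integers.
-/
lemma wind_eq_of_preconnected {L : List Plane} {s : Set Plane} (hs : IsPreconnected s)
    (hd : s ⊆ (bd L)ᶜ) {x y : Plane} (hx : x ∈ s) (hy : y ∈ s) : wind L x = wind L y := by
  refine hs.constant_of_mapsTo (T := Set.range ((↑) : ℤ → ℝ)) (f := wind L) ?_ ?_ ?_ hx hy
  · rw [← Set.image_univ]; exact IsDiscrete.univ.image Int.isClosedEmbedding_coe_real.isInducing
  · exact fun z hz => (continuousAt_wind (hd hz)).continuousWithinAt
  · intro z hz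
    obtain ⟨k, hk⟩ := exists_int_wind (fun h' => hd hz (mem_bd_of_mem h'))
    exact ⟨k, hk.symm⟩

/-- Seen from far away the two endpoints nearly coincide: the ratio tends to `1`, where the argument
is continuous and vanishes. -/
lemma eventually_cobounded_turn (p q : Plane) {ε : ℝ} (hε : 0 < ε) :
    ∀ᶠ x in Bornology.cobounded Plane, |turn p q x| < ε := by
  have h1 : Filter.Tendsto (fun x : Plane => toC p - toC x) (Bornology.cobounded Plane)
      (Bornology.cobounded ℂ) := by
    have h2 : Filter.Tendsto (fun x : Plane => ‖x‖ - ‖p‖) (Bornology.cobounded Plane) Filter.atTop :=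
      Filter.tendsto_atTop_add_const_right _ _ tendsto_norm_cobounded_atTop
    rw [← tendsto_norm_atTop_iff_cobounded]
    refine Filter.tendsto_atTop_mono (fun x => ?_) h2
    have := norm_sub_norm_le (toC x) (toC p)
    rw [norm_toC, norm_toC, norm_sub_rev] at this
    exact this
  have h2 : Filter.Tendsto (fun x : Plane => 1 + (toC q - toC p) * (toC p - toC x)⁻¹)
      (Bornology.cobounded Plane) (𝓝 (1 + (toC q - toC p) * 0)) :=
    ((Filter.tendsto_inv₀_cobounded.comp h1).const_mul _).const_add _
  rw [mul_zero, add_zero] at h2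
  have h3 : Filter.Tendsto (fun x : Plane => ratio p q x) (Bornology.cobounded Plane) (𝓝 1) := by
    refine h2.congr' ?_
    have : ∀ᶠ x in Bornology.cobounded Plane, x ≠ p := by
      have : Bornology.IsBounded ({p} : Set Plane) := Bornology.isBounded_singleton
      exact Bornology.isBounded_def.1 this
    filter_upwards [this] with x hx
    have : toC p - toC x ≠ 0 := sub_ne_zero.2 fun h => hx (toC_injective h).symm
    unfold ratio
    field_simp; ring
  have h4 : Filter.Tendsto (fun x : Plane => turn p q x) (Bornology.cobounded Plane) (𝓝 0) := by
    have := ((Complex.continuousAt_arg Complex.one_mem_slitPlane).tendsto.comp h3).div_const (2 * Real.pi)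
    simpa [turn] using this
  have := h4.abs
  rw [abs_zero] at this
  exact this.eventually (gt_mem_nhds hε)

/-- A sum of finitely many small turns is smaller than `1` in absolute value, and it is an integer.
-/
lemma eventually_cobounded_wind (L : List Plane) :
    ∀ᶠ x in Bornology.cobounded Plane, wind L x = 0 := by
  have h0 : ∀ E : List (Plane × Plane), ∀ ε : ℝ, 0 < ε → ∀ᶠ x in Bornology.cobounded Plane,
      |(E.map fun e => turn e.1 e.2 x).sum| < ε := by
    intro E
    induction E with
    | nil => intro ε hε; simp [hε]
    | cons e E ih =>
      intro ε hε
      filter_upwards [eventually_cobounded_turn e.1 e.2 (half_pos hε), ih _ (half_pos hε)] with x h1 h2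
      simp only [List.map_cons, List.sum_cons]
      exact (abs_add_le _ _).trans_lt (by linarith)
  have hb : ∀ᶠ x in Bornology.cobounded Plane, x ∉ bd L :=
    Bornology.isBounded_def.1 (isCompact_bd L).isBounded
  filter_upwards [h0 (cycEdges L) 1 one_pos, hb] with x h1 h2
  obtain ⟨k, hk⟩ := exists_int_wind (L := L) (x := x) (fun h' => h2 (mem_bd_of_mem h'))
  have h3 : |wind L x| < 1 := h1
  rw [hk] at h3 ⊢
  have : |k| < 1 := by exact_mod_cast h3
  rw [Int.abs_lt_one_iff] at this
  simp [this]

/-- Close to an interior point of an edge, the edge is seen under an angle close to a half turn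
from the left and close to minus a half turn from the right. -/
lemma turn_near_edge {p q m : Plane} (hpq : p ≠ q) (hm : m ∈ openSegment ℝ p q) {ε : ℝ}
    (hε : 0 < ε) : ∀ᶠ x in 𝓝 m, (0 < det p q x → |turn p q x - 1 / 2| < ε) ∧
      (det p q x < 0 → |turn p q x + 1 / 2| < ε) := by
  obtain ⟨t, ht0, ht1, rfl⟩ := mem_openSegment_iff.1 hm
  set m := p + t • (q - p) with hmdef
  have hm0 : m 0 = p 0 + t * (q 0 - p 0) := by simp [hmdef]
  have hm1 : m 1 = p 1 + t * (q 1 - p 1) := by simp [hmdef]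
  have hq := sqd_pos hpq.symm
  have hpm : p ≠ m := by
    intro h
    have e0 : t * (q 0 - p 0) = 0 := by have := congrArg (fun z : Plane => z 0) h; simp only [hm0] at this; linarith
    have e1 : t * (q 1 - p 1) = 0 := by have := congrArg (fun z : Plane => z 1) h; simp only [hm1] at this; linarith
    have e0' := (mul_eq_zero.1 e0).resolve_left ht0.ne'
    have e1' := (mul_eq_zero.1 e1).resolve_left ht0.ne'
    rw [e0', e1'] at hq; simp at hq
  have hpos := sqd_pos hpm
  have hre : (ratio p q m).re < 0 := by
    rw [ratio_re]
    apply div_neg_of_neg_of_pos _ hpos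
    rw [hm0, hm1]
    have : 0 < t * (1 - t) * ((q 0 - p 0) ^ 2 + (q 1 - p 1) ^ 2) := by
      have : 0 < 1 - t := by linarith
      positivity
    nlinarith
  have him : (ratio p q m).im = 0 := by
    rw [ratio_im, div_eq_zero_iff]; left; simp [det, hm0, hm1]; ring
  have hc := continuousAt_ratio (q := q) hpm
  have hpi := Real.pi_pos
  have hup := Complex.tendsto_arg_nhdsWithin_im_nonneg_of_re_neg_of_im_zero hre him
  have hdn := Complex.tendsto_arg_nhdsWithin_im_neg_of_re_neg_of_im_zero hre him
  have hδ : 0 < ε * (2 * Real.pi) := by positivity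
  have hup' := (Metric.tendsto_nhds.1 hup _ hδ)
  have hdn' := (Metric.tendsto_nhds.1 hdn _ hδ)
  rw [eventually_nhdsWithin_iff] at hup' hdn'
  have hne : ∀ᶠ x in 𝓝 m, p ≠ x := by
    filter_upwards [isOpen_ne.mem_nhds hpm.symm] with x hx using Ne.symm hx
  filter_upwards [hc.eventually hup', hc.eventually hdn', hne] with x h1 h2 hx
  have hpos' := sqd_pos hx
  constructor
  · intro hd
    have := h1 (show 0 ≤ _ by rw [ratio_im]; positivity)
    rw [Real.dist_eq] at this
    have e : turn p q x - 1 / 2 = ((ratio p q x).arg - Real.pi) / (2 * Real.pi) := by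
      unfold turn; field_simp
    rw [e, abs_div, abs_of_pos (by positivity : 0 < 2 * Real.pi), div_lt_iff₀ (by positivity)]
    exact this
  · intro hd
    have := h2 (show _ < 0 by rw [ratio_im]; exact div_neg_of_neg_of_pos hd hpos')
    rw [Real.dist_eq] at this
    have e : turn p q x + 1 / 2 = ((ratio p q x).arg - -Real.pi) / (2 * Real.pi) := by
      unfold turn; field_simp; ring
    rw [e, abs_div, abs_of_pos (by positivity : 0 < 2 * Real.pi), div_lt_iff₀ (by positivity)]
    exact this

/-- The winding number jumps by one across a side. -/
lemma wind_jump {L : List Plane} (hL : SP L) {p q m : Plane} (he : (p, q) ∈ cycEdges L)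
    (hm : m ∈ openSegment ℝ p q) :
    ∃ k : ℝ, ∀ᶠ x in 𝓝 m, x ∉ bd L → (0 < det p q x → wind L x = k + 1) ∧
      (det p q x < 0 → wind L x = k) := by
  have hpq := hL.edge_ne he
  have hperm := List.perm_cons_erase he
  set E := (cycEdges L).erase (p, q) with hE
  have hnd := cycEdges_nodup hL.nodup
  have hmp : m ≠ p := by
    rintro rfl
    exact hpq ((left_mem_openSegment_iff (𝕜 := ℝ)).1 hm)
  have hmq : m ≠ q := by
    rintro rfl
    exact hpq ((right_mem_openSegment_iff (𝕜 := ℝ)).1 hm)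
  have hEm : ∀ e ∈ E, m ∉ segment ℝ e.1 e.2 := by
    intro e heE hme
    rw [hE, hnd.mem_erase_iff] at heE
    have := (hL.simple (p, q) he e heE.2 heE.1.symm ⟨openSegment_subset_segment ℝ _ _ hm, hme⟩).1
    simp only [Set.mem_insert_iff, Set.mem_singleton_iff] at this
    tauto
  have hcont := continuousAt_list_sum hEm
  have hw : ∀ x, wind L x = turn p q x + (E.map fun e => turn e.1 e.2 x).sum := by
    intro x; unfold wind; rw [(hperm.map _).sum_eq]; simp
  set S : Plane → ℝ := fun y => (E.map fun e => turn e.1 e.2 y).sum with hS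
  have hc' : ∀ᶠ x in 𝓝 m, |S x - S m| < 1 / 8 := by
    have := Metric.tendsto_nhds.1 hcont (1 / 8) (by norm_num)
    simpa [Real.dist_eq] using this
  have ht := turn_near_edge hpq hm (ε := 1 / 8) (by norm_num)
  -- Near `m` the winding number is within `1 / 4` of `S m + 1 / 2` on the left and of `S m - 1 / 2`
  -- on the right. At most one integer is within `1 / 2` of the first value, so the left value and
  -- the right value plus one agree.
  obtain ⟨k, hk⟩ : ∃ k : ℤ, ∀ j : ℤ, |(j : ℝ) - (S m + 1 / 2)| < 1 / 2 → j = k := by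
    refine ⟨round (S m + 1 / 2), fun j hj => ?_⟩
    have h1 := abs_sub_round (S m + 1 / 2)
    have h2 : |(j : ℝ) - round (S m + 1 / 2)| < 1 := by
      have := abs_sub_le (j : ℝ) (S m + 1 / 2) (round (S m + 1 / 2))
      linarith
    have h3 : |j - round (S m + 1 / 2)| < 1 := by exact_mod_cast h2
    rw [Int.abs_lt_one_iff] at h3; omega
  refine ⟨(k : ℝ) - 1, ?_⟩
  filter_upwards [hc', ht] with x h1 h2 hx
  obtain ⟨j, hj⟩ := exists_int_wind (L := L) (x := x) (fun h' => hx (mem_bd_of_mem h'))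
  have hwx : (j : ℝ) = turn p q x + S x := by rw [← hj, hw x]
  constructor
  · intro hd
    have h3 := h2.1 hd
    have := hk j (by
      rw [hwx]; rw [abs_lt] at *; constructor <;> linarith [h1.1, h1.2, h3.1, h3.2])
    rw [hj, this]; ring
  · intro hd
    have h3 := h2.2 hd
    have := hk (j + 1) (by
      push_cast; rw [hwx]; rw [abs_lt] at *; constructor <;> linarith [h1.1, h1.2, h3.1, h3.2])
    rw [hj, ← this]; push_cast; ring

/-! ### The two local sides of a polygon -/

lemma convex_halfplane (c : ℝ) (a b : Plane) : Convex ℝ {x : Plane | 0 < c * det a b x} := by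
  intro x hx y hy s t hs ht hst
  simp only [Set.mem_ofPred_eq] at *
  rw [det_comb a b x y hst]
  rcases hs.eq_or_lt with rfl | hs'
  · have : t = 1 := by linarith
    subst this; simpa using hy
  · nlinarith [mul_pos hs' hx, mul_nonneg ht hy.le]

/-- The open convex cone at `v` spanned by the rays towards `p` and `q`. -/
def cone (v p q : Plane) : Set Plane :=
  {x | 0 < det v q p * det v q x} ∩ {x | 0 < det v p q * det v p x}

/-- The complement of the closed convex cone at `v` spanned by the rays towards `p` and `q`. -/
def cocone (v p q : Plane) : Set Plane :=
  {x | 0 < -det v q p * det v q x} ∪ {x | 0 < -det v p q * det v p x}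

lemma convex_cone (v p q : Plane) : Convex ℝ (cone v p q) :=
  (convex_halfplane _ _ _).inter (convex_halfplane _ _ _)

lemma mem_closure_of_ray {S : Set Plane} {y d : Plane} (h : ∀ᶠ ε : ℝ in 𝓝[>] 0, y + ε • d ∈ S) :
    y ∈ closure S := by
  refine mem_closure_of_tendsto (b := 𝓝[>] (0 : ℝ)) (f := fun ε : ℝ => y + ε • d) ?_ h
  have : ContinuousAt (fun ε : ℝ => y + ε • d) 0 := by fun_prop
  have h2 := this.tendsto
  simp only [zero_smul, add_zero] at h2
  exact h2.mono_left nhdsWithin_le_nhds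

lemma eventually_ray {U : Set Plane} {y : Plane} (d : Plane) (hU : U ∈ 𝓝 y) :
    ∀ᶠ ε : ℝ in 𝓝[>] 0, y + ε • d ∈ U := by
  have : ContinuousAt (fun ε : ℝ => y + ε • d) 0 := by fun_prop
  have h2 := this.tendsto
  simp only [zero_smul, add_zero] at h2
  exact (h2.mono_left nhdsWithin_le_nhds) hU

lemma det_add_smul_add (v p q y : Plane) (ε : ℝ) :
    det v p (y + ε • ((p - v) + (q - v))) = det v p y + ε * det v p q := by
  simp [det]; ring

lemma det_add_smul_add' (v p q y : Plane) (ε : ℝ) :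
    det v q (y + ε • ((p - v) + (q - v))) = det v q y + ε * det v q p := by
  simp [det]; ring

lemma det_neg_add_smul_add (v p q y : Plane) (ε : ℝ) :
    det v p (y + ε • (-((p - v) + (q - v)))) = det v p y - ε * det v p q := by
  simp [det]; ring

lemma det_neg_add_smul_add' (v p q y : Plane) (ε : ℝ) :
    det v q (y + ε • (-((p - v) + (q - v)))) = det v q y - ε * det v q p := by
  simp [det]; ring

/-- From a point of the closed cone, every small step in the direction `(p - v) + (q - v)` leads
into the open cone. The opposite direction serves for `cocone`. -/
lemma mem_closure_cone {v p q y : Plane} (h : det v p q ≠ 0) {U : Set Plane} (hU : U ∈ 𝓝 y)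
    (h1 : 0 ≤ det v q p * det v q y) (h2 : 0 ≤ det v p q * det v p y) :
    y ∈ closure (cone v p q ∩ U) := by
  have h' : det v q p ≠ 0 := by rwa [det_swap, neg_ne_zero]
  apply mem_closure_of_ray (d := (p - v) + (q - v))
  filter_upwards [eventually_ray _ hU, self_mem_nhdsWithin] with ε hε hpos
  refine ⟨⟨?_, ?_⟩, hε⟩
  · simp only [Set.mem_ofPred_eq, det_add_smul_add']
    have := mul_pos (Set.mem_Ioi.1 hpos) (mul_self_pos.2 h')
    nlinarith
  · simp only [Set.mem_ofPred_eq, det_add_smul_add]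
    have := mul_pos (Set.mem_Ioi.1 hpos) (mul_self_pos.2 h)
    nlinarith

lemma mem_closure_cocone {v p q y : Plane} (h : det v p q ≠ 0) {U : Set Plane} (hU : U ∈ 𝓝 y)
    (h1 : det v q p * det v q y ≤ 0 ∨ det v p q * det v p y ≤ 0) :
    y ∈ closure (cocone v p q ∩ U) := by
  have h' : det v q p ≠ 0 := by rwa [det_swap, neg_ne_zero]
  apply mem_closure_of_ray (d := -((p - v) + (q - v)))
  filter_upwards [eventually_ray _ hU, self_mem_nhdsWithin] with ε hε hpos
  refine ⟨?_, hε⟩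
  rcases h1 with h1 | h1
  · left
    simp only [Set.mem_ofPred_eq, det_neg_add_smul_add']
    have := mul_pos (Set.mem_Ioi.1 hpos) (mul_self_pos.2 h')
    nlinarith
  · right
    simp only [Set.mem_ofPred_eq, det_neg_add_smul_add]
    have := mul_pos (Set.mem_Ioi.1 hpos) (mul_self_pos.2 h)
    nlinarith

/-- The set is a union of two convex sets, which share the points close to `v` opposite to the
direction `(p - v) + (q - v)`. -/
lemma isPreconnected_cocone_inter {v p q : Plane} (h : det v p q ≠ 0) {U : Set Plane}
    (hc : Convex ℝ U) (hU : U ∈ 𝓝 v) : IsPreconnected (cocone v p q ∩ U) := by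
  have h' : det v q p ≠ 0 := by rwa [det_swap, neg_ne_zero]
  unfold cocone
  rw [Set.union_inter_distrib_right]
  obtain ⟨ε, hε, hpos⟩ := ((eventually_ray (-((p - v) + (q - v))) hU).and self_mem_nhdsWithin).exists
  have hpos' : 0 < ε := hpos
  refine IsPreconnected.union (v + ε • (-((p - v) + (q - v)))) ⟨?_, hε⟩ ⟨?_, hε⟩
    ((convex_halfplane _ _ _).inter hc).isPreconnected
    ((convex_halfplane _ _ _).inter hc).isPreconnected
  · simp only [Set.mem_ofPred_eq, det_neg_add_smul_add', det_self_outer]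
    nlinarith [mul_pos hpos' (mul_self_pos.2 h')]
  · simp only [Set.mem_ofPred_eq, det_neg_add_smul_add, det_self_outer]
    nlinarith [mul_pos hpos' (mul_self_pos.2 h)]

/-- Points that lie neither in the open cone nor off the closed cone lie on its two rays. -/
lemma cone_trichotomy {v p q : Plane} (h : det v p q ≠ 0) (x : Plane) :
    x ∈ cone v p q ∨ x ∈ cocone v p q ∨ (det v q x = 0 ∧ 0 ≤ det v p q * det v p x) ∨
      (det v p x = 0 ∧ 0 ≤ det v q p * det v q x) := by
  have h' : det v q p ≠ 0 := by rwa [det_swap, neg_ne_zero]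
  by_cases h1 : 0 < -det v q p * det v q x
  · exact Or.inr (Or.inl (Or.inl h1))
  by_cases h2 : 0 < -det v p q * det v p x
  · exact Or.inr (Or.inl (Or.inr h2))
  have h1' : 0 ≤ det v q p * det v q x := by linarith
  have h2' : 0 ≤ det v p q * det v p x := by linarith
  rcases h1'.eq_or_lt with e1 | e1
  · exact Or.inr (Or.inr (Or.inl ⟨(mul_eq_zero.1 e1.symm).resolve_left h', h2'⟩))
  rcases h2'.eq_or_lt with e2 | e2
  · exact Or.inr (Or.inr (Or.inr ⟨(mul_eq_zero.1 e2.symm).resolve_left h, h1'⟩))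
  exact Or.inl ⟨e1, e2⟩

/-- On the line through `v` and `p`, `det v q` is proportional to the parameter, so its sign and its
size decide whether the point lies on the segment. -/
lemma eventually_mem_segment_of_ray {v p q : Plane} (h : det v p q ≠ 0) :
    ∀ᶠ x in 𝓝 v, det v p x = 0 → 0 ≤ det v q p * det v q x → x ∈ segment ℝ v p := by
  have hvp : v ≠ p := by rintro rfl; simp at h
  have h' : det v q p ≠ 0 := by rwa [det_swap, neg_ne_zero]
  have hc : Continuous fun x : Plane => det v q p * det v q x := by fun_prop
  have : ∀ᶠ x in 𝓝 v, det v q p * det v q x < det v q p * det v q p := by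
    refine hc.continuousAt.eventually (gt_mem_nhds ?_)
    simp only [det_self_outer, mul_zero]; exact mul_self_pos.2 h'
  filter_upwards [this] with x hx h0 h1
  obtain ⟨t, rfl⟩ := exists_param_of_det_eq_zero hvp h0
  have e : det v q (v + t • (p - v)) = t * det v q p := by simp [det]; ring
  rw [e] at hx h1
  have hD := mul_self_pos.2 h'
  rw [mem_segment_iff]
  refine ⟨t, ?_, ?_, rfl⟩
  · by_contra hneg; push Not at hneg; nlinarith
  · by_contra hneg; push Not at hneg; nlinarith

lemma ray_nonneg_of_mem_segment {v p q x : Plane} (h : x ∈ segment ℝ v p) :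
    det v p x = 0 ∧ 0 ≤ det v q p * det v q x := by
  refine ⟨det_eq_zero_of_mem_segment h, ?_⟩
  obtain ⟨t, h0, -, rfl⟩ := mem_segment_iff.1 h
  have e : det v q (v + t • (p - v)) = t * det v q p := by simp [det]; ring
  rw [e]; nlinarith [mul_self_nonneg (det v q p)]

lemma eventually_notMem_segments {E : List (Plane × Plane)} {m : Plane}
    (h : ∀ e ∈ E, m ∉ segment ℝ e.1 e.2) :
    ∀ᶠ x in 𝓝 m, ∀ e ∈ E, x ∉ segment ℝ e.1 e.2 := by
  induction E with
  | nil => simp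
  | cons e E ih =>
    have h1 : ∀ᶠ x in 𝓝 m, x ∉ segment ℝ e.1 e.2 :=
      (isCompact_segment' e.1 e.2).isClosed.isOpen_compl.mem_nhds (h e (by simp))
    filter_upwards [h1, ih fun e' he' => h e' (by simp [he'])] with x hx1 hx2
    simpa using ⟨hx1, fun a b hab => hx2 (a, b) hab⟩

/-- Near a vertex, the boundary consists of two segments. -/
lemma SP.bd_near_vertex {L : List Plane} (hL : SP L) {p v q : Plane} (hp : (p, v) ∈ cycEdges L)
    (hq : (v, q) ∈ cycEdges L) :
    ∀ᶠ x in 𝓝 v, x ∈ bd L → x ∈ segment ℝ v p ∨ x ∈ segment ℝ v q := by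
  have hE : ∀ e ∈ (cycEdges L).filter (fun e => e ≠ (p, v) ∧ e ≠ (v, q)), v ∉ segment ℝ e.1 e.2 := by
    intro e he hv
    simp only [ne_eq, Bool.decide_and, decide_not, List.mem_filter, Bool.and_eq_true,
      Bool.not_eq_true', decide_eq_false_iff_not] at he
    obtain ⟨he, h1, h2⟩ := he
    have := (hL.simple e he (p, v) hp h1 ⟨hv, right_mem_segment ℝ _ _⟩).1
    simp only [Set.mem_insert_iff, Set.mem_singleton_iff] at this
    rcases this with h | h
    · apply h2
      have : (v, e.2) ∈ cycEdges L := by rw [h]; exact he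
      rw [← next_unique hL.nodup this hq]
      exact Prod.ext h.symm rfl
    · apply h1
      have : (e.1, v) ∈ cycEdges L := by rw [h]; exact he
      rw [← prev_unique hL.nodup this hp]
      exact Prod.ext rfl h.symm
  filter_upwards [eventually_notMem_segments hE] with x hx hb
  obtain ⟨e, he, hxe⟩ := hb
  by_cases h1 : e = (p, v)
  · subst h1; left; rwa [segment_symm]
  by_cases h2 : e = (v, q)
  · subst h2; right; exact hxe
  exact absurd hxe (hx e (by simp [he, h1, h2]))

/-- Near an interior point of a side, the boundary consists of this side. -/
lemma SP.bd_near_edge {L : List Plane} (hL : SP L) {p q m : Plane} (he : (p, q) ∈ cycEdges L)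
    (hm : m ∈ openSegment ℝ p q) :
    ∀ᶠ x in 𝓝 m, x ∈ bd L → x ∈ segment ℝ p q := by
  have hpq := hL.edge_ne he
  have hE : ∀ e ∈ (cycEdges L).filter (fun e => e ≠ (p, q)), m ∉ segment ℝ e.1 e.2 := by
    intro e heE hv
    simp only [ne_eq, decide_not, List.mem_filter, Bool.not_eq_true', decide_eq_false_iff_not] at heE
    have := (hL.simple (p, q) he e heE.1 (Ne.symm heE.2)
      ⟨openSegment_subset_segment ℝ _ _ hm, hv⟩).1
    simp only [Set.mem_insert_iff, Set.mem_singleton_iff] at this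
    rcases this with rfl | rfl
    · exact hpq ((left_mem_openSegment_iff (𝕜 := ℝ)).1 hm)
    · exact hpq ((right_mem_openSegment_iff (𝕜 := ℝ)).1 hm)
  filter_upwards [eventually_notMem_segments hE] with x hx hb
  obtain ⟨e, he', hxe⟩ := hb
  by_cases h1 : e = (p, q)
  · subst h1; exact hxe
  exact absurd hxe (hx e (by simp [he', h1]))

lemma eventually_mem_openSegment {p q m : Plane} (hpq : p ≠ q) (hm : m ∈ openSegment ℝ p q) :
    ∀ᶠ x in 𝓝 m, det p q x = 0 → x ∈ openSegment ℝ p q := by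
  obtain ⟨t, ht0, ht1, rfl⟩ := mem_openSegment_iff.1 hm
  have hq := sqd_pos hpq.symm
  set N := (q 0 - p 0) ^ 2 + (q 1 - p 1) ^ 2 with hN
  have hc : Continuous fun x : Plane => dotp (q - p) (x - p) := by unfold dotp; fun_prop
  have e : ∀ s : ℝ, dotp (q - p) (p + s • (q - p) - p) = s * N := by
    intro s; simp [dotp, hN]; ring
  have h1 : ∀ᶠ x in 𝓝 (p + t • (q - p)), 0 < dotp (q - p) (x - p) :=
    hc.continuousAt.eventually (lt_mem_nhds (by beta_reduce; rw [e]; positivity))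
  have h2 : ∀ᶠ x in 𝓝 (p + t • (q - p)), dotp (q - p) (x - p) < N :=
    hc.continuousAt.eventually (gt_mem_nhds (by beta_reduce; rw [e]; nlinarith))
  filter_upwards [h1, h2] with x hx1 hx2 h0
  obtain ⟨s, rfl⟩ := exists_param_of_det_eq_zero hpq h0
  rw [e] at hx1 hx2
  exact mem_openSegment_iff.2 ⟨s, by by_contra h; push Not at h; nlinarith,
    by by_contra h; push Not at h; nlinarith, rfl⟩

lemma det_perp (p q y : Plane) (ε : ℝ) :
    det p q (y + ε • (!₂[-(q 1 - p 1), q 0 - p 0] : Plane))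
      = det p q y + ε * ((q 0 - p 0) ^ 2 + (q 1 - p 1) ^ 2) := by
  simp [det]; ring

lemma mem_closure_halfplane {p q y : Plane} (hpq : p ≠ q) {c : ℝ} (hc : c = 1 ∨ c = -1)
    {U : Set Plane} (hU : U ∈ 𝓝 y) (hy : det p q y = 0) :
    y ∈ closure ({x | 0 < c * det p q x} ∩ U) := by
  apply mem_closure_of_ray (d := c • (!₂[-(q 1 - p 1), q 0 - p 0] : Plane))
  filter_upwards [eventually_ray _ hU, self_mem_nhdsWithin] with ε hε hpos
  refine ⟨?_, hε⟩
  have hN := mul_pos (Set.mem_Ioi.1 hpos) (sqd_pos hpq.symm)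
  simp only [Set.mem_ofPred_eq, smul_smul, det_perp, hy]
  rcases hc with rfl | rfl <;> linarith

/-- Near a vertex, the open cone of the two sides and the complement of the closed cone do not meet
the boundary. -/
lemma SP.exists_ball_vertex {L : List Plane} (hL : SP L) {p v q : Plane}
    (hp : (p, v) ∈ cycEdges L) (hq : (v, q) ∈ cycEdges L) :
    ∃ r > 0, (∀ x ∈ Metric.ball v r, x ∈ bd L → x ∈ segment ℝ v p ∨ x ∈ segment ℝ v q) ∧
      cone v p q ∩ Metric.ball v r ⊆ (bd L)ᶜ ∧ cocone v p q ∩ Metric.ball v r ⊆ (bd L)ᶜ := by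
  obtain ⟨r, hr, hball⟩ := Metric.eventually_nhds_iff_ball.1 (hL.bd_near_vertex hp hq)
  refine ⟨r, hr, hball, ?_, ?_⟩
  · rintro x ⟨⟨h1, h2⟩, hxb⟩ hbd
    simp only [Set.mem_ofPred_eq] at h1 h2
    rcases hball x hxb hbd with h | h
    · rw [det_eq_zero_of_mem_segment h] at h2; simp at h2
    · rw [det_eq_zero_of_mem_segment h] at h1; simp at h1
  · rintro x ⟨hx, hxb⟩ hbd
    rcases hball x hxb hbd with h | h
    · have := ray_nonneg_of_mem_segment (q := q) h
      rcases hx with hx | hx <;> simp only [Set.mem_ofPred_eq] at hx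
      · linarith [this.2]
      · rw [this.1] at hx; simp at hx
    · have := ray_nonneg_of_mem_segment (q := p) h
      rcases hx with hx | hx <;> simp only [Set.mem_ofPred_eq] at hx
      · rw [this.1] at hx; simp at hx
      · linarith [this.2]

/-- Locally, the boundary has two sides. -/
lemma SP.two_sides {L : List Plane} (hL : SP L) {y : Plane} (hy : y ∈ bd L) :
    ∃ N₁ N₂ : Set Plane, IsPreconnected N₁ ∧ IsPreconnected N₂ ∧ N₁ ⊆ (bd L)ᶜ ∧ N₂ ⊆ (bd L)ᶜ ∧
      (∀ᶠ x in 𝓝 y, x ∉ bd L → x ∈ N₁ ∪ N₂) ∧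
      (∀ᶠ z in 𝓝 y, z ∈ bd L → z ∈ closure N₁ ∧ z ∈ closure N₂) := by
  -- At a vertex the two sides are `cone` and `cocone` within a small ball; at an inner point of an
  -- edge, treated afterwards, they are two half-balls.
  have hvertex : ∀ v ∈ L, ∃ N₁ N₂ : Set Plane, IsPreconnected N₁ ∧ IsPreconnected N₂ ∧
      N₁ ⊆ (bd L)ᶜ ∧ N₂ ⊆ (bd L)ᶜ ∧
      (∀ᶠ x in 𝓝 v, x ∉ bd L → x ∈ N₁ ∪ N₂) ∧
      (∀ᶠ z in 𝓝 v, z ∈ bd L → z ∈ closure N₁ ∧ z ∈ closure N₂) := by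
    intro v hv
    obtain ⟨p, hp⟩ := exists_prev hv
    obtain ⟨q, hq⟩ := exists_next hv
    have hD : det v p q ≠ 0 := by
      have := hL.det_ne_of_edges hp hq
      rwa [det_swap', neg_ne_zero] at this
    have hD' : det v q p ≠ 0 := by rwa [det_swap, neg_ne_zero]
    obtain ⟨r₀, hr₀, hball₀, hcone, hcocone⟩ := hL.exists_ball_vertex hp hq
    obtain ⟨r, ⟨hr, hball⟩, hrr⟩ : ∃ r, (0 < r ∧ ∀ x ∈ Metric.ball v r,
        (det v p x = 0 → 0 ≤ det v q p * det v q x → x ∈ segment ℝ v p) ∧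
        (det v q x = 0 → 0 ≤ det v p q * det v p x → x ∈ segment ℝ v q)) ∧ r ≤ r₀ := by
      obtain ⟨r, hr, hball⟩ := Metric.eventually_nhds_iff_ball.1
        ((eventually_mem_segment_of_ray hD).and (eventually_mem_segment_of_ray hD'))
      exact ⟨min r r₀, ⟨lt_min hr hr₀, fun x hx =>
        hball x (Metric.ball_subset_ball (min_le_left _ _) hx)⟩, min_le_right _ _⟩
    have hsub : Metric.ball v r ⊆ Metric.ball v r₀ := Metric.ball_subset_ball hrr
    have hnhds : Metric.ball v r ∈ 𝓝 v := Metric.ball_mem_nhds v hr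
    refine ⟨cone v p q ∩ Metric.ball v r, cocone v p q ∩ Metric.ball v r,
      ((convex_cone v p q).inter (convex_ball v r)).isPreconnected,
      isPreconnected_cocone_inter hD (convex_ball v r) hnhds, ?_, ?_, ?_, ?_⟩
    · exact (Set.inter_subset_inter_right _ hsub).trans hcone
    · exact (Set.inter_subset_inter_right _ hsub).trans hcocone
    · filter_upwards [hnhds] with x hx hbd
      rcases cone_trichotomy hD x with h | h | h | h
      · exact Or.inl ⟨h, hx⟩
      · exact Or.inr ⟨h, hx⟩
      · exact absurd ⟨(v, q), hq, (hball x hx).2 h.1 h.2⟩ hbd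
      · refine absurd ⟨(p, v), hp, ?_⟩ hbd
        rw [segment_symm]
        exact (hball x hx).1 h.1 h.2
    · filter_upwards [Metric.isOpen_ball.mem_nhds (Metric.mem_ball_self hr)] with z hz hbd
      have hzn : Metric.ball v r ∈ 𝓝 z := Metric.isOpen_ball.mem_nhds hz
      rcases hball₀ z (hsub hz) hbd with h | h
      · have := ray_nonneg_of_mem_segment (q := q) h
        exact ⟨mem_closure_cone hD hzn this.2 (by rw [this.1]; simp),
          mem_closure_cocone hD hzn (Or.inr (by rw [this.1]; simp))⟩
      · have := ray_nonneg_of_mem_segment (q := p) h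
        exact ⟨mem_closure_cone hD hzn (by rw [this.1]; simp) this.2,
          mem_closure_cocone hD hzn (Or.inl (by rw [this.1]; simp))⟩
  obtain ⟨⟨p, q⟩, he, hye⟩ := hy
  simp only at hye
  rw [← insert_endpoints_openSegment] at hye
  rcases hye with rfl | rfl | hm
  · exact hvertex _ (fst_mem_of_mem_cycEdges he)
  · exact hvertex _ (snd_mem_of_mem_cycEdges he)
  have hpq := hL.edge_ne he
  obtain ⟨r, hr, hball⟩ := Metric.eventually_nhds_iff_ball.1
    ((hL.bd_near_edge he hm).and (eventually_mem_openSegment hpq hm))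
  have hside : ∀ c : ℝ, {x | 0 < c * det p q x} ∩ Metric.ball y r ⊆ (bd L)ᶜ := by
    rintro c x ⟨hx, hxb⟩ hbd
    simp only [Set.mem_ofPred_eq] at hx
    rw [det_eq_zero_of_mem_segment ((hball x hxb).1 hbd)] at hx; simp at hx
  refine ⟨{x | 0 < 1 * det p q x} ∩ Metric.ball y r, {x | 0 < -1 * det p q x} ∩ Metric.ball y r,
    ((convex_halfplane _ _ _).inter (convex_ball y r)).isPreconnected,
    ((convex_halfplane _ _ _).inter (convex_ball y r)).isPreconnected, hside 1, hside (-1), ?_, ?_⟩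
  · filter_upwards [Metric.ball_mem_nhds y hr] with x hx hbd
    rcases lt_trichotomy (det p q x) 0 with h | h | h
    · exact Or.inr ⟨by simp only [Set.mem_ofPred_eq]; linarith, hx⟩
    · exact absurd ⟨(p, q), he, openSegment_subset_segment ℝ _ _ ((hball x hx).2 h)⟩ hbd
    · exact Or.inl ⟨by simp only [Set.mem_ofPred_eq]; linarith, hx⟩
  · filter_upwards [Metric.ball_mem_nhds y hr] with z hz hbd
    have hzn : Metric.ball y r ∈ 𝓝 z := Metric.isOpen_ball.mem_nhds hz
    have h0 := det_eq_zero_of_mem_segment ((hball z hz).1 hbd)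
    exact ⟨mem_closure_halfplane hpq (Or.inl rfl) hzn h0,
      mem_closure_halfplane hpq (Or.inr rfl) hzn h0⟩

/-! ### The Jordan curve theorem -/

/-- The points outside a large square. -/
def farSet (r : ℝ) : Set Plane := {x | r < x 0} ∪ ({x | r < x 1} ∪ ({x | x 0 < -r} ∪ {x | x 1 < -r}))

/-- The set is a union of four half-planes. They are joined one after another, each meeting the
union of those before it. -/
lemma isPreconnected_farSet (r : ℝ) : IsPreconnected (farSet r) := by
  have h0 : Convex ℝ {x : Plane | r < x 0} := by
    intro x hx y hy s t hs ht hst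
    simp only [Set.mem_ofPred_eq, PiLp.add_apply, PiLp.smul_apply, smul_eq_mul] at *
    obtain rfl : s = 1 - t := by linarith
    nlinarith [mul_nonneg hs (sub_pos.2 hx).le, mul_nonneg ht (sub_pos.2 hy).le, mul_pos (sub_pos.2 hx) (sub_pos.2 hy), mul_nonneg hs ht]
  have h1 : Convex ℝ {x : Plane | r < x 1} := by
    intro x hx y hy s t hs ht hst
    simp only [Set.mem_ofPred_eq, PiLp.add_apply, PiLp.smul_apply, smul_eq_mul] at *
    obtain rfl : s = 1 - t := by linarith
    nlinarith [mul_nonneg hs (sub_pos.2 hx).le, mul_nonneg ht (sub_pos.2 hy).le, mul_pos (sub_pos.2 hx) (sub_pos.2 hy), mul_nonneg hs ht]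
  have h2 : Convex ℝ {x : Plane | x 0 < -r} := by
    intro x hx y hy s t hs ht hst
    simp only [Set.mem_ofPred_eq, PiLp.add_apply, PiLp.smul_apply, smul_eq_mul] at *
    obtain rfl : s = 1 - t := by linarith
    nlinarith [mul_nonneg hs (sub_pos.2 hx).le, mul_nonneg ht (sub_pos.2 hy).le, mul_pos (sub_pos.2 hx) (sub_pos.2 hy), mul_nonneg hs ht]
  have h3 : Convex ℝ {x : Plane | x 1 < -r} := by
    intro x hx y hy s t hs ht hst
    simp only [Set.mem_ofPred_eq, PiLp.add_apply, PiLp.smul_apply, smul_eq_mul] at *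
    obtain rfl : s = 1 - t := by linarith
    nlinarith [mul_nonneg hs (sub_pos.2 hx).le, mul_nonneg ht (sub_pos.2 hy).le, mul_pos (sub_pos.2 hx) (sub_pos.2 hy), mul_nonneg hs ht]
  have a23 := h2.isPreconnected.union (!₂[-r - 1, -r - 1] : Plane) (by simp) (by simp) h3.isPreconnected
  have a123 := h1.isPreconnected.union (!₂[-r - 1, r + 1] : Plane) (by simp) (by simp) a23
  exact h0.isPreconnected.union (!₂[r + 1, r + 1] : Plane) (by simp) (by simp) a123

lemma abs_coord_le_norm (x : Plane) (i : Fin 2) : |x i| ≤ ‖x‖ := by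
  simpa using PiLp.norm_apply_le x i

lemma exists_mem_farSet_of_not_isBounded {S : Set Plane} (h : ¬ Bornology.IsBounded S) (r : ℝ) :
    ∃ x ∈ S, x ∈ farSet r := by
  by_contra! hall
  apply h
  rw [isBounded_iff_forall_norm_le]
  refine ⟨2 * |r|, fun x hx => ?_⟩
  have := hall x hx
  simp only [farSet, Set.mem_union, Set.mem_ofPred_eq, not_or, not_lt] at this
  obtain ⟨h1, h2, h3, h4⟩ := this
  rw [EuclideanSpace.norm_eq, Fin.sum_univ_two]
  apply Real.sqrt_le_iff.2
  simp only [Real.norm_eq_abs, sq_abs]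
  have hr : 0 ≤ r := by linarith
  rw [abs_of_nonneg hr]
  constructor
  · linarith
  · nlinarith

lemma not_isBounded_of_farSet_subset {S : Set Plane} {r : ℝ} (h : farSet r ⊆ S) :
    ¬ Bornology.IsBounded S := by
  intro hb
  obtain ⟨C, hC⟩ := isBounded_iff_forall_norm_le.1 hb
  have h1 : (!₂[max r C + 1, 0] : Plane) ∈ S := h (Or.inl (by simp; linarith [le_max_left r C]))
  have h2 := hC _ h1
  have h3 := abs_coord_le_norm (!₂[max r C + 1, 0] : Plane) 0
  simp only [Matrix.cons_val_zero] at h3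
  have := le_abs_self (max r C + 1)
  linarith [le_max_right r C]

lemma exists_farSet_of_eventually {P : Plane → Prop}
    (h : ∀ᶠ x in Bornology.cobounded Plane, P x) : ∃ r : ℝ, ∀ x ∈ farSet r, P x := by
  have h' : Bornology.IsBounded {x | P x}ᶜ := by
    rw [Bornology.isBounded_def, compl_compl]; exact h
  obtain ⟨C, hC⟩ := isBounded_iff_forall_norm_le.1 h'
  refine ⟨C, fun x hx => ?_⟩
  by_contra hP
  have h1 := hC x hP
  have h2 := abs_coord_le_norm x 0
  have h3 := abs_coord_le_norm x 1
  rw [abs_le] at h2 h3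
  rcases hx with hx | hx | hx | hx <;> simp only [Set.mem_ofPred_eq] at hx <;> linarith [h2.1, h2.2, h3.1, h3.2]

/-- The components of an open set are open, so a point of another component has a neighbourhood that
misses this one. -/
lemma closure_component_subset {B : Set Plane} {z : Plane} (hB : IsClosed B) :
    closure (connectedComponentIn Bᶜ z) ∩ Bᶜ ⊆ connectedComponentIn Bᶜ z := by
  rintro x ⟨hx, hxB⟩
  have hop : IsOpen (connectedComponentIn Bᶜ x) := hB.isOpen_compl.connectedComponentIn
  obtain ⟨y, hy1, hy2⟩ := mem_closure_iff.1 hx _ hop (mem_connectedComponentIn hxB)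
  rw [connectedComponentIn_eq hy2, ← connectedComponentIn_eq hy1]
  exact mem_connectedComponentIn hxB

/-- The boundary of a component of the complement of a simple polygon is the whole polygon. -/
lemma SP.bd_subset_closure {L : List Plane} (hL : SP L) {z : Plane} (hz : z ∉ bd L) :
    bd L ⊆ closure (connectedComponentIn (bd L)ᶜ z) := by
  set C := connectedComponentIn (bd L)ᶜ z with hC
  -- If the closure of the component missed the polygon, the component would be open and closed,
  -- hence the whole plane.
  have hne : ∃ y ∈ bd L, y ∈ closure C := by
    by_contra! hcon
    have hcl : closure C ⊆ C := fun x hx =>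
      closure_component_subset (isClosed_bd L) ⟨hx, fun hb => hcon x hb hx⟩
    have hclosed : IsClosed C := closure_subset_iff_isClosed.1 hcl
    have hopen : IsOpen C := (isClosed_bd L).isOpen_compl.connectedComponentIn
    have huniv : C = Set.univ := IsClopen.eq_univ ⟨hclosed, hopen⟩ ⟨z, mem_connectedComponentIn hz⟩
    have hlen := hL.three_le
    obtain ⟨v, hv⟩ : ∃ v, v ∈ L := List.exists_mem_of_length_pos (by omega)
    exact connectedComponentIn_subset _ _ (huniv ▸ Set.mem_univ v : v ∈ C) (mem_bd_of_mem hv)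
  have : PreconnectedSpace (bd L) := Subtype.preconnectedSpace (isPreconnected_bd L)
  -- The polygon is connected, so it suffices that its points in the closure of `C` form a clopen
  -- set. Near such a point, `C` contains one of the two local sides, and each side has all nearby
  -- boundary points in its closure.
  have hclopen : IsClopen {y : bd L | (y : Plane) ∈ closure C} := by
    constructor
    · exact isClosed_closure.preimage continuous_subtype_val
    · rw [isOpen_iff_eventually]
      intro y hy
      obtain ⟨N₁, N₂, p1, p2, s1, s2, h1, h2⟩ := hL.two_sides y.2
      obtain ⟨x, hxC, hx⟩ := (mem_closure_iff_frequently.1 hy).and_eventually h1 |>.exists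
      have hsub : N₁ ⊆ C ∨ N₂ ⊆ C := by
        have e := connectedComponentIn_eq hxC
        rcases hx (connectedComponentIn_subset _ _ hxC) with h | h
        · left; rw [hC, e]; exact p1.subset_connectedComponentIn h s1
        · right; rw [hC, e]; exact p2.subset_connectedComponentIn h s2
      rw [nhds_subtype_eq_comap]
      refine Filter.mem_of_superset (Filter.preimage_mem_comap h2) ?_
      intro w hw
      rcases hsub with h | h
      · exact closure_mono h (hw w.2).1
      · exact closure_mono h (hw w.2).2
  rcases isClopen_iff.1 hclopen with h | h
  · obtain ⟨y, hy, hyC⟩ := hne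
    have : (⟨y, hy⟩ : bd L) ∈ {y : bd L | (y : Plane) ∈ closure C} := hyC
    rw [h] at this; exact absurd this (Set.notMem_empty _)
  · intro y hy
    have : (⟨y, hy⟩ : bd L) ∈ {y : bd L | (y : Plane) ∈ closure C} := by rw [h]; trivial
    exact this

lemma midpoint_mem (p q : Plane) (hpq : p ≠ q) : midpoint ℝ p q ∈ openSegment ℝ p q := by
  have := midpoint_mem_segment (𝕜 := ℝ) p q
  rw [← insert_endpoints_openSegment] at this
  rcases this with h | h | h
  · exact absurd ((midpoint_eq_left_iff ℝ).1 h) hpq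
  · exact absurd ((midpoint_eq_right_iff ℝ).1 h) hpq
  · exact h

lemma SP.exists_edge {L : List Plane} (hL : SP L) : ∃ p q, (p, q) ∈ cycEdges L := by
  have hlen := hL.three_le
  obtain ⟨v, hv⟩ : ∃ v, v ∈ L := List.exists_mem_of_length_pos (by omega)
  obtain ⟨q, hq⟩ := exists_next hv
  exact ⟨v, q, hq⟩

lemma frequently_side {p q m : Plane} (hpq : p ≠ q) (h0 : det p q m = 0) {c : ℝ}
    (hc : c = 1 ∨ c = -1) : ∃ᶠ x in 𝓝 m, 0 < c * det p q x := by
  have := mem_closure_halfplane hpq hc Filter.univ_mem h0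
  rw [Set.inter_univ] at this
  exact mem_closure_iff_frequently.1 this

/-- The Jordan curve theorem for simple polygons in general position. -/
theorem SP.jordan {L : List Plane} (hL : SP L) :
    (∃ σ : ℝ, (σ = 1 ∨ σ = -1) ∧ ∀ x ∉ bd L, wind L x = 0 ∨ wind L x = σ) ∧
    (∀ x ∉ bd L, x ∈ ins (bd L) ↔ wind L x ≠ 0) ∧
    (∀ x ∉ bd L, ∀ y ∉ bd L, wind L x = wind L y →
      connectedComponentIn (bd L)ᶜ x = connectedComponentIn (bd L)ᶜ y) ∧
    (∃ x, x ∈ ins (bd L)) := by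
  obtain ⟨p, q, he⟩ := hL.exists_edge
  have hpq := hL.edge_ne he
  have hm := midpoint_mem p q hpq
  set m := midpoint ℝ p q
  have hms := openSegment_subset_segment ℝ _ _ hm
  have hmB : m ∈ bd L := ⟨(p, q), he, hms⟩
  have hm0 := det_eq_zero_of_mem_segment hms
  obtain ⟨k, hk⟩ := wind_jump hL he hm
  obtain ⟨N₁, N₂, p1, p2, s1, s2, h1, -⟩ := hL.two_sides hmB
  have hnear := (hk.and h1).and (hL.bd_near_edge he hm)
  -- points on the two sides of the edge
  obtain ⟨a, ha, ⟨hak, haN⟩, hab⟩ := ((frequently_side hpq hm0 (Or.inl rfl)).and_eventually hnear).exists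
  obtain ⟨b, hb, ⟨hbk, hbN⟩, hbb⟩ := ((frequently_side hpq hm0 (Or.inr rfl)).and_eventually hnear).exists
  have haB : a ∉ bd L := fun h => by
    have := det_eq_zero_of_mem_segment (hab h); rw [this] at ha; simp at ha
  have hbB : b ∉ bd L := fun h => by
    have := det_eq_zero_of_mem_segment (hbb h); rw [this] at hb; simp at hb
  have hwa := (hak haB).1 (by linarith)
  have hwb := (hbk hbB).2 (by linarith)
  set cc := fun z => connectedComponentIn (bd L)ᶜ z with hcc
  have hwcc : ∀ z ∉ bd L, ∀ x ∈ cc z, wind L x = wind L z := fun z hz x hx =>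
    wind_eq_of_preconnected isPreconnected_connectedComponentIn (connectedComponentIn_subset _ _) hx
      (mem_connectedComponentIn hz)
  have hN : ∀ N : Set Plane, IsPreconnected N → N ⊆ (bd L)ᶜ → ∀ x ∈ N, ∀ y ∈ N, cc x = cc y :=
    fun N hp hs x hx y hy => connectedComponentIn_eq (hp.subset_connectedComponentIn hx hs hy)
  -- Every component comes arbitrarily close to `m`, where it meets one of the two local sides.
  -- These contain `a` and `b`, in different ones because the winding numbers differ, so there are
  -- only two components.
  have htwo : ∀ z ∉ bd L, cc z = cc a ∨ cc z = cc b := by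
    intro z hz
    obtain ⟨x, hx, ⟨-, hxN⟩, -⟩ := ((mem_closure_iff_frequently.1
      (hL.bd_subset_closure hz hmB)).and_eventually hnear).exists
    have hxB := connectedComponentIn_subset _ _ hx
    have ezx : cc z = cc x := connectedComponentIn_eq hx
    rw [ezx]
    have hab : ∀ N : Set Plane, IsPreconnected N → N ⊆ (bd L)ᶜ → a ∈ N → b ∈ N → False := by
      intro N hp hs h h'
      have e := hN N hp hs a h b h'
      have : wind L b = wind L a := hwcc a haB b (by rw [e]; exact mem_connectedComponentIn hbB)
      linarith
    rcases haN haB with ha' | ha' <;> rcases hbN hbB with hb' | hb' <;> rcases hxN hxB with hx' | hx'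
    · exact (hab N₁ p1 s1 ha' hb').elim
    · exact (hab N₁ p1 s1 ha' hb').elim
    · exact Or.inl (hN N₁ p1 s1 x hx' a ha')
    · exact Or.inr (hN N₂ p2 s2 x hx' b hb')
    · exact Or.inr (hN N₁ p1 s1 x hx' b hb')
    · exact Or.inl (hN N₂ p2 s2 x hx' a ha')
    · exact (hab N₂ p2 s2 ha' hb').elim
    · exact (hab N₂ p2 s2 ha' hb').elim
  have hinj : ∀ x ∉ bd L, ∀ y ∉ bd L, wind L x = wind L y → cc x = cc y := by
    intro x hx y hy hxy
    have hval : ∀ z ∉ bd L, (cc z = cc a ∧ wind L z = k + 1) ∨ (cc z = cc b ∧ wind L z = k) := by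
      intro z hz
      rcases htwo z hz with h | h
      · left; refine ⟨h, ?_⟩
        rw [← hwa]; exact hwcc a haB z (by rw [← h]; exact mem_connectedComponentIn hz)
      · right; refine ⟨h, ?_⟩
        rw [← hwb]; exact hwcc b hbB z (by rw [← h]; exact mem_connectedComponentIn hz)
    rcases hval x hx with ⟨h, h'⟩ | ⟨h, h'⟩ <;> rcases hval y hy with ⟨g, g'⟩ | ⟨g, g'⟩
    · rw [h, g]
    · linarith
    · linarith
    · rw [h, g]
  -- the unbounded component
  obtain ⟨r, hr⟩ := exists_farSet_of_eventually ((eventually_cobounded_wind L).and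
    (Bornology.isBounded_def.1 (isCompact_bd L).isBounded))
  have hfar : farSet r ⊆ (bd L)ᶜ := fun x hx => (hr x hx).2
  have hins : ∀ x ∉ bd L, x ∈ ins (bd L) ↔ wind L x ≠ 0 := by
    intro x hx
    constructor
    · rintro ⟨-, hbd⟩ h0
      obtain ⟨y, hy⟩ : ∃ y, y ∈ farSet r := ⟨!₂[r + 1, 0], Or.inl (by simp)⟩
      have e : cc x = cc y := hinj x hx y (hfar hy) (by rw [h0, (hr y hy).1])
      refine not_isBounded_of_farSet_subset (r := r) ?_ hbd
      have := (isPreconnected_farSet r).subset_connectedComponentIn hy hfar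
      exact this.trans (show cc y ⊆ cc x by rw [e])
    · intro h0
      refine ⟨hx, ?_⟩
      by_contra hbd
      obtain ⟨y, hy, hyf⟩ := exists_mem_farSet_of_not_isBounded hbd r
      have := hwcc x hx y hy
      rw [(hr y hyf).1] at this
      exact h0 this.symm
  -- A far point has winding number `0` and lies in the component of `a` or of `b`, where the values
  -- are `k + 1` and `k`.
  have hvals : k = 0 ∨ k = -1 := by
    obtain ⟨y, hy⟩ : ∃ y, y ∈ farSet r := ⟨!₂[r + 1, 0], Or.inl (by simp)⟩
    rcases htwo y (hfar hy) with h | h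
    · right
      have := hwcc a haB y (by rw [← h]; exact mem_connectedComponentIn (hfar hy))
      rw [(hr y hy).1, hwa] at this; linarith
    · left
      have := hwcc b hbB y (by rw [← h]; exact mem_connectedComponentIn (hfar hy))
      rw [(hr y hy).1, hwb] at this; linarith
  refine ⟨?_, hins, hinj, ?_⟩
  · have hw : ∀ z ∉ bd L, wind L z = k + 1 ∨ wind L z = k := by
      intro z hz
      rcases htwo z hz with h | h
      · left; rw [← hwa]; exact hwcc a haB z (by rw [← h]; exact mem_connectedComponentIn hz)
      · right; rw [← hwb]; exact hwcc b hbB z (by rw [← h]; exact mem_connectedComponentIn hz)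
    rcases hvals with rfl | rfl
    · exact ⟨1, Or.inl rfl, fun x hx => by rcases hw x hx with h | h <;> simp [h]⟩
    · exact ⟨-1, Or.inr rfl, fun x hx => by rcases hw x hx with h | h <;> simp [h]⟩
  · rcases hvals with rfl | rfl
    · exact ⟨a, (hins a haB).2 (by rw [hwa]; norm_num)⟩
    · exact ⟨b, (hins b hbB).2 (by rw [hwb]; norm_num)⟩

/-! ### Position of the interior at sides and vertices -/

/-- A simple polygon in general position that is oriented counterclockwise. -/
structure Pos (L : List Plane) : Prop extends SP L where
  wind01 : ∀ x ∉ bd L, wind L x = 0 ∨ wind L x = 1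

lemma SP.pos_or_reverse {L : List Plane} (hL : SP L) : Pos L ∨ Pos L.reverse := by
  obtain ⟨⟨σ, hσ, hw⟩, -⟩ := hL.jordan
  rcases hσ with rfl | rfl
  · exact Or.inl ⟨hL, hw⟩
  · refine Or.inr ⟨hL.reverse, fun x hx => ?_⟩
    rw [bd_reverse] at hx
    rw [wind_reverse hx]
    rcases hw x hx with h | h <;> simp [h]

lemma Pos.congr {L L' : List Plane} (h : Pos L) (hp : L'.Perm L)
    (hc : (cycEdges L').Perm (cycEdges L)) : Pos L' where
  toSP := h.toSP.congr hp hc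
  wind01 := fun x hx => by
    rw [wind_congr hc]; exact h.wind01 x (by rwa [bd_congr hc] at hx)

lemma Pos.mem_ins {L : List Plane} (h : Pos L) {x : Plane} (hx : x ∉ bd L) :
    x ∈ ins (bd L) ↔ wind L x = 1 := by
  rw [h.toSP.jordan.2.1 x hx]
  rcases h.wind01 x hx with h' | h' <;> simp [h']

lemma Pos.notMem_ins {L : List Plane} (h : Pos L) {x : Plane} (hx : x ∉ bd L) :
    x ∉ ins (bd L) ↔ wind L x = 0 := by
  rw [h.toSP.jordan.2.1 x hx, not_not]

lemma SP.component_eq_ins {L : List Plane} (h : SP L) {x : Plane} (hx : x ∈ ins (bd L)) :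
    connectedComponentIn (bd L)ᶜ x = ins (bd L) := by
  obtain ⟨⟨σ, -, hσ⟩, hins, hinj, -⟩ := h.jordan
  have hval : ∀ y ∈ ins (bd L), wind L y = σ := fun y hy =>
    (hσ y hy.1).resolve_left ((hins y hy.1).1 hy)
  ext y
  constructor
  · intro hy
    have hyB := connectedComponentIn_subset _ _ hy
    exact ⟨hyB, by rw [← connectedComponentIn_eq hy]; exact hx.2⟩
  · intro hy
    rw [hinj x hx.1 y hy.1 (by rw [hval x hx, hval y hy])]
    exact mem_connectedComponentIn hy.1

lemma SP.isPreconnected_ins {L : List Plane} (h : SP L) : IsPreconnected (ins (bd L)) := by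
  obtain ⟨x, hx⟩ := h.jordan.2.2.2
  rw [← h.component_eq_ins hx]
  exact isPreconnected_connectedComponentIn

lemma SP.bd_subset_closure_ins {L : List Plane} (h : SP L) : bd L ⊆ closure (ins (bd L)) := by
  obtain ⟨x, hx⟩ := h.jordan.2.2.2
  rw [← h.component_eq_ins hx]
  exact h.bd_subset_closure hx.1

lemma SP.closure_ins_subset {L : List Plane} (h : SP L) :
    closure (ins (bd L)) ⊆ ins (bd L) ∪ bd L := by
  obtain ⟨x, hx⟩ := h.jordan.2.2.2
  intro y hy
  by_cases hyB : y ∈ bd L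
  · exact Or.inr hyB
  · left
    rw [← h.component_eq_ins hx] at hy ⊢
    exact closure_component_subset (isClosed_bd L) ⟨hy, hyB⟩

lemma SP.ins_of_preconnected {L : List Plane} (h : SP L) {S : Set Plane} (hS : IsPreconnected S)
    (hd : S ⊆ (bd L)ᶜ) {x : Plane} (hx : x ∈ S) (hxi : x ∈ ins (bd L)) : S ⊆ ins (bd L) := by
  rw [← h.component_eq_ins hxi]
  exact hS.subset_connectedComponentIn hx hd

lemma SP.not_ins_of_preconnected {L : List Plane} (h : SP L) {S : Set Plane}
    (hS : IsPreconnected S) (hd : S ⊆ (bd L)ᶜ) {x : Plane} (hx : x ∈ S) (hxi : x ∉ ins (bd L)) :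
    ∀ y ∈ S, y ∉ ins (bd L) := fun _ hy hyi => hxi (h.ins_of_preconnected hS hd hy hyi hx)

/-- The interior lies to the left of every side, the exterior to the right. -/
lemma Pos.near_edge {L : List Plane} (h : Pos L) {p q m : Plane} (he : (p, q) ∈ cycEdges L)
    (hm : m ∈ openSegment ℝ p q) : ∀ᶠ x in 𝓝 m, (0 < det p q x → x ∈ ins (bd L)) ∧
      (det p q x < 0 → x ∉ bd L ∧ x ∉ ins (bd L)) := by
  have hpq := h.edge_ne he
  have hm0 := det_eq_zero_of_mem_segment (openSegment_subset_segment ℝ _ _ hm)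
  obtain ⟨k, hk⟩ := wind_jump h.toSP he hm
  have hnear := hk.and (h.toSP.bd_near_edge he hm)
  obtain ⟨a, ha, hak, hab⟩ := ((frequently_side hpq hm0 (Or.inl rfl)).and_eventually hnear).exists
  obtain ⟨b, hb, hbk, hbb⟩ := ((frequently_side hpq hm0 (Or.inr rfl)).and_eventually hnear).exists
  have haB : a ∉ bd L := fun h => by
    have := det_eq_zero_of_mem_segment (hab h); rw [this] at ha; simp at ha
  have hbB : b ∉ bd L := fun h => by
    have := det_eq_zero_of_mem_segment (hbb h); rw [this] at hb; simp at hb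
  have hwa := (hak haB).1 (by linarith)
  have hwb := (hbk hbB).2 (by linarith)
  -- Both `k` and `k + 1` are among the values `0` and `1`.
  have hk0 : k = 0 := by
    rcases h.wind01 a haB with h1 | h1 <;> rcases h.wind01 b hbB with h2 | h2 <;> linarith
  subst hk0
  filter_upwards [hnear] with x hx
  have hxB : det p q x ≠ 0 → x ∉ bd L := fun h0 hb => h0 (det_eq_zero_of_mem_segment (hx.2 hb))
  constructor
  · intro hd
    rw [h.mem_ins (hxB hd.ne'), (hx.1 (hxB hd.ne')).1 hd]; norm_num
  · intro hd
    exact ⟨hxB hd.ne, by rw [h.notMem_ins (hxB hd.ne), (hx.1 (hxB hd.ne)).2 hd]⟩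

/-- At a point `m` of the side `v q` close to `v`, one side of the line lies in the cone and the
other one off the closed cone. The interior is to the left, and the sign of `det p v q` tells which
of the two this is. The local sides at `v` are connected, so one test point in each determines them.
-/
lemma Pos.vertex_aux {L : List Plane} (h : Pos L) {p v q : Plane} (hp : (p, v) ∈ cycEdges L)
    (hq : (v, q) ∈ cycEdges L) {U : Set Plane} (hU : U ∈ 𝓝 v) :
    (∃ x ∈ cone v p q ∩ U, x ∈ ins (bd L) ↔ 0 < det p v q) ∧
    (∃ x ∈ cocone v p q ∩ U, x ∈ ins (bd L) ↔ ¬ 0 < det p v q) := by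
  have hD := h.toSP.det_ne_of_edges hp hq
  have hvq := h.edge_ne hq
  have hD1 : det v q p = det p v q := (det_rot p v q).symm
  have hD2 : det v p q = -det p v q := by rw [det_swap, hD1]
  obtain ⟨t, ht, ht0, ht1⟩ : ∃ t : ℝ, v + t • (q - v) ∈ interior U ∧ 0 < t ∧ t < 1 := by
    have h1 := eventually_ray (q - v) (interior_mem_nhds.2 hU)
    have h2 : ∀ᶠ t : ℝ in 𝓝[>] 0, t < 1 := (gt_mem_nhds one_pos).filter_mono nhdsWithin_le_nhds
    obtain ⟨t, h1, h2, h3⟩ := (h1.and (h2.and self_mem_nhdsWithin)).exists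
    exact ⟨t, h1, h3, h2⟩
  set m := v + t • (q - v) with hm
  have hmo : m ∈ openSegment ℝ v q := mem_openSegment_iff.2 ⟨t, ht0, ht1, rfl⟩
  have hm0 := det_eq_zero_of_mem_segment (openSegment_subset_segment ℝ _ _ hmo)
  have hUm : U ∈ 𝓝 m := mem_interior_iff_mem_nhds.1 ht
  have hpos : ∀ᶠ x in 𝓝 m, 0 < det v p q * det v p x := by
    have hc : Continuous fun x => det v p q * det v p x := by fun_prop
    refine hc.continuousAt.eventually (lt_mem_nhds ?_)
    have e : det v p m = t * det v p q := by simp [hm, det]; ring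
    have hD2' : det v p q ≠ 0 := by rw [hD2]; exact neg_ne_zero.2 hD
    have := mul_pos ht0 (mul_self_pos.2 hD2')
    show 0 < det v p q * det v p m
    rw [e]; linarith
  have hnear := (h.near_edge hq hmo).and (hpos.and hUm)
  obtain ⟨a, ha, haE, haP, haU⟩ := ((frequently_side hvq hm0 (Or.inl rfl)).and_eventually hnear).exists
  obtain ⟨b, hb, hbE, hbP, hbU⟩ := ((frequently_side hvq hm0 (Or.inr rfl)).and_eventually hnear).exists
  have hai := haE.1 (by linarith)
  have hbi := (hbE.2 (by linarith)).2
  rcases hD.lt_or_gt with hneg | hpos'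
  · constructor
    · refine ⟨b, ⟨⟨?_, hbP⟩, hbU⟩, by simp [hbi, hneg.le]⟩
      simp only [Set.mem_ofPred_eq, hD1]; nlinarith
    · refine ⟨a, ⟨Or.inl ?_, haU⟩, by simp [hai, hneg.le]⟩
      simp only [Set.mem_ofPred_eq, hD1]; nlinarith
  · constructor
    · refine ⟨a, ⟨⟨?_, haP⟩, haU⟩, by simp [hai, hpos']⟩
      simp only [Set.mem_ofPred_eq, hD1]; nlinarith
    · refine ⟨b, ⟨Or.inl ?_, hbU⟩, by simp [hbi, hpos']⟩
      simp only [Set.mem_ofPred_eq, hD1]; nlinarith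

/-- At a convex vertex the interior fills the open cone of the sides, at a reflex vertex it fills
the complement of the closed cone. -/
lemma Pos.near_vertex {L : List Plane} (h : Pos L) {p v q : Plane} (hp : (p, v) ∈ cycEdges L)
    (hq : (v, q) ∈ cycEdges L) :
    ∀ᶠ x in 𝓝 v, (x ∈ cone v p q → x ∉ bd L ∧ (x ∈ ins (bd L) ↔ 0 < det p v q)) ∧
      (x ∈ cocone v p q → x ∉ bd L ∧ (x ∈ ins (bd L) ↔ ¬ 0 < det p v q)) := by
  obtain ⟨r, hr, -, hc, hcc⟩ := h.toSP.exists_ball_vertex hp hq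
  have hU := Metric.ball_mem_nhds v hr
  have hD : det v p q ≠ 0 := by
    have := h.toSP.det_ne_of_edges hp hq
    rwa [det_swap', neg_ne_zero] at this
  obtain ⟨⟨a, ha, hai⟩, ⟨b, hb, hbi⟩⟩ := h.vertex_aux hp hq hU
  have key : ∀ S : Set Plane, IsPreconnected S → S ⊆ (bd L)ᶜ → ∀ x ∈ S, ∀ y ∈ S,
      (x ∈ ins (bd L) ↔ y ∈ ins (bd L)) := fun S hS hd x hx y hy =>
    ⟨fun hxi => h.toSP.ins_of_preconnected hS hd hx hxi hy,
      fun hyi => h.toSP.ins_of_preconnected hS hd hy hyi hx⟩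
  filter_upwards [hU] with x hx
  constructor
  · intro hxc
    exact ⟨hc ⟨hxc, hx⟩, (key _ ((convex_cone v p q).inter (convex_ball v r)).isPreconnected hc
      x ⟨hxc, hx⟩ a ha).trans hai⟩
  · intro hxc
    exact ⟨hcc ⟨hxc, hx⟩, (key _ (isPreconnected_cocone_inter hD (convex_ball v r) hU) hcc
      x ⟨hxc, hx⟩ b hb).trans hbi⟩

lemma ray_mem_cone {v p q : Plane} (h : det v p q ≠ 0) {ε : ℝ} (hε : 0 < ε) :
    v + ε • ((p - v) + (q - v)) ∈ cone v p q := by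
  have h' : det v q p ≠ 0 := by rwa [det_swap, neg_ne_zero]
  constructor
  · simp only [Set.mem_ofPred_eq, det_add_smul_add', det_self_outer]
    nlinarith [mul_pos hε (mul_self_pos.2 h')]
  · simp only [Set.mem_ofPred_eq, det_add_smul_add, det_self_outer]
    nlinarith [mul_pos hε (mul_self_pos.2 h)]

/-- Translates the topological definition of a corner into the sign of a determinant: the ray in
question runs in the open cone of the two sides. -/
lemma Pos.corner_iff {L : List Plane} (h : Pos L) {p v q : Plane} (hp : (p, v) ∈ cycEdges L)
    (hq : (v, q) ∈ cycEdges L) :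
    (∀ᶠ ε : ℝ in 𝓝[>] 0, v + ε • ((p - v) + (q - v)) ∈ ins (bd L)) ↔ 0 < det p v q := by
  have hD : det v p q ≠ 0 := by
    have := h.toSP.det_ne_of_edges hp hq
    rwa [det_swap', neg_ne_zero] at this
  have h1 := eventually_ray ((p - v) + (q - v)) (h.near_vertex hp hq)
  constructor
  · intro h2
    obtain ⟨ε, e1, e2, e3⟩ := (h1.and (h2.and self_mem_nhdsWithin)).exists
    exact (e1.1 (ray_mem_cone hD e3)).2.1 e2
  · intro h2
    filter_upwards [h1, self_mem_nhdsWithin] with ε e1 e2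
    exact (e1.1 (ray_mem_cone hD e2)).2.2 h2

/-- An open half-plane at `v` containing `p` and `q` contains the closed cone except for its apex.
-/
lemma mem_cocone_of_dotp_neg {v p q x w : Plane} (hD : det v p q ≠ 0)
    (hp : 0 < dotp w (p - v)) (hq : 0 < dotp w (q - v)) (hx : dotp w (x - v) < 0) :
    x ∈ cocone v p q := by
  by_contra hcon
  simp only [cocone, Set.mem_union, Set.mem_ofPred_eq, not_or, not_lt] at hcon
  have hxv : x ≠ v := by rintro rfl; simp [dotp] at hx
  have := dotp_pos_of_mem_cone hD hxv (by rw [det_swap v x q, det_swap v p q]; linarith)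
    (by linarith) hp hq
  linarith

/-- An exposed vertex is a convex vertex. -/
lemma Pos.det_pos_of_exposed {L : List Plane} (h : Pos L) {p v q : Plane}
    (hp : (p, v) ∈ cycEdges L) (hq : (v, q) ∈ cycEdges L) (he : Exposed {x | x ∈ L} v) :
    0 < det p v q := by
  by_contra hneg
  obtain ⟨hv, w, hw⟩ := he
  have hD : det v p q ≠ 0 := by
    have := h.toSP.det_ne_of_edges hp hq
    rwa [det_swap', neg_ne_zero] at this
  have hpw := hw p (fst_mem_of_mem_cycEdges hp) (h.edge_ne hp)
  have hqw := hw q (snd_mem_of_mem_cycEdges hq) (h.edge_ne hq).symm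
  have hww : 0 < dotp w w := by
    have : w ≠ 0 := by rintro rfl; simp [dotp] at hpw
    have := sqd_pos this
    simp [dotp] at *; nlinarith
  -- The open half-plane behind `v` misses the polygon. If `v` were reflex, this half-plane would
  -- contain interior points near `v`, so all of it would lie in the interior, which is bounded.
  set S : Set Plane := {x | dotp w (x - v) < 0} with hS
  have hSd : S ⊆ (bd L)ᶜ := by
    rintro x hx ⟨⟨a, b⟩, hab, hxs⟩
    have hge : ∀ y ∈ L, 0 ≤ dotp w (y - v) := by
      intro y hy
      by_cases hyv : y = v
      · subst hyv; simp [dotp]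
      · exact (hw y hy hyv).le
    have h1 := hge a (fst_mem_of_mem_cycEdges hab)
    have h2 := hge b (snd_mem_of_mem_cycEdges hab)
    obtain ⟨t, t0, t1, rfl⟩ := mem_segment_iff.1 hxs
    have e : dotp w (a + t • (b - a) - v) = (1 - t) * dotp w (a - v) + t * dotp w (b - v) := by
      simp [dotp]; ring
    simp only [hS, Set.mem_ofPred_eq, e] at hx
    nlinarith [mul_nonneg (sub_nonneg.2 t1) h1, mul_nonneg t0 h2]
  have hray : ∀ t : ℝ, 0 < t → v + t • (-w) ∈ S := by
    intro t ht
    have e : dotp w (v + t • (-w) - v) = -(t * dotp w w) := by simp [dotp]; ring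
    simp only [hS, Set.mem_ofPred_eq, e]
    linarith [mul_pos ht hww]
  have hSc : IsPreconnected S := by
    have : Convex ℝ S := by
      intro x hx y hy s t hs ht hst
      simp only [hS, Set.mem_ofPred_eq] at *
      have e : dotp w (s • x + t • y - v) = s * dotp w (x - v) + t * dotp w (y - v) := by
        obtain rfl : s = 1 - t := by linarith
        simp [dotp]; ring
      rw [e]
      rcases hs.eq_or_lt with rfl | hs'
      · have : t = 1 := by linarith
        subst this; simpa using hy
      · nlinarith [mul_pos hs' (neg_pos.2 hx), mul_nonneg ht (neg_pos.2 hy).le]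
    exact this.isPreconnected
  have h1 := eventually_ray (-w) (h.near_vertex hp hq)
  obtain ⟨ε, e1, e2⟩ := (h1.and self_mem_nhdsWithin).exists
  have e2' : 0 < ε := e2
  have hmem := hray ε e2'
  have hins : v + ε • (-w) ∈ ins (bd L) :=
    (e1.2 (mem_cocone_of_dotp_neg hD hpw hqw hmem)).2.2 hneg
  have hsub := h.toSP.ins_of_preconnected hSc hSd hmem hins
  have hbdd : Bornology.IsBounded S := by
    have := hins.2
    rw [h.toSP.component_eq_ins hins] at this
    exact this.subset hsub
  obtain ⟨C, hC⟩ := isBounded_iff_forall_norm_le.1 hbdd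
  have hwpos : 0 < ‖w‖ := by
    rw [norm_pos_iff]; rintro rfl; simp [dotp] at hww
  -- The point at distance `|C| + ‖v‖ + 1` from `v` has norm larger than `C`.
  have hC0 := hC _ (hray ((|C| + ‖v‖ + 1) / ‖w‖) (by positivity))
  have h3 := norm_sub_norm_le (((|C| + ‖v‖ + 1) / ‖w‖) • w) v
  rw [norm_smul, Real.norm_eq_abs, abs_of_pos (by positivity), div_mul_cancel₀ _ hwpos.ne'] at h3
  rw [smul_neg, ← sub_eq_add_neg, norm_sub_rev] at hC0
  linarith [le_abs_self C]

/-! ### Corners -/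

open scoped Classical in
/-- The corners of a counterclockwise polygon. -/
noncomputable def corners (L : List Plane) : Finset Plane :=
  L.toFinset.filter fun v => ∃ p q, (p, v) ∈ cycEdges L ∧ (v, q) ∈ cycEdges L ∧ 0 < det p v q

lemma mem_corners {L : List Plane} {v : Plane} : v ∈ corners L ↔
    ∃ p q, (p, v) ∈ cycEdges L ∧ (v, q) ∈ cycEdges L ∧ 0 < det p v q := by
  simp only [corners, Finset.mem_filter, List.mem_toFinset, and_iff_right_iff_imp]
  rintro ⟨p, q, hp, -⟩
  exact snd_mem_of_mem_cycEdges hp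

lemma mem_of_mem_corners {L : List Plane} {v : Plane} (h : v ∈ corners L) : v ∈ L := by
  obtain ⟨p, q, hp, -⟩ := mem_corners.1 h
  exact snd_mem_of_mem_cycEdges hp

lemma mem_corners_iff {L : List Plane} (h : L.Nodup) {p v q : Plane} (hp : (p, v) ∈ cycEdges L)
    (hq : (v, q) ∈ cycEdges L) : v ∈ corners L ↔ 0 < det p v q := by
  rw [mem_corners]
  constructor
  · rintro ⟨p', q', hp', hq', hd⟩
    rwa [prev_unique h hp hp', next_unique h hq hq']
  · intro hd; exact ⟨p, q, hp, hq, hd⟩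

lemma corners_congr {L L' : List Plane} (hc : (cycEdges L').Perm (cycEdges L)) :
    corners L' = corners L := by
  ext v; simp only [mem_corners, hc.mem_iff]

lemma Pos.mem_corners_of_exposed {L : List Plane} (h : Pos L) {v : Plane}
    (he : Exposed {x | x ∈ L} v) : v ∈ corners L := by
  obtain ⟨p, hp⟩ := exists_prev (L := L) he.1
  obtain ⟨q, hq⟩ := exists_next (L := L) he.1
  exact mem_corners.2 ⟨p, q, hp, hq, h.det_pos_of_exposed hp hq he⟩

lemma SP.exists_det_ne {L : List Plane} (h : SP L) : ∃ a ∈ L, ∃ b ∈ L, ∃ c ∈ L, det a b c ≠ 0 := by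
  obtain ⟨v, q, hq⟩ := h.exists_edge
  obtain ⟨p, hp⟩ := exists_prev (fst_mem_of_mem_cycEdges hq)
  exact ⟨p, fst_mem_of_mem_cycEdges hp, v, snd_mem_of_mem_cycEdges hp, q,
    snd_mem_of_mem_cycEdges hq, h.det_ne_of_edges hp hq⟩

/-- A simple polygon has at least three corners. -/
lemma Pos.three_le_card_corners {L : List Plane} (h : Pos L) : 3 ≤ (corners L).card := by
  classical
  obtain ⟨a, ha, b, hb, c, hc, hd⟩ := h.toSP.exists_det_ne
  obtain ⟨x, y, z, hx, hy, hz, hxy, hxz, hyz⟩ := exists_three_exposed (V := L.toFinset)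
    (by simpa using ha) (by simpa using hb) (by simpa using hc) hd
  have e : ((L.toFinset : Finset Plane) : Set Plane) = {x | x ∈ L} := by ext; simp
  rw [e] at hx hy hz
  have hsub : ({x, y, z} : Finset Plane) ⊆ corners L := by
    intro w hw
    simp only [Finset.mem_insert, Finset.mem_singleton] at hw
    rcases hw with rfl | rfl | rfl
    · exact h.mem_corners_of_exposed hx
    · exact h.mem_corners_of_exposed hy
    · exact h.mem_corners_of_exposed hz
  have := Finset.card_le_card hsub
  rwa [Finset.card_eq_three.2 ⟨x, y, z, hxy, hxz, hyz, rfl⟩] at this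

/-! ### Polygons indexed by `Fin n` -/

section Bridge

variable {n : ℕ}

lemma pathEdges_eq_zip (a : Plane) (l : List Plane) :
    pathEdges (a :: l) = (a :: l).zip l := by
  induction l generalizing a with
  | nil => rfl
  | cons b l ih => simp [ih]

/-- The link between polygons indexed by `Fin n`, as in the definitions, and lists, for which
rotating, reversing and cutting are easy. -/
lemma cycEdges_ofFn (f : Fin n → Plane) :
    cycEdges (List.ofFn f) = List.ofFn fun i => (f i, f (finRotate n i)) := by
  cases n with
  | zero => simp [cycEdges]
  | succ m =>
    rw [List.ofFn_succ, cycEdges_cons, List.cons_append, pathEdges_eq_zip]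
    apply List.ext_getElem
    · simp
    · intro i h1 h2
      simp only [List.length_ofFn] at h2
      simp only [List.getElem_zip, List.getElem_ofFn]
      congr 1
      · rcases i with _ | i
        · simp
        · rw [List.getElem_cons_succ, List.getElem_append_left (by simpa using h2)]
          simp
      · by_cases him : i < m
        · rw [finRotate_of_lt him, List.getElem_append_left (by simpa using him)]
          simp
        · have : i = m := by omega
          subst this
          rw [finRotate_last']
          simp

lemma mem_cycEdges_ofFn {f : Fin n → Plane} {e : Plane × Plane} :
    e ∈ cycEdges (List.ofFn f) ↔ ∃ i, (f i, f (finRotate n i)) = e := by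
  rw [cycEdges_ofFn, List.mem_ofFn]

lemma boundary_eq_bd (R : Polygon Plane n) : R.boundary ℝ = bd (List.ofFn R.vertices) := by
  ext x
  simp only [Polygon.boundary, Polygon.edgeSet, Set.mem_iUnion, affineSegment_eq_segment, bd,
    mem_cycEdges_ofFn, Set.mem_ofPred_eq]
  constructor
  · rintro ⟨i, hi⟩; exact ⟨_, ⟨i, rfl⟩, hi⟩
  · rintro ⟨_, ⟨i, rfl⟩, hi⟩; exact ⟨i, hi⟩

lemma inside_eq (R : Polygon Plane n) : inside R = ins (bd (List.ofFn R.vertices)) := by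
  rw [inside_eq_ins, boundary_eq_bd]

lemma sp_ofFn_iff (R : Polygon Plane n) :
    SP (List.ofFn R.vertices) ↔ IsSimplePolygon R ∧ GeneralPosition (Set.range R.vertices) := by
  have hset : {x | x ∈ List.ofFn R.vertices} = Set.range R.vertices := by
    ext x; simp [List.mem_ofFn]
  have hedge : (Function.Injective R.vertices) → ((∀ e ∈ cycEdges (List.ofFn R.vertices),
      ∀ e' ∈ cycEdges (List.ofFn R.vertices), e ≠ e' →
      segment ℝ e.1 e.2 ∩ segment ℝ e'.1 e'.2 ⊆ ({e.1, e.2} ∩ {e'.1, e'.2} : Set Plane)) ↔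
      ∀ i j : Fin n, i ≠ j → R.edgeSet ℝ i ∩ R.edgeSet ℝ j ⊆
      ({R i, R (finRotate n i)} ∩ {R j, R (finRotate n j)} : Set Plane)) := by
    intro hinj
    simp only [Polygon.edgeSet, affineSegment_eq_segment]
    constructor
    · intro h i j hij
      exact h _ (mem_cycEdges_ofFn.2 ⟨i, rfl⟩) _ (mem_cycEdges_ofFn.2 ⟨j, rfl⟩)
        fun he => hij (hinj (Prod.mk.inj he).1)
    · intro h e he e' he' hne
      obtain ⟨i, rfl⟩ := mem_cycEdges_ofFn.1 he
      obtain ⟨j, rfl⟩ := mem_cycEdges_ofFn.1 he'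
      exact h i j fun hij => hne (by rw [hij])
  constructor
  · intro h
    have hinj : Function.Injective R.vertices := List.nodup_ofFn.1 h.nodup
    exact ⟨⟨by simpa using h.three_le, hinj, (hedge hinj).1 h.simple⟩, hset ▸ h.gp⟩
  · rintro ⟨h, hg⟩
    exact ⟨List.nodup_ofFn.2 h.injective, by simpa using h.three_le, hset ▸ hg,
      (hedge h.injective).2 h.inter_subset⟩

lemma isCorner_iff_of_pos {R : Polygon Plane n} (h : Pos (List.ofFn R.vertices)) (i : Fin n) :
    IsCorner R i ↔ R i ∈ corners (List.ofFn R.vertices) := by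
  have hp : (R ((finRotate n).symm i), R i) ∈ cycEdges (List.ofFn R.vertices) :=
    mem_cycEdges_ofFn.2 ⟨(finRotate n).symm i, by rw [Equiv.apply_symm_apply]⟩
  have hq : (R i, R (finRotate n i)) ∈ cycEdges (List.ofFn R.vertices) :=
    mem_cycEdges_ofFn.2 ⟨i, rfl⟩
  rw [mem_corners_iff h.nodup hp hq, ← h.corner_iff hp hq, IsCorner, inside_eq,
    add_comm (R (finRotate n i) - R i)]

lemma isCorner_iff_of_pos_reverse {R : Polygon Plane n} (h : Pos (List.ofFn R.vertices).reverse)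
    (i : Fin n) : IsCorner R i ↔ R i ∈ corners (List.ofFn R.vertices).reverse := by
  have hp : (R i, R ((finRotate n).symm i)) ∈ cycEdges (List.ofFn R.vertices).reverse :=
    mem_cycEdges_reverse.2 (mem_cycEdges_ofFn.2 ⟨(finRotate n).symm i, by rw [Equiv.apply_symm_apply]⟩)
  have hq : (R (finRotate n i), R i) ∈ cycEdges (List.ofFn R.vertices).reverse :=
    mem_cycEdges_reverse.2 (mem_cycEdges_ofFn.2 ⟨i, rfl⟩)
  rw [mem_corners_iff h.nodup hq hp, ← h.corner_iff hq hp, IsCorner, inside_eq, bd_reverse]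

lemma ncard_isCorner {R : Polygon Plane n} (hinj : Function.Injective R.vertices) {L : List Plane}
    (hL : ∀ x, x ∈ L → ∃ i, R i = x) (h : ∀ i, IsCorner R i ↔ R i ∈ corners L) :
    {i : Fin n | IsCorner R i}.ncard = (corners L).card := by
  rw [← Set.ncard_coe_finset, ← Set.ncard_image_of_injective _ hinj]
  congr 1
  ext x
  simp only [Set.mem_image, Set.mem_ofPred_eq, Finset.mem_coe]
  constructor
  · rintro ⟨i, hi, rfl⟩; exact (h i).1 hi
  · intro hx
    obtain ⟨i, rfl⟩ := hL x (mem_of_mem_corners hx)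
    exact ⟨i, (h i).2 hx, rfl⟩

/-- The counterclockwise list of vertices of a simple polygon. -/
lemma exists_pos_list {R : Polygon Plane n} (hR : IsSimplePolygon R)
    (hg : GeneralPosition (Set.range R.vertices)) :
    ∃ L, Pos L ∧ bd L = R.boundary ℝ ∧ (corners L).card = {i : Fin n | IsCorner R i}.ncard ∧
      (∀ x, x ∈ L ↔ ∃ i, R i = x) ∧ L.length = n ∧
      ∀ a b, (a, b) ∈ cycEdges L → (∃ i, (R i = a ∧ R (finRotate n i) = b) ∨
        (R i = b ∧ R (finRotate n i) = a)) := by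
  have hsp := (sp_ofFn_iff R).2 ⟨hR, hg⟩
  rcases hsp.pos_or_reverse with h | h
  · refine ⟨_, h, (boundary_eq_bd R).symm, (ncard_isCorner hR.injective ?_ (isCorner_iff_of_pos h)).symm,
      ?_, by simp, ?_⟩
    · intro x hx; exact List.mem_ofFn.1 hx
    · intro x; simp [List.mem_ofFn]
    · intro a b hab
      obtain ⟨i, hi⟩ := mem_cycEdges_ofFn.1 hab
      exact ⟨i, Or.inl (Prod.mk.inj hi)⟩
  · refine ⟨_, h, by rw [bd_reverse, boundary_eq_bd],
      (ncard_isCorner hR.injective ?_ (isCorner_iff_of_pos_reverse h)).symm, ?_, by simp, ?_⟩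
    · intro x hx; rw [List.mem_reverse] at hx; exact List.mem_ofFn.1 hx
    · intro x; simp [List.mem_ofFn]
    · intro a b hab
      obtain ⟨i, hi⟩ := mem_cycEdges_ofFn.1 (mem_cycEdges_reverse.1 hab)
      exact ⟨i, Or.inr (Prod.mk.inj hi)⟩

/-- Every counterclockwise list is the vertex list of a simple polygon. -/
lemma Pos.exists_polygon {L : List Plane} (h : Pos L) :
    ∃ (m : ℕ) (Q : Polygon Plane m), IsPseudoGon (corners L).card Q ∧ inside Q = ins (bd L) ∧
      ∀ i, (Q i, Q (finRotate m i)) ∈ cycEdges L := by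
  set Q : Polygon Plane L.length := ⟨L.get⟩ with hQ
  have e : List.ofFn Q.vertices = L := List.ofFn_get L
  have hsp := (sp_ofFn_iff Q).1 (by rw [e]; exact h.toSP)
  refine ⟨_, Q, ⟨hsp.1, ?_⟩, by rw [inside_eq, e], fun i => ?_⟩
  · refine ncard_isCorner hsp.1.injective ?_ fun i => ?_
    · intro x hx
      rw [← e] at hx
      exact List.mem_ofFn.1 hx
    · have := isCorner_iff_of_pos (R := Q) (by rw [e]; exact h) i
      rwa [e] at this
  · have : (Q i, Q (finRotate L.length i)) ∈ cycEdges (List.ofFn Q.vertices) :=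
      mem_cycEdges_ofFn.2 ⟨i, rfl⟩
    rwa [e] at this

end Bridge

/-! ### Splitting a polygon along a chord -/

section Split

variable {a b : Plane} {l₁ l₂ : List Plane}

lemma mem_cycEdges_split {e : Plane × Plane} : e ∈ cycEdges (a :: l₁ ++ b :: l₂) ↔
    e ∈ pathEdges (a :: l₁ ++ [b]) ∨ e ∈ pathEdges (b :: l₂ ++ [a]) := by
  rw [cycEdges_two, List.mem_append]

lemma mem_cycEdges_part {e : Plane × Plane} : e ∈ cycEdges (a :: l₁ ++ [b]) ↔
    e ∈ pathEdges (a :: l₁ ++ [b]) ∨ e = (b, a) := by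
  rw [cycEdges_chord, List.mem_append, List.mem_singleton]

/-- The chord is traversed once in each direction, and the two contributions cancel. -/
lemma wind_split {x : Plane} (hx : x ∉ segment ℝ a b) :
    wind (a :: l₁ ++ b :: l₂) x = wind (a :: l₁ ++ [b]) x + wind (b :: l₂ ++ [a]) x := by
  unfold wind
  rw [cycEdges_two, cycEdges_chord, cycEdges_chord]
  simp only [List.map_append, List.sum_append, List.map_cons, List.map_nil, List.sum_cons,
    List.sum_nil, add_zero]
  rw [turn_swap hx]; ring

lemma bd_part_subset : bd (a :: l₁ ++ [b]) ⊆ bd (a :: l₁ ++ b :: l₂) ∪ segment ℝ a b := by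
  rintro x ⟨e, he, hx⟩
  rcases mem_cycEdges_part.1 he with h | rfl
  · exact Or.inl ⟨e, mem_cycEdges_split.2 (Or.inl h), hx⟩
  · right; rw [segment_symm]; exact hx

lemma bd_part_subset' : bd (b :: l₂ ++ [a]) ⊆ bd (a :: l₁ ++ b :: l₂) ∪ segment ℝ a b := by
  rintro x ⟨e, he, hx⟩
  rcases mem_cycEdges_part.1 he with h | rfl
  · exact Or.inl ⟨e, mem_cycEdges_split.2 (Or.inr h), hx⟩
  · exact Or.inr hx

lemma bd_split_subset : bd (a :: l₁ ++ b :: l₂) ⊆ bd (a :: l₁ ++ [b]) ∪ bd (b :: l₂ ++ [a]) := by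
  rintro x ⟨e, he, hx⟩
  rcases mem_cycEdges_split.1 he with h | h
  · exact Or.inl ⟨e, mem_cycEdges_part.2 (Or.inl h), hx⟩
  · exact Or.inr ⟨e, mem_cycEdges_part.2 (Or.inl h), hx⟩

lemma segment_subset_bd_part : segment ℝ a b ⊆ bd (a :: l₁ ++ [b]) := fun x hx =>
  ⟨(b, a), mem_cycEdges_part.2 (Or.inr rfl), by rwa [segment_symm]⟩

/-- If two open interiors are disjoint, then one does not meet the boundary of the other. -/
lemma SP.disjoint_ins_bd {L L' : List Plane} (h' : SP L')
    (hd : Disjoint (ins (bd L)) (ins (bd L'))) : Disjoint (ins (bd L)) (bd L') := by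
  rw [Set.disjoint_left]
  intro x hx hx'
  obtain ⟨y, hy, hy'⟩ := mem_closure_iff.1 (h'.bd_subset_closure_ins hx') _
    (isOpen_ins (isClosed_bd L)) hx
  exact Set.disjoint_left.1 hd hy hy'

lemma ins_split_subset (hM : Pos (a :: l₁ ++ b :: l₂)) (h1 : Pos (a :: l₁ ++ [b]))
    (h2 : Pos (b :: l₂ ++ [a])) {x : Plane} (hx : x ∈ ins (bd (a :: l₁ ++ b :: l₂)))
    (hxs : x ∉ segment ℝ a b) :
    x ∈ ins (bd (a :: l₁ ++ [b])) ∨ x ∈ ins (bd (b :: l₂ ++ [a])) := by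
  have hx1 : x ∉ bd (a :: l₁ ++ [b]) := fun h => (bd_part_subset h).elim hx.1 hxs
  have hx2 : x ∉ bd (b :: l₂ ++ [a]) := fun h => (bd_part_subset' h).elim hx.1 hxs
  have hw := (hM.mem_ins hx.1).1 hx
  rw [wind_split hxs] at hw
  rw [h1.mem_ins hx1, h2.mem_ins hx2]
  rcases h1.wind01 x hx1 with h | h
  · right; linarith
  · left; exact h

/-- The two parts of a counterclockwise polygon cut along a chord are counterclockwise. -/
lemma Pos.split (hM : Pos (a :: l₁ ++ b :: l₂)) (h1 : SP (a :: l₁ ++ [b]))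
    (h2 : SP (b :: l₂ ++ [a])) (hab : openSegment ℝ a b ⊆ ins (bd (a :: l₁ ++ b :: l₂))) :
    Pos (a :: l₁ ++ [b]) ∧ Pos (b :: l₂ ++ [a]) ∧
      ins (bd (a :: l₁ ++ [b])) ⊆ ins (bd (a :: l₁ ++ b :: l₂)) ∧
      ins (bd (b :: l₂ ++ [a])) ⊆ ins (bd (a :: l₁ ++ b :: l₂)) ∧
      Disjoint (ins (bd (a :: l₁ ++ [b]))) (ins (bd (b :: l₂ ++ [a]))) := by
  have e1 : (b, a) ∈ cycEdges (a :: l₁ ++ [b]) := mem_cycEdges_part.2 (Or.inr rfl)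
  have e2 : (a, b) ∈ cycEdges (b :: l₂ ++ [a]) := mem_cycEdges_part.2 (Or.inr rfl)
  have hne := h2.edge_ne e2
  have hm := midpoint_mem a b hne
  set m := midpoint ℝ a b
  have hm' : m ∈ openSegment ℝ b a := by rwa [openSegment_symm]
  have hm0 := det_eq_zero_of_mem_segment (openSegment_subset_segment ℝ _ _ hm)
  obtain ⟨k1, hk1⟩ := wind_jump h1 e1 hm'
  obtain ⟨k2, hk2⟩ := wind_jump h2 e2 hm
  have hins : ∀ᶠ x in 𝓝 m, x ∈ ins (bd (a :: l₁ ++ b :: l₂)) :=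
    (isOpen_ins (isClosed_bd _)).mem_nhds (hab hm)
  have hnear := (hk1.and hk2).and (((h1.bd_near_edge e1 hm').and (h2.bd_near_edge e2 hm)).and hins)
  have hsw : ∀ x, det b a x = -det a b x := fun x => by rw [det_swap']
  have hside : ∀ x, det a b x ≠ 0 → x ∉ segment ℝ a b := fun x h0 h =>
    h0 (det_eq_zero_of_mem_segment h)
  obtain ⟨x, hx, ⟨hx1, hx2⟩, ⟨hxb1, hxb2⟩, hxi⟩ :=
    ((frequently_side hne hm0 (Or.inl rfl)).and_eventually hnear).exists
  obtain ⟨y, hy, ⟨hy1, hy2⟩, ⟨hyb1, hyb2⟩, hyi⟩ :=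
    ((frequently_side hne hm0 (Or.inr rfl)).and_eventually hnear).exists
  have hxs := hside x (by intro h0; rw [h0] at hx; simp at hx)
  have hys := hside y (by intro h0; rw [h0] at hy; simp at hy)
  have nx1 : x ∉ bd (a :: l₁ ++ [b]) := fun h => hxs (by rw [segment_symm]; exact hxb1 h)
  have nx2 : x ∉ bd (b :: l₂ ++ [a]) := fun h => hxs (hxb2 h)
  have ny1 : y ∉ bd (a :: l₁ ++ [b]) := fun h => hys (by rw [segment_symm]; exact hyb1 h)
  have ny2 : y ∉ bd (b :: l₂ ++ [a]) := fun h => hys (hyb2 h)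
  have wx1 := (hx1 nx1).2 (by rw [hsw]; linarith)
  have wx2 := (hx2 nx2).1 (by linarith)
  have wy1 := (hy1 ny1).1 (by rw [hsw]; linarith)
  have wy2 := (hy2 ny2).2 (by linarith)
  have wx := (hM.mem_ins hxi.1).1 hxi
  rw [wind_split hxs, wx1, wx2] at wx
  obtain ⟨⟨σ1, hσ1, hw1⟩, -⟩ := h1.jordan
  obtain ⟨⟨σ2, hσ2, hw2⟩, -⟩ := h2.jordan
  have g1 := hw1 x nx1
  have g2 := hw1 y ny1
  have g3 := hw2 x nx2
  have g4 := hw2 y ny2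
  rw [wx1] at g1; rw [wy1] at g2; rw [wx2] at g3; rw [wy2] at g4
  -- The winding number of the whole polygon at `x` gives `k1 + k2 = 0`. A clockwise part would have
  -- `k1 = -1` or `k2 = -1`, and neither number can be positive.
  have hs1 : σ1 = 1 ∧ σ2 = 1 := by
    rcases hσ1 with rfl | rfl <;> rcases hσ2 with rfl | rfl <;> rcases g1 with g1 | g1 <;>
      rcases g2 with g2 | g2 <;> rcases g3 with g3 | g3 <;> rcases g4 with g4 | g4 <;>
      first | exact ⟨rfl, rfl⟩ | (exfalso; linarith)
  obtain ⟨rfl, rfl⟩ := hs1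
  have P1 : Pos (a :: l₁ ++ [b]) := ⟨h1, hw1⟩
  have P2 : Pos (b :: l₂ ++ [a]) := ⟨h2, hw2⟩
  -- A common interior point would have winding number `2` in the whole polygon.
  have hdisj : Disjoint (ins (bd (a :: l₁ ++ [b]))) (ins (bd (b :: l₂ ++ [a]))) := by
    rw [Set.disjoint_left]
    intro z hz1 hz2
    have hzs : z ∉ segment ℝ a b := fun h => hz1.1 (segment_subset_bd_part h)
    have hzB : z ∉ bd (a :: l₁ ++ b :: l₂) := fun h => (bd_split_subset h).elim hz1.1 hz2.1
    have := hM.wind01 z hzB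
    rw [wind_split hzs, (P1.mem_ins hz1.1).1 hz1, (P2.mem_ins hz2.1).1 hz2] at this
    norm_num at this
  refine ⟨P1, P2, ?_, ?_, hdisj⟩
  · intro z hz
    have hz2 := Set.disjoint_left.1 (h2.disjoint_ins_bd hdisj) hz
    have hzs : z ∉ segment ℝ a b := fun h => hz.1 (segment_subset_bd_part h)
    have hzB : z ∉ bd (a :: l₁ ++ b :: l₂) := fun h => (bd_split_subset h).elim hz.1 hz2
    rw [hM.mem_ins hzB, wind_split hzs, (P1.mem_ins hz.1).1 hz,
      (P2.notMem_ins hz2).1 (Set.disjoint_left.1 hdisj hz)]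
    norm_num
  · intro z hz
    have hz1 := Set.disjoint_left.1 (h1.disjoint_ins_bd hdisj.symm) hz
    have hzs : z ∉ segment ℝ a b := fun h => hz1 (segment_subset_bd_part h)
    have hzB : z ∉ bd (a :: l₁ ++ b :: l₂) := fun h => (bd_split_subset h).elim hz1 hz.1
    rw [hM.mem_ins hzB, wind_split hzs, (P2.mem_ins hz.1).1 hz,
      (P1.notMem_ins hz1).1 (Set.disjoint_right.1 hdisj hz)]
    norm_num

/-- Merging two counterclockwise polygons with disjoint interiors along a common side. -/
lemma Pos.merge (hM : SP (a :: l₁ ++ b :: l₂)) (h1 : Pos (a :: l₁ ++ [b]))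
    (h2 : Pos (b :: l₂ ++ [a]))
    (hdisj : Disjoint (ins (bd (a :: l₁ ++ [b]))) (ins (bd (b :: l₂ ++ [a])))) :
    Pos (a :: l₁ ++ b :: l₂) ∧ ins (bd (a :: l₁ ++ [b])) ⊆ ins (bd (a :: l₁ ++ b :: l₂)) := by
  -- Inside the first part the second one contributes nothing, so the sum of the winding numbers is
  -- `1`; this also fixes the orientation of the union.
  have key : ∀ z ∈ ins (bd (a :: l₁ ++ [b])),
      z ∉ bd (a :: l₁ ++ b :: l₂) ∧ wind (a :: l₁ ++ b :: l₂) z = 1 := by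
    intro z hz
    have hz2 := Set.disjoint_left.1 (h2.toSP.disjoint_ins_bd hdisj) hz
    have hzs : z ∉ segment ℝ a b := fun h => hz.1 (segment_subset_bd_part h)
    have hzB : z ∉ bd (a :: l₁ ++ b :: l₂) := fun h => (bd_split_subset h).elim hz.1 hz2
    refine ⟨hzB, ?_⟩
    rw [wind_split hzs, (h1.mem_ins hz.1).1 hz,
      (h2.notMem_ins hz2).1 (Set.disjoint_left.1 hdisj hz)]
    norm_num
  obtain ⟨⟨σ, hσ, hw⟩, hins, -⟩ := hM.jordan
  obtain ⟨z, hz⟩ := h1.toSP.jordan.2.2.2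
  have hσ1 : σ = 1 := by
    rcases hw z (key z hz).1 with h | h
    · rw [(key z hz).2] at h; norm_num at h
    · rw [← h, (key z hz).2]
  subst hσ1
  refine ⟨⟨hM, hw⟩, fun x hx => ?_⟩
  rw [hins x (key x hx).1, (key x hx).2]; norm_num

lemma nodup_parts (h : (a :: l₁ ++ b :: l₂).Nodup) :
    (a :: l₁ ++ [b]).Nodup ∧ (b :: l₂ ++ [a]).Nodup ∧ a ≠ b ∧ a ∉ l₁ ∧ b ∉ l₁ ∧ a ∉ l₂ ∧ b ∉ l₂ := by
  simp only [List.cons_append, List.nodup_cons, List.mem_append, List.mem_cons, not_or,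
    List.nodup_append, List.not_mem_nil, List.nodup_nil] at h ⊢
  obtain ⟨⟨ha1, hab, ha2⟩, hl1, ⟨hb2, hl2⟩, hd⟩ := h
  refine ⟨⟨⟨ha1, hab, not_false⟩, hl1, ⟨not_false, trivial⟩, ?_⟩,
    ⟨⟨hb2, Ne.symm hab, not_false⟩, hl2, ⟨not_false, trivial⟩, ?_⟩, hab, ha1, ?_, ha2, hb2⟩
  · intro c hc d hd'
    rcases hd' with rfl | h
    · exact hd c hc _ (Or.inl rfl)
    · exact h.elim
  · intro c hc d hd'
    rcases hd' with rfl | h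
    · rintro rfl; exact ha2 hc
    · exact h.elim
  · intro h; exact hd b h b (Or.inl rfl) rfl

lemma mem_corners_part (h : (a :: l₁ ++ b :: l₂).Nodup) {x : Plane} (hx : x ∈ l₁) :
    x ∈ corners (a :: l₁ ++ [b]) ↔ x ∈ corners (a :: l₁ ++ b :: l₂) := by
  obtain ⟨n1, -, hab, ha1, hb1, -, -⟩ := nodup_parts h
  obtain ⟨p, hp⟩ := exists_prev (L := a :: l₁ ++ [b]) (v := x) (by simp [hx])
  obtain ⟨q, hq⟩ := exists_next (L := a :: l₁ ++ [b]) (v := x) (by simp [hx])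
  have hp' : (p, x) ∈ cycEdges (a :: l₁ ++ b :: l₂) := by
    rcases mem_cycEdges_part.1 hp with h | h
    · exact mem_cycEdges_split.2 (Or.inl h)
    · rw [(Prod.mk.inj h).2] at hx; exact absurd hx ha1
  have hq' : (x, q) ∈ cycEdges (a :: l₁ ++ b :: l₂) := by
    rcases mem_cycEdges_part.1 hq with h | h
    · exact mem_cycEdges_split.2 (Or.inl h)
    · rw [(Prod.mk.inj h).1] at hx; exact absurd hx hb1
  rw [mem_corners_iff n1 hp hq, mem_corners_iff h hp' hq']

lemma cycEdges_split_comm : (cycEdges (b :: l₂ ++ a :: l₁)).Perm (cycEdges (a :: l₁ ++ b :: l₂)) :=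
  cycEdges_append_perm (b :: l₂) (a :: l₁)

lemma mem_corners_part' (h : (a :: l₁ ++ b :: l₂).Nodup) {x : Plane} (hx : x ∈ l₂) :
    x ∈ corners (b :: l₂ ++ [a]) ↔ x ∈ corners (a :: l₁ ++ b :: l₂) := by
  have h' : (b :: l₂ ++ a :: l₁).Nodup := List.perm_append_comm.nodup_iff.1 h
  rw [mem_corners_part h' hx, corners_congr cycEdges_split_comm]

open scoped Classical in
lemma card_corners_eq_countP {L : List Plane} (h : L.Nodup) :
    (corners L).card = L.countP fun v => v ∈ corners L := by
  rw [List.countP_eq_length_filter, ← List.toFinset_card_of_nodup (h.filter _), List.toFinset_filter]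
  congr 1
  ext v
  simp only [decide_eq_true_eq, Finset.mem_filter, List.mem_toFinset]
  exact ⟨fun hv => ⟨mem_of_mem_corners hv, hv⟩, fun hv => hv.2⟩

open scoped Classical in
/-- The numbers of corners of a polygon and of its two parts differ only at the ends of the
chord. -/
lemma card_corners_split (h : (a :: l₁ ++ b :: l₂).Nodup) : ∃ c₁ c₂ : ℕ,
    (corners (a :: l₁ ++ b :: l₂)).card = c₁ + c₂ +
      (if a ∈ corners (a :: l₁ ++ b :: l₂) then 1 else 0) +
      (if b ∈ corners (a :: l₁ ++ b :: l₂) then 1 else 0) ∧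
    (corners (a :: l₁ ++ [b])).card = c₁ + (if a ∈ corners (a :: l₁ ++ [b]) then 1 else 0) +
      (if b ∈ corners (a :: l₁ ++ [b]) then 1 else 0) ∧
    (corners (b :: l₂ ++ [a])).card = c₂ + (if a ∈ corners (b :: l₂ ++ [a]) then 1 else 0) +
      (if b ∈ corners (b :: l₂ ++ [a]) then 1 else 0) := by
  obtain ⟨n1, n2, -⟩ := nodup_parts h
  refine ⟨l₁.countP fun v => v ∈ corners (a :: l₁ ++ b :: l₂),
    l₂.countP fun v => v ∈ corners (a :: l₁ ++ b :: l₂), ?_, ?_, ?_⟩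
  · rw [card_corners_eq_countP h, List.countP_append, List.countP_cons, List.countP_cons]
    simp only [decide_eq_true_eq]; ring
  · have e : (l₁.countP fun v => v ∈ corners (a :: l₁ ++ [b]))
        = l₁.countP fun v => v ∈ corners (a :: l₁ ++ b :: l₂) :=
      List.countP_congr fun x hx => by simpa using mem_corners_part h hx
    rw [card_corners_eq_countP n1, List.countP_append, List.countP_cons, List.countP_cons, e]
    simp only [decide_eq_true_eq, List.countP_nil]; ring
  · have e : (l₂.countP fun v => v ∈ corners (b :: l₂ ++ [a]))
        = l₂.countP fun v => v ∈ corners (a :: l₁ ++ b :: l₂) :=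
      List.countP_congr fun x hx => by simpa using mem_corners_part' h hx
    rw [card_corners_eq_countP n2, List.countP_append, List.countP_cons, List.countP_cons, e]
    simp only [decide_eq_true_eq, List.countP_nil]; ring

/-- The sides at an end of the chord. -/
lemma exists_sides_at_chord (h : (a :: l₁ ++ b :: l₂).Nodup) : ∃ p q,
    (p, a) ∈ cycEdges (a :: l₁ ++ b :: l₂) ∧ (a, q) ∈ cycEdges (a :: l₁ ++ b :: l₂) ∧
    (b, a) ∈ cycEdges (a :: l₁ ++ [b]) ∧ (a, q) ∈ cycEdges (a :: l₁ ++ [b]) ∧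
    (p, a) ∈ cycEdges (b :: l₂ ++ [a]) ∧ (a, b) ∈ cycEdges (b :: l₂ ++ [a]) := by
  obtain ⟨n1, n2, hab, -⟩ := nodup_parts h
  obtain ⟨q, hq⟩ := exists_next (L := a :: l₁ ++ [b]) (v := a) (by simp)
  obtain ⟨p, hp⟩ := exists_prev (L := b :: l₂ ++ [a]) (v := a) (by simp)
  refine ⟨p, q, ?_, ?_, mem_cycEdges_part.2 (Or.inr rfl), hq, hp, mem_cycEdges_part.2 (Or.inr rfl)⟩
  · rcases mem_cycEdges_part.1 hp with h | h
    · exact mem_cycEdges_split.2 (Or.inr h)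
    · exact absurd (Prod.mk.inj h).2 hab
  · rcases mem_cycEdges_part.1 hq with h | h
    · exact mem_cycEdges_split.2 (Or.inl h)
    · exact absurd (Prod.mk.inj h).1 hab

end Split

/-! ### Systems of segments without crossings -/

/-- Two segments of the system meet only in common endpoints. -/
def Compat (J : Plane → Plane → Prop) : Prop :=
  ∀ a b c d x : Plane, J a b → J c d → x ∈ segment ℝ a b → x ∈ segment ℝ c d →
    s(a, b) = s(c, d) ∨ ((x = a ∨ x = b) ∧ (x = c ∨ x = d))

/-- The way to see that the polygons produced by cutting and merging are simple: their sides belong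
to a system in which nothing crosses. -/
lemma Compat.sp {J : Plane → Plane → Prop} (hJ : Compat J) {L : List Plane} (hn : L.Nodup)
    (h3 : 3 ≤ L.length) (hg : GeneralPosition {x | x ∈ L})
    (hL : ∀ e ∈ cycEdges L, J e.1 e.2) : SP L where
  nodup := hn
  three_le := h3
  gp := hg
  simple := by
    rintro ⟨a, b⟩ he ⟨c, d⟩ he' hne x ⟨hx, hx'⟩
    rcases hJ a b c d x (hL _ he) (hL _ he') hx hx' with h | h
    · exfalso
      rw [Sym2.eq_iff] at h
      rcases h with ⟨rfl, rfl⟩ | ⟨rfl, rfl⟩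
      · exact hne rfl
      · exact swap_notMem_of_nodup hn h3 he he'
    · simpa using h

lemma SP.compat {L : List Plane} (h : SP L) :
    Compat fun a b => (a, b) ∈ cycEdges L ∨ (b, a) ∈ cycEdges L := by
  have key : ∀ a b c d x : Plane, (a, b) ∈ cycEdges L → (c, d) ∈ cycEdges L →
      x ∈ segment ℝ a b → x ∈ segment ℝ c d →
      s(a, b) = s(c, d) ∨ ((x = a ∨ x = b) ∧ (x = c ∨ x = d)) := by
    intro a b c d x h1 h2 hx hx'
    by_cases hne : ((a, b) : Plane × Plane) = (c, d)
    · left; rw [(Prod.mk.inj hne).1, (Prod.mk.inj hne).2]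
    · right; simpa using h.simple _ h1 _ h2 hne ⟨hx, hx'⟩
  rintro a b c d x (h1 | h1) (h2 | h2) hx hx'
  · exact key a b c d x h1 h2 hx hx'
  · rw [segment_symm] at hx'
    have := key a b d c x h1 h2 hx hx'
    rw [Sym2.eq_swap (a := c)]; tauto
  · rw [segment_symm] at hx
    have := key b a c d x h1 h2 hx hx'
    rw [Sym2.eq_swap (a := a)]; tauto
  · rw [segment_symm] at hx hx'
    have := key b a d c x h1 h2 hx hx'
    rw [Sym2.eq_swap (a := a), Sym2.eq_swap (a := c)]; tauto

/-- Adding a chord to a system of segments whose interior avoids all segments. -/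
lemma Compat.insert {J : Plane → Plane → Prop} (hJ : Compat J) {S : Set Plane}
    (hS : GeneralPosition S) (hmem : ∀ a b, J a b → a ∈ S ∧ b ∈ S) {u v : Plane} (hu : u ∈ S)
    (hv : v ∈ S) (hd : ∀ a b x, J a b → x ∈ segment ℝ a b → x ∉ openSegment ℝ u v) :
    Compat fun a b => J a b ∨ s(a, b) = s(u, v) := by
  have key : ∀ a b x, J a b → x ∈ segment ℝ a b → x ∈ segment ℝ u v →
      (x = a ∨ x = b) ∧ (x = u ∨ x = v) := by
    intro a b x hab hx hx'
    have h1 : x = u ∨ x = v := by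
      rw [← insert_endpoints_openSegment] at hx'
      rcases hx' with h | h | h
      · exact Or.inl h
      · exact Or.inr h
      · exact absurd h (hd a b x hab hx)
    have hxS : x ∈ S := by rcases h1 with rfl | rfl <;> assumption
    exact ⟨hS.eq_or_eq_of_mem_segment (hmem a b hab).1 (hmem a b hab).2 hxS hx, h1⟩
  have hseg : ∀ c d : Plane, s(c, d) = s(u, v) → segment ℝ c d = segment ℝ u v := by
    intro c d h
    rw [Sym2.eq_iff] at h
    rcases h with ⟨rfl, rfl⟩ | ⟨rfl, rfl⟩
    · rfl
    · exact segment_symm ℝ _ _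
  have hend : ∀ c d x : Plane, s(c, d) = s(u, v) → (x = u ∨ x = v) → (x = c ∨ x = d) := by
    intro c d x h
    rw [Sym2.eq_iff] at h
    rcases h with ⟨rfl, rfl⟩ | ⟨rfl, rfl⟩ <;> tauto
  rintro a b c d x (h1 | h1) (h2 | h2) hx hx'
  · exact hJ a b c d x h1 h2 hx hx'
  · have := key a b x h1 hx (by rwa [← hseg c d h2])
    exact Or.inr ⟨this.1, hend c d x h2 this.2⟩
  · have := key c d x h2 hx' (by rwa [← hseg a b h1])
    exact Or.inr ⟨hend a b x h1 this.2, this.1⟩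
  · left; rw [h1, h2]

/-! ### Drawings of non-crossing graphs -/

section Graph

variable {P : Finset Plane} {G : SimpleGraph P}

lemma Joined.symm {a b : Plane} (h : Joined G a b) : Joined G b a := by
  obtain ⟨ha, hb, h⟩ := h
  exact ⟨hb, ha, h.symm⟩

lemma Joined.ne {a b : Plane} (h : Joined G a b) : a ≠ b := by
  obtain ⟨ha, hb, h⟩ := h
  rintro rfl
  exact h.ne rfl

lemma Joined.left_mem {a b : Plane} (h : Joined G a b) : a ∈ P := h.1
lemma Joined.right_mem {a b : Plane} (h : Joined G a b) : b ∈ P := h.2.1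

lemma mem_drawing_iff {x : Plane} :
    x ∈ drawing G ↔ x ∈ P ∨ ∃ a b, Joined G a b ∧ x ∈ segment ℝ a b := by
  constructor
  · rintro (h | ⟨u, v, h, hx⟩)
    · exact Or.inl h
    · exact Or.inr ⟨u, v, ⟨u.2, v.2, h⟩, hx⟩
  · rintro (h | ⟨a, b, ⟨ha, hb, h⟩, hx⟩)
    · exact Or.inl h
    · exact Or.inr ⟨_, _, h, hx⟩

lemma Joined.segment_subset {a b : Plane} (h : Joined G a b) : segment ℝ a b ⊆ drawing G :=
  fun _ hx => mem_drawing_iff.2 (Or.inr ⟨a, b, h, hx⟩)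

lemma isClosed_drawing : IsClosed (drawing G) := by
  have e : drawing G = (P : Set Plane) ∪ ⋃ u : P, ⋃ v : P, {x | G.Adj u v ∧ x ∈ segment ℝ (u : Plane) v} := by
    ext x; simp [drawing]
  rw [e]
  refine (P.finite_toSet.isClosed).union (isClosed_iUnion_of_finite fun u =>
    isClosed_iUnion_of_finite fun v => ?_)
  by_cases h : G.Adj u v
  · simpa [h] using (isCompact_segment' (u : Plane) v).isClosed
  · simp [h]

lemma bd_subset_drawing {L : List Plane} (h : ∀ e ∈ cycEdges L, Joined G e.1 e.2) :
    bd L ⊆ drawing G := by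
  rintro x ⟨e, he, hx⟩
  exact (h e he).segment_subset hx

/-- `NonCrossing` concerns edges without common endpoint; for the other pairs, general position
makes the common endpoint the only common point. -/
lemma compat_of_nonCrossing (hg : GeneralPosition (P : Set Plane)) (hG : NonCrossing G) :
    Compat (Joined G) := by
  intro a b c d x hab hcd hx hx'
  by_cases hs : s(a, b) = s(c, d)
  · exact Or.inl hs
  right
  obtain ⟨ha, hb, h1⟩ := id hab
  obtain ⟨hc, hd, h2⟩ := id hcd
  have key : ∀ p q r : Plane, p ∈ P → q ∈ P → r ∈ P → p ≠ q → p ≠ r → q ≠ r →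
      x ∈ segment ℝ p q → x ∈ segment ℝ p r → x = p := fun p q r hp hq hr h1 h2 h3 =>
    segment_inter_of_det_ne (hg.det_ne hp hq hr h1 h2 h3)
  have nab := hab.ne
  have ncd := hcd.ne
  by_cases hac : a = c
  · subst hac
    have : x = a := key a b d ha hb hd nab ncd (by rintro rfl; exact hs rfl) hx hx'
    simp [this]
  by_cases had : a = d
  · subst had
    have : x = a := key a b c ha hb hc nab ncd.symm (by rintro rfl; exact hs Sym2.eq_swap) hx
      (by rwa [segment_symm])
    simp [this]
  by_cases hbc : b = c
  · subst hbc
    have : x = b := key b a d hb ha hd nab.symm ncd had (by rwa [segment_symm]) hx'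
    simp [this]
  by_cases hbd : b = d
  · subst hbd
    have : x = b := key b a c hb ha hc nab.symm ncd.symm hac (by rwa [segment_symm])
      (by rwa [segment_symm])
    simp [this]
  have := hG ⟨a, ha⟩ ⟨b, hb⟩ ⟨c, hc⟩ ⟨d, hd⟩ h1 h2 (by simpa using hac) (by simpa using had)
    (by simpa using hbc) (by simpa using hbd)
  exact absurd hx' (Set.disjoint_left.1 this hx)

lemma nonCrossing_of_compat (h : Compat (Joined G)) : NonCrossing G := by
  intro u v w z huv hwz h1 h2 h3 h4
  rw [Set.disjoint_left]
  intro x hx hx'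
  have c1 : (u : Plane) ≠ w := fun h => h1 (Subtype.ext h)
  have c2 : (u : Plane) ≠ z := fun h => h2 (Subtype.ext h)
  have c3 : (v : Plane) ≠ w := fun h => h3 (Subtype.ext h)
  have c4 : (v : Plane) ≠ z := fun h => h4 (Subtype.ext h)
  rcases h u v w z x ⟨u.2, v.2, huv⟩ ⟨w.2, z.2, hwz⟩ hx hx' with h | ⟨h, h'⟩
  · rw [Sym2.eq_iff] at h; tauto
  · rcases h with rfl | rfl <;> rcases h' with h' | h' <;> tauto

/-- Near an interior point of an edge, the drawing consists of this edge. -/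
lemma drawing_near_edge (hg : GeneralPosition (P : Set Plane)) (hG : Compat (Joined G))
    {a b m : Plane} (hab : Joined G a b) (hm : m ∈ openSegment ℝ a b) :
    ∀ᶠ x in 𝓝 m, x ∈ drawing G → x ∈ segment ℝ a b := by
  have hms := openSegment_subset_segment ℝ _ _ hm
  have hma : m ≠ a := by
    rintro rfl; exact hab.ne ((left_mem_openSegment_iff (𝕜 := ℝ)).1 hm)
  have hmb : m ≠ b := by
    rintro rfl; exact hab.ne ((right_mem_openSegment_iff (𝕜 := ℝ)).1 hm)
  have h1 : ∀ᶠ x : Plane in 𝓝 m, ∀ p : P, x ≠ (p : Plane) := by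
    rw [Filter.eventually_all]
    intro p
    have : m ≠ p := by
      rintro rfl
      rcases hg.eq_or_eq_of_mem_segment hab.left_mem hab.right_mem p.2 hms with h | h
      · exact hma h
      · exact hmb h
    exact isOpen_ne.mem_nhds this
  have h2 : ∀ᶠ x in 𝓝 m, ∀ u v : P, G.Adj u v → s((u : Plane), (v : Plane)) ≠ s(a, b) →
      x ∉ segment ℝ (u : Plane) v := by
    rw [Filter.eventually_all]; intro u
    rw [Filter.eventually_all]; intro v
    by_cases h : G.Adj u v ∧ s((u : Plane), (v : Plane)) ≠ s(a, b)
    · have : m ∉ segment ℝ (u : Plane) v := by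
        intro hmuv
        rcases hG _ _ _ _ m ⟨u.2, v.2, h.1⟩ hab hmuv hms with h' | h'
        · exact h.2 h'
        · rcases h'.2 with h' | h'
          · exact hma h'
          · exact hmb h'
      filter_upwards [(isCompact_segment' (u : Plane) v).isClosed.isOpen_compl.mem_nhds this]
        with x hx _ _ using hx
    · refine Filter.Eventually.of_forall fun x h3 h4 => absurd ⟨h3, h4⟩ h
  filter_upwards [h1, h2] with x hx1 hx2 hx
  rcases hx with hx | ⟨u, v, huv, hx⟩
  · exact absurd rfl (hx1 ⟨x, hx⟩)
  · by_contra hcon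
    refine hx2 u v huv (fun h => hcon ?_) hx
    rw [Sym2.eq_iff] at h
    rcases h with ⟨h, h'⟩ | ⟨h, h'⟩
    · rwa [← h, ← h']
    · rwa [← h, ← h', segment_symm]

/-- All edges at `v` lead into an open half-plane. -/
def PointedAt (G : SimpleGraph P) (v : Plane) : Prop :=
  ∃ w : Plane, ∀ r, Joined G v r → 0 < dotp w (r - v)

/-- A counterclockwise polygon with sides in the graph and no part of the graph inside. -/
structure IsFace (G : SimpleGraph P) (L : List Plane) : Prop where
  pos : Pos L
  joined : ∀ e ∈ cycEdges L, Joined G e.1 e.2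
  disjoint : Disjoint (ins (bd L)) (drawing G)

lemma IsFace.congr {L L' : List Plane} (h : IsFace G L) (hp : L'.Perm L)
    (hc : (cycEdges L').Perm (cycEdges L)) : IsFace G L' where
  pos := h.pos.congr hp hc
  joined := fun e he => h.joined e (hc.mem_iff.1 he)
  disjoint := by rw [bd_congr hc]; exact h.disjoint

lemma IsFace.bd_subset {L : List Plane} (h : IsFace G L) : bd L ⊆ drawing G :=
  bd_subset_drawing h.joined

lemma IsFace.mem {L : List Plane} (h : IsFace G L) {v : Plane} (hv : v ∈ L) : v ∈ P := by
  obtain ⟨q, hq⟩ := exists_next hv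
  exact (h.joined _ hq).left_mem

lemma IsFace.subset_of_inter {L L' : List Plane} (h : IsFace G L) (h' : IsFace G L') {x : Plane}
    (hx : x ∈ ins (bd L)) (hx' : x ∈ ins (bd L')) : ins (bd L) ⊆ ins (bd L') :=
  h'.pos.toSP.ins_of_preconnected h.pos.toSP.isPreconnected_ins
    (fun _ hy hyb => Set.disjoint_left.1 h.disjoint hy (h'.bd_subset hyb)) hx hx'

/-- The sides belong to the drawing, so the component stays inside the polygon; conversely the
interior is connected and free of the drawing. -/
lemma IsFace.component_eq {L : List Plane} (h : IsFace G L) {x : Plane} (hx : x ∈ ins (bd L)) :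
    connectedComponentIn (drawing G)ᶜ x = ins (bd L) := by
  apply Set.Subset.antisymm
  · rw [← h.pos.toSP.component_eq_ins hx]
    exact connectedComponentIn_mono _ (Set.compl_subset_compl.2 h.bd_subset)
  · exact h.pos.toSP.isPreconnected_ins.subset_connectedComponentIn hx
      fun y hy hyd => Set.disjoint_left.1 h.disjoint hy hyd

lemma det_ray (v p r : Plane) (ε : ℝ) : det v p (v + ε • (r - v)) = ε * det v p r := by
  simp [det]; ring

lemma ray_mem_cone_iff {v p q r : Plane} {ε : ℝ} (hε : 0 < ε) :
    v + ε • (r - v) ∈ cone v p q ↔ r ∈ cone v p q := by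
  simp only [cone, Set.mem_inter_iff, Set.mem_ofPred_eq, det_ray]
  rw [mul_left_comm, mul_left_comm _ ε, mul_pos_iff_of_pos_left hε, mul_pos_iff_of_pos_left hε]

lemma ray_mem_cocone_iff {v p q r : Plane} {ε : ℝ} (hε : 0 < ε) :
    v + ε • (r - v) ∈ cocone v p q ↔ r ∈ cocone v p q := by
  simp only [cocone, Set.mem_union, Set.mem_ofPred_eq, det_ray]
  rw [mul_left_comm, mul_left_comm _ ε, mul_pos_iff_of_pos_left hε, mul_pos_iff_of_pos_left hε]

lemma exists_small_ray {U : Set Plane} {v : Plane} (r : Plane) (hU : U ∈ 𝓝 v) :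
    ∃ ε : ℝ, 0 < ε ∧ v + ε • (r - v) ∈ U ∧ v + ε • (r - v) ∈ segment ℝ v r := by
  have h2 : ∀ᶠ t : ℝ in 𝓝[>] 0, t < 1 := (gt_mem_nhds one_pos).filter_mono nhdsWithin_le_nhds
  obtain ⟨ε, h1, h2, h3⟩ := ((eventually_ray (r - v) hU).and (h2.and self_mem_nhdsWithin)).exists
  have h3' : 0 < ε := h3
  exact ⟨ε, h3', h1, mem_segment_iff.2 ⟨ε, h3'.le, h2.le, rfl⟩⟩

/-- No edge leaves a reflex vertex of a face into the face. -/
lemma IsFace.notMem_cocone {L : List Plane} (h : IsFace G L) {p v q r : Plane}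
    (hp : (p, v) ∈ cycEdges L) (hq : (v, q) ∈ cycEdges L) (hd : ¬ 0 < det p v q)
    (hr : Joined G v r) : r ∉ cocone v p q := by
  intro hrc
  obtain ⟨ε, h0, h1, h2⟩ := exists_small_ray r (h.pos.near_vertex hp hq)
  exact Set.disjoint_left.1 h.disjoint ((h1.2 ((ray_mem_cocone_iff h0).2 hrc)).2.2 hd)
    (hr.segment_subset h2)

lemma det_ne_at_vertex {L : List Plane} (h : SP L) {p v q : Plane} (hp : (p, v) ∈ cycEdges L)
    (hq : (v, q) ∈ cycEdges L) : det v p q ≠ 0 := by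
  have := h.det_ne_of_edges hp hq
  rwa [det_swap', neg_ne_zero] at this

lemma dotp_pos_of_notMem_cocone {v p q r w : Plane} (hD : det v p q ≠ 0) (hr : r ≠ v)
    (h : r ∉ cocone v p q) (hp : 0 < dotp w (p - v)) (hq : 0 < dotp w (q - v)) :
    0 < dotp w (r - v) := by
  simp only [cocone, Set.mem_union, Set.mem_ofPred_eq, not_or, not_lt] at h
  exact dotp_pos_of_mem_cone hD hr (by rw [det_swap v r q, det_swap v p q]; linarith)
    (by linarith) hp hq

/-- At a reflex vertex the face fills everything off the closed cone of its two sides. All edges at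
`v` therefore run in this cone, hence in an open half-plane, and the complementary open half-plane
lies in the face near `v`. -/
lemma IsFace.exists_halfplane_of_reflex {L : List Plane} (h : IsFace G L) {p v q : Plane}
    (hp : (p, v) ∈ cycEdges L) (hq : (v, q) ∈ cycEdges L) (hd : ¬ 0 < det p v q) :
    ∃ w, (∀ r, Joined G v r → 0 < dotp w (r - v)) ∧ ∀ᶠ ε : ℝ in 𝓝[>] 0,
      v + ε • (-w) ∈ ins (bd L) ∧ ∀ x, dotp w (x - v) < 0 → x ∈ cocone v p q := by
  have hD := det_ne_at_vertex h.pos.toSP hp hq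
  obtain ⟨w, hwp, hwq⟩ := exists_halfplane_of_det_ne hD
  refine ⟨w, fun r hr => dotp_pos_of_notMem_cocone hD hr.ne.symm (h.notMem_cocone hp hq hd hr) hwp hwq, ?_⟩
  have hww : 0 < dotp w w := by
    have : w ≠ 0 := by rintro rfl; simp [dotp] at hwp
    have := sqd_pos this
    simp [dotp] at *; nlinarith
  filter_upwards [eventually_ray (-w) (h.pos.near_vertex hp hq), self_mem_nhdsWithin] with ε h1 h2
  have h2' : 0 < ε := h2
  have e : dotp w (v + ε • (-w) - v) = -(ε * dotp w w) := by simp [dotp]; ring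
  exact ⟨(h1.2 (mem_cocone_of_dotp_neg hD hwp hwq (by rw [e]; linarith [mul_pos h2' hww]))).2.2 hd,
    fun x hx => mem_cocone_of_dotp_neg hD hwp hwq hx⟩

lemma IsFace.pointedAt_of_reflex {L : List Plane} (h : IsFace G L) {p v q : Plane}
    (hp : (p, v) ∈ cycEdges L) (hq : (v, q) ∈ cycEdges L) (hd : ¬ 0 < det p v q) :
    PointedAt G v := (h.exists_halfplane_of_reflex hp hq hd).imp fun _ hw => hw.1

/-- A common vertex of two faces is a corner of at least one of them. -/
lemma IsFace.corner_of_common {L L' : List Plane} (h : IsFace G L) (h' : IsFace G L')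
    (hd : Disjoint (ins (bd L)) (ins (bd L'))) {v : Plane} (hv : v ∈ L) (hv' : v ∈ L') :
    v ∈ corners L ∨ v ∈ corners L' := by
  by_contra! hcon
  obtain ⟨p, hp⟩ := exists_prev hv
  obtain ⟨q, hq⟩ := exists_next hv
  obtain ⟨p', hp'⟩ := exists_prev hv'
  obtain ⟨q', hq'⟩ := exists_next hv'
  have c1 := hcon.1
  have c2 := hcon.2
  rw [mem_corners_iff h.pos.nodup hp hq] at c1
  rw [mem_corners_iff h'.pos.nodup hp' hq'] at c2
  obtain ⟨w, hw, hε⟩ := h.exists_halfplane_of_reflex hp hq c1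
  have hD := det_ne_at_vertex h'.pos.toSP hp' hq'
  obtain ⟨ε, ⟨h1, -⟩, h2, h3⟩ := (hε.and ((eventually_ray (-w) (h'.pos.near_vertex hp' hq')).and
    self_mem_nhdsWithin)).exists
  have h3' : 0 < ε := h3
  have hwp' := hw p' (h'.joined _ hp').symm
  have hww : 0 < dotp w w := by
    have : w ≠ 0 := by rintro rfl; simp [dotp] at hwp'
    have := sqd_pos this
    simp [dotp] at *; nlinarith
  -- If `v` were reflex in both faces, the points near `v` in the direction `-w` would lie in both:
  -- the half-plane from the first face contains all edges at `v`, in particular the sides of the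
  -- second face.
  have e : dotp w (v + ε • (-w) - v) = -(ε * dotp w w) := by simp [dotp]; ring
  have := (h2.2 (mem_cocone_of_dotp_neg hD hwp' (hw q' (h'.joined _ hq'))
    (by rw [e]; linarith [mul_pos h3' hww]))).2.2 c2
  exact Set.disjoint_left.1 hd h1 this

end Graph

/-! ### Faces of pseudo-triangulations -/

namespace Pointgon

variable {X : Pointgon} {T : SimpleGraph X.pts}

lemma IsPseudoTriangulation.compat (hT : X.IsPseudoTriangulation T) : Compat (Joined T) :=
  compat_of_nonCrossing X.generalPosition hT.nonCrossing

lemma boundary_subset_drawing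
    (hT : ∀ i : Fin X.n, Joined T (X.poly i) (X.poly (finRotate X.n i))) :
    X.poly.boundary ℝ ⊆ drawing T := by
  rw [boundary_eq_bd]
  apply bd_subset_drawing
  intro e he
  obtain ⟨i, rfl⟩ := mem_cycEdges_ofFn.1 he
  exact hT i

/-- The component of a point inside the polygon and off the graph is the interior of a
pseudo-triangle. -/
lemma IsPseudoTriangulation.exists_face (hT : X.IsPseudoTriangulation T) {x : Plane}
    (hx : x ∈ inside X.poly) (hxd : x ∉ drawing T) :
    ∃ L, IsFace T L ∧ (corners L).card = 3 ∧ x ∈ ins (bd L) := by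
  have hb : Bornology.IsBounded (connectedComponentIn (drawing T)ᶜ x) :=
    hx.2.subset (connectedComponentIn_mono _ (Set.compl_subset_compl.2
      (boundary_subset_drawing hT.boundary)))
  obtain ⟨m, Q, hQ, hj, hF⟩ := hT.faces _ ⟨x, hxd, rfl, hb⟩
  have hgQ : GeneralPosition (Set.range Q.vertices) := by
    refine X.generalPosition.mono ?_
    rintro _ ⟨i, rfl⟩
    exact (hj i).left_mem
  obtain ⟨L, hL, hbd, hcard, -, -, hed⟩ := exists_pos_list hQ.1 hgQ
  have hins : inside Q = ins (bd L) := by rw [inside_eq_ins, hbd]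
  rw [hins] at hF
  refine ⟨L, ⟨hL, ?_, ?_⟩, by rw [hcard, hQ.2], ?_⟩
  · rintro ⟨a, b⟩ he
    obtain ⟨i, ⟨rfl, rfl⟩ | ⟨rfl, rfl⟩⟩ := hed a b he
    · exact hj i
    · exact (hj i).symm
  · rw [← hF, Set.disjoint_left]
    intro y hy
    exact connectedComponentIn_subset _ _ hy
  · rw [← hF]; exact mem_connectedComponentIn hxd

/-- The edge stays in the closed region, and an inner point of it on the boundary would lie on a
side, which is an edge of `T` as well. -/
lemma IsPseudoTriangulation.openSegment_subset (hT : X.IsPseudoTriangulation T) {a b : Plane}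
    (hab : Joined T a b) (hnb : ∀ i, s(a, b) ≠ s(X.poly i, X.poly (finRotate X.n i))) :
    openSegment ℝ a b ⊆ inside X.poly := by
  intro m hm
  have hms := openSegment_subset_segment ℝ _ _ hm
  obtain ⟨ha, hb, h⟩ := id hab
  rcases hT.subset_region _ _ h hms with h' | h'
  · exact h'
  exfalso
  rw [boundary_eq_bd] at h'
  obtain ⟨e, he, hme⟩ := h'
  obtain ⟨i, rfl⟩ := mem_cycEdges_ofFn.1 he
  rcases hT.compat _ _ _ _ m hab (hT.boundary i) hms hme with h1 | ⟨rfl | rfl, -⟩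
  · exact hnb i h1
  · exact hab.ne ((left_mem_openSegment_iff (𝕜 := ℝ)).1 hm)
  · exact hab.ne ((right_mem_openSegment_iff (𝕜 := ℝ)).1 hm)

/-- There is a face to the left of every inner edge. -/
lemma IsPseudoTriangulation.exists_face_of_edge (hT : X.IsPseudoTriangulation T) {a b : Plane}
    (hab : Joined T a b) (hins : openSegment ℝ a b ⊆ inside X.poly) :
    ∃ L, IsFace T L ∧ (corners L).card = 3 ∧ (a, b) ∈ cycEdges L := by
  have hne := hab.ne
  have hm := midpoint_mem a b hne
  set m := midpoint ℝ a b
  have hms := openSegment_subset_segment ℝ _ _ hm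
  have hm0 := det_eq_zero_of_mem_segment hms
  have hmi : ∀ᶠ x in 𝓝 m, x ∈ inside X.poly :=
    (isOpen_ins (by rw [boundary_eq_bd]; exact isClosed_bd _)).mem_nhds (hins hm)
  obtain ⟨r, hr, hball⟩ := Metric.eventually_nhds_iff_ball.1
    (hmi.and (drawing_near_edge X.generalPosition hT.compat hab hm))
  -- The half-disc to the left of the edge at its midpoint is connected and avoids the drawing, so
  -- it lies in a single face, and `m` is on the boundary of this face.
  set H : Set Plane := {x | 0 < 1 * det a b x} ∩ Metric.ball m r with hH
  have hHd : H ⊆ (drawing T)ᶜ := by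
    rintro x ⟨hx, hxb⟩ hxd
    have := det_eq_zero_of_mem_segment ((hball x hxb).2 hxd)
    simp only [Set.mem_ofPred_eq, this] at hx; simp at hx
  have hHc : IsPreconnected H := ((convex_halfplane 1 a b).inter (convex_ball m r)).isPreconnected
  obtain ⟨x, hx, hxb⟩ := ((frequently_side hne hm0 (Or.inl rfl)).and_eventually
    (Metric.ball_mem_nhds m hr)).exists
  have hxH : x ∈ H := ⟨hx, hxb⟩
  obtain ⟨L, hL, h3, hxL⟩ := hT.exists_face (hball x hxb).1 (hHd hxH)
  refine ⟨L, hL, h3, ?_⟩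
  have hHL : H ⊆ ins (bd L) := by
    rw [← hL.component_eq hxL]
    exact hHc.subset_connectedComponentIn hxH hHd
  have hmL : m ∈ bd L := by
    have hmc : m ∈ closure (ins (bd L)) :=
      closure_mono hHL (mem_closure_halfplane hne (Or.inl rfl) (Metric.ball_mem_nhds m hr) hm0)
    rcases hL.pos.toSP.closure_ins_subset hmc with h | h
    · exact absurd (hab.segment_subset hms) (Set.disjoint_left.1 hL.disjoint h)
    · exact h
  obtain ⟨⟨c, d⟩, he, hmcd⟩ := hmL
  rcases hT.compat _ _ _ _ m hab (hL.joined _ he) hms hmcd with h | ⟨h | h, -⟩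
  · rw [Sym2.eq_iff] at h
    rcases h with ⟨rfl, rfl⟩ | ⟨rfl, rfl⟩
    · exact he
    -- A side traversed from `b` to `a` would have the face on its other side.
    · exfalso
      obtain ⟨y, hy, hyb, hyn⟩ := ((frequently_side hne hm0 (Or.inl rfl)).and_eventually
        ((Filter.eventually_mem_set.2 (Metric.ball_mem_nhds m hr)).and
          (hL.pos.near_edge he (by rwa [openSegment_symm])))).exists
      exact (hyn.2 (by rw [det_swap']; linarith)).2 (hHL ⟨hy, hyb⟩)
  · exact absurd ((left_mem_openSegment_iff (𝕜 := ℝ)).1 (h ▸ hm)) hne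
  · exact absurd ((right_mem_openSegment_iff (𝕜 := ℝ)).1 (h ▸ hm)) hne

open scoped Classical in
/-- A segment that can be added to a pseudo-triangulation without crossings destroys the
pointedness of one of its ends. -/
lemma IsPseudoTriangulation.exists_reflex_end (hT : X.IsPseudoTriangulation T) {a b : Plane}
    (ha : a ∈ X.pts) (hb : b ∈ X.pts) (hab : a ≠ b) (hnj : ¬ Joined T a b)
    (hins : openSegment ℝ a b ⊆ inside X.poly) (hdis : Disjoint (openSegment ℝ a b) (drawing T)) :
    ∃ v v' p q, s(v, v') = s(a, b) ∧ Joined T v p ∧ Joined T v q ∧ 0 < det v p q ∧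
      0 < det v q v' ∧ 0 < det v v' p ∧ ∀ r, Joined T v r → r ∉ cocone v p q := by
  have hm := midpoint_mem a b hab
  set m := midpoint ℝ a b
  obtain ⟨L, hL, h3, hmL⟩ := hT.exists_face (hins hm) (Set.disjoint_left.1 hdis hm)
  have hopen : openSegment ℝ a b ⊆ ins (bd L) := by
    rw [← hL.component_eq hmL]
    exact (convex_openSegment a b).isPreconnected.subset_connectedComponentIn hm
      fun x hx hxd => Set.disjoint_left.1 hdis hx hxd
  -- An end of the segment is in the closure of the face but, as a vertex, not in the face; by
  -- general position it is a vertex of the bounding polygon.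
  have hend : ∀ x ∈ X.pts, x ∈ closure (openSegment ℝ a b) → x ∈ L := by
    intro x hx hxc
    rcases hL.pos.toSP.closure_ins_subset (closure_mono hopen hxc) with h | h
    · exact absurd (mem_drawing_iff.2 (Or.inl hx)) (Set.disjoint_left.1 hL.disjoint h)
    · obtain ⟨⟨c, d⟩, he, hxe⟩ := h
      rcases X.generalPosition.eq_or_eq_of_mem_segment (hL.joined _ he).left_mem
        (hL.joined _ he).right_mem hx hxe with rfl | rfl
      · exact fst_mem_of_mem_cycEdges he
      · exact snd_mem_of_mem_cycEdges he
  have haL := hend a ha (by rw [closure_openSegment]; exact left_mem_segment ℝ _ _)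
  have hbL := hend b hb (by rw [closure_openSegment]; exact right_mem_segment ℝ _ _)
  obtain ⟨l, hl, hc⟩ := exists_rotation haL
  have hbl : b ∈ l := by
    have := hl.mem_iff.2 hbL
    simpa [hab.symm] using this
  obtain ⟨l₁, l₂, rfl⟩ := List.append_of_mem hbl
  have hQ : IsFace T (a :: l₁ ++ b :: l₂) := hL.congr hl hc
  rw [← corners_congr hc] at h3
  rw [← bd_congr hc] at hopen
  change (corners (a :: l₁ ++ b :: l₂)).card = 3 at h3
  change openSegment ℝ a b ⊆ ins (bd (a :: l₁ ++ b :: l₂)) at hopen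
  clear hl hc hbl
  have hnd := hQ.pos.nodup
  obtain ⟨n1, n2, -, -⟩ := nodup_parts hnd
  have hl1 : l₁ ≠ [] := by
    rintro rfl
    exact hnj (hQ.joined (a, b) (mem_cycEdges_split.2 (Or.inl (by simp))))
  have hl2 : l₂ ≠ [] := by
    rintro rfl
    exact hnj (hQ.joined (b, a) (mem_cycEdges_split.2 (Or.inr (by simp)))).symm
  have hlen1 : 0 < l₁.length := List.length_pos_iff.2 hl1
  have hlen2 : 0 < l₂.length := List.length_pos_iff.2 hl2
  have hJ : Compat fun c d => Joined T c d ∨ s(c, d) = s(a, b) :=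
    hT.compat.insert X.generalPosition (fun c d h => ⟨h.left_mem, h.right_mem⟩) ha hb
      fun c d x hcd hx hxo => Set.disjoint_left.1 hdis hxo (hcd.segment_subset hx)
  have hgp : ∀ M : List Plane, (∀ x ∈ M, x ∈ a :: l₁ ++ b :: l₂) → GeneralPosition {x | x ∈ M} :=
    fun M hM => X.generalPosition.mono fun x hx => hQ.mem (hM x hx)
  have s1 : SP (a :: l₁ ++ [b]) := by
    refine hJ.sp n1 (by simp; omega) (hgp _ ?_) ?_
    · intro x hx; simp at hx ⊢; tauto
    · intro e he
      rcases mem_cycEdges_part.1 he with h | rfl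
      · exact Or.inl (hQ.joined e (mem_cycEdges_split.2 (Or.inl h)))
      · exact Or.inr Sym2.eq_swap
  have s2 : SP (b :: l₂ ++ [a]) := by
    refine hJ.sp n2 (by simp; omega) (hgp _ ?_) ?_
    · intro x hx; simp at hx ⊢; tauto
    · intro e he
      rcases mem_cycEdges_part.1 he with h | rfl
      · exact Or.inl (hQ.joined e (mem_cycEdges_split.2 (Or.inr h)))
      · exact Or.inr rfl
  obtain ⟨P1, P2, -⟩ := hQ.pos.split s1 s2 hopen
  have k1 := P1.three_le_card_corners
  have k2 := P2.three_le_card_corners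
  obtain ⟨c₁, c₂, f0, f1, f2⟩ := card_corners_split hnd
  -- The two parts have at least six corners together and the face has three. Only the ends of the
  -- chord contribute new ones, and an end contributes two only if it is reflex in the face and a
  -- corner of both parts; otherwise it contributes at most one.
  have hcases : (a ∉ corners (a :: l₁ ++ b :: l₂) ∧ a ∈ corners (a :: l₁ ++ [b]) ∧
      a ∈ corners (b :: l₂ ++ [a])) ∨ (b ∉ corners (a :: l₁ ++ b :: l₂) ∧
      b ∈ corners (a :: l₁ ++ [b]) ∧ b ∈ corners (b :: l₂ ++ [a])) := by
    by_contra hcon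
    rw [h3] at f0; rw [f1] at k1; rw [f2] at k2
    split_ifs at f0 k1 k2 <;> first | omega | (apply hcon; tauto)
  have hfinal : ∀ (a b : Plane) (l₁ l₂ : List Plane), IsFace T (a :: l₁ ++ b :: l₂) →
      a ∉ corners (a :: l₁ ++ b :: l₂) → a ∈ corners (a :: l₁ ++ [b]) →
      a ∈ corners (b :: l₂ ++ [a]) → ∃ p q, Joined T a p ∧ Joined T a q ∧ 0 < det a p q ∧
      0 < det a q b ∧ 0 < det a b p ∧ ∀ r, Joined T a r → r ∉ cocone a p q := by
    intro a b l₁ l₂ hQ g0 g1 g2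
    have hnd := hQ.pos.nodup
    obtain ⟨n1, n2, -, -⟩ := nodup_parts hnd
    obtain ⟨p, q, e1, e2, e3, e4, e5, e6⟩ := exists_sides_at_chord hnd
    rw [mem_corners_iff hnd e1 e2] at g0
    rw [mem_corners_iff n1 e3 e4] at g1
    rw [mem_corners_iff n2 e5 e6] at g2
    have hD := hQ.pos.toSP.det_ne_of_edges e1 e2
    refine ⟨p, q, (hQ.joined _ e1).symm, hQ.joined _ e2, ?_, ?_, ?_,
      fun r hr => hQ.notMem_cocone e1 e2 g0 hr⟩
    · rw [det_swap' a p q]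
      have := lt_of_le_of_ne (not_lt.1 g0) hD
      linarith
    · rw [det_rot b a q] at g1; exact g1
    · rw [det_rot p a b] at g2; exact g2
  rcases hcases with ⟨g0, g1, g2⟩ | ⟨g0, g1, g2⟩
  · obtain ⟨p, q, h⟩ := hfinal a b l₁ l₂ hQ g0 g1 g2
    exact ⟨a, b, p, q, rfl, h⟩
  · have hQ' : IsFace T (b :: l₂ ++ a :: l₁) := hQ.congr List.perm_append_comm cycEdges_split_comm
    obtain ⟨p, q, h⟩ := hfinal b a l₂ l₁ hQ' (by rwa [corners_congr cycEdges_split_comm]) g2 g1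
    exact ⟨b, a, p, q, Sym2.eq_swap, h⟩

end Pointgon

/-! ### Connectivity along polygonal paths -/

section Reachable

variable {P : Finset Plane} {D : SimpleGraph P}

lemma Joined.adj {x y : P} (h : Joined D x y) : D.Adj x y := by
  obtain ⟨_, _, h⟩ := h
  exact h

lemma reachable_of_pathEdges {a b : Plane} {l : List Plane} (ha : a ∈ P) (hb : b ∈ P)
    (h : ∀ e ∈ pathEdges (a :: l ++ [b]), Joined D e.1 e.2) :
    D.Reachable ⟨a, ha⟩ ⟨b, hb⟩ := by
  induction l generalizing a with
  | nil => exact (Joined.adj (x := ⟨a, ha⟩) (y := ⟨b, hb⟩) (h (a, b) (by simp))).reachable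
  | cons c l ih =>
    have h1 : Joined D a c := h (a, c) (by simp)
    exact (Joined.adj (x := ⟨a, ha⟩) (y := ⟨c, h1.right_mem⟩) h1).reachable.trans
      (ih h1.right_mem fun e he => h e (by simpa using Or.inr he))

end Reachable

/-! ### Merging two faces -/

section MergeFaces

variable {P : Finset Plane} {T : SimpleGraph P} {u u' : Plane} {l₁ l₂ : List Plane}

/-- The half-plane criterion makes `u` a corner of both faces but not a corner of their union. -/
lemma reflex_of_pointed {p q w : Plane} (hq0 : 0 < det u q u') (hp0 : 0 < det u u' p)
    (hp : 0 < dotp w (p - u)) (hq : 0 < dotp w (q - u)) (hu' : ¬ 0 < dotp w (u' - u)) :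
    ¬ 0 < det u q p := by
  intro h
  have e := det_smul_identity u q p u' w
  have : 0 < det u q p * dotp w (u' - u) := by
    rw [e]; exact add_pos (mul_pos hp0 hq) (mul_pos hq0 hp)
  exact hu' (pos_of_mul_pos_right this h.le)

/-- Faces that meet contain each other, but points close to the midpoint of the edge on its right
are inside `L` and outside `L'`. -/
lemma disjoint_of_opposite_edges {L L' : List Plane} (h : IsFace T L) (h' : IsFace T L')
    (he : (u', u) ∈ cycEdges L) (he' : (u, u') ∈ cycEdges L') :
    Disjoint (ins (bd L)) (ins (bd L')) := by
  have hne := h'.pos.toSP.edge_ne he'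
  have hm := midpoint_mem u u' hne
  have hm0 := det_eq_zero_of_mem_segment (openSegment_subset_segment ℝ _ _ hm)
  rw [Set.disjoint_left]
  intro y hy hy'
  obtain ⟨x, hx, h1, h2⟩ := ((frequently_side hne hm0 (Or.inr rfl)).and_eventually
    ((h.pos.near_edge he (by rwa [openSegment_symm])).and (h'.pos.near_edge he' hm))).exists
  have hd := det_swap' u u' x
  exact (h2.2 (by linarith)).2 (h.subset_of_inter h' hy hy' (h1.1 (by linarith)))

variable (hg : GeneralPosition (P : Set Plane)) (h1 : IsFace T (u :: l₁ ++ [u']))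
  (h2 : IsFace T (u' :: l₂ ++ [u])) (k1 : (corners (u :: l₁ ++ [u'])).card = 3)
  (k2 : (corners (u' :: l₂ ++ [u])).card = 3) (hnp : ¬ PointedAt T u) {w : Plane}
  (hw : ∀ r, Joined T u r → r ≠ u' → 0 < dotp w (r - u))

include h1 h2 in
lemma disjoint_faces_at_edge :
    Disjoint (ins (bd (u :: l₁ ++ [u']))) (ins (bd (u' :: l₂ ++ [u]))) :=
  disjoint_of_opposite_edges h1 h2 (mem_cycEdges_part.2 (Or.inr rfl))
    (mem_cycEdges_part.2 (Or.inr rfl))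

include hg h1 h2 hnp hw in
-- As `u` is not pointed, it is reflex in neither face. The other edges at `u` lie in a half-plane
-- that does not contain `u'`, so the two angles add up to more than `π`: the directions to `q`,
-- `u'` and `p` positively span the plane.
lemma exists_sides_of_faces : ∃ p q, (u, q) ∈ cycEdges (u :: l₁ ++ [u']) ∧
    (p, u) ∈ cycEdges (u' :: l₂ ++ [u]) ∧ p ≠ u' ∧ q ≠ u' ∧ p ≠ q ∧ 0 < det u q u' ∧ 0 < det u u' p ∧
    0 < det u p q := by
  have e1 : (u', u) ∈ cycEdges (u :: l₁ ++ [u']) := mem_cycEdges_part.2 (Or.inr rfl)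
  have e2 : (u, u') ∈ cycEdges (u' :: l₂ ++ [u]) := mem_cycEdges_part.2 (Or.inr rfl)
  obtain ⟨q, hq⟩ := exists_next (L := u :: l₁ ++ [u']) (v := u) (by simp)
  obtain ⟨p, hp⟩ := exists_prev (L := u' :: l₂ ++ [u]) (v := u) (by simp)
  have hq' := (h1.pos.toSP.prev_ne_next e1 hq).symm
  have hp' := h2.pos.toSP.prev_ne_next hp e2
  have d1 : 0 < det u' u q := by
    by_contra h
    exact hnp (h1.pointedAt_of_reflex e1 hq h)
  have d2 : 0 < det p u u' := by
    by_contra h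
    exact hnp (h2.pointedAt_of_reflex hp e2 h)
  have juq := h1.joined _ hq
  have jup := (h2.joined _ hp).symm
  simp only at juq jup
  rw [det_rot] at d1
  rw [det_rot] at d2
  have hpq : p ≠ q := by
    rintro rfl
    rw [det_swap] at d1; linarith
  have hu' : ¬ 0 < dotp w (u' - u) := by
    intro h
    refine hnp ⟨w, fun r hr => ?_⟩
    by_cases hr' : r = u'
    · rwa [hr']
    · exact hw r hr hr'
  have d3 := reflex_of_pointed d1 d2 (hw p jup hp') (hw q juq hq') hu'
  have d4 := hg.det_ne juq.left_mem juq.right_mem jup.right_mem juq.ne jup.ne hpq.symm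
  refine ⟨p, q, hq, hp, hp', hq', hpq, d1, d2, ?_⟩
  rw [det_swap]
  have := lt_of_le_of_ne (not_lt.1 d3) d4
  linarith

include hg h1 h2 k1 k2 hnp hw in
/-- Two pseudo-triangles at an edge whose removal makes an end pointed have no other common
vertices. -/
lemma nodup_of_faces : (u :: l₁ ++ u' :: l₂).Nodup := by
  classical
  obtain ⟨p, q, hq, hp, hp', hq', hpq, d1, d2, d3⟩ := exists_sides_of_faces hg h1 h2 hnp hw
  have hd := disjoint_faces_at_edge h1 h2
  set L := u :: l₁ ++ [u'] with hL
  set L' := u' :: l₂ ++ [u] with hL'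
  have e1 : (u', u) ∈ cycEdges L := mem_cycEdges_part.2 (Or.inr rfl)
  have e2 : (u, u') ∈ cycEdges L' := mem_cycEdges_part.2 (Or.inr rfl)
  have huu' : u ≠ u' := h2.pos.toSP.edge_ne e2
  -- Counting with multiplicity, the two faces have six corners. A further common vertex `v` would
  -- give at least seven: two from `u`, three from exposed points `E` of all vertices (`u` is not
  -- exposed), and two from `u'` and `v`. The numbers add up because a point of both `E` and `{u',
  -- v}` is a corner of both faces.
  have key : ∀ v, v ∈ L → v ∈ L' → v = u ∨ v = u' := by
    by_contra! hcon
    obtain ⟨v, hv, hv', hvu, hvu'⟩ := hcon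
    set V : Finset Plane := L.toFinset ∪ L'.toFinset with hV
    have hVL : {x | x ∈ L} ⊆ (V : Set Plane) := fun x hx => by simp [hV]; exact Or.inl hx
    have hVL' : {x | x ∈ L'} ⊆ (V : Set Plane) := fun x hx => by simp [hV]; exact Or.inr hx
    have hqL := snd_mem_of_mem_cycEdges hq
    have hpL := fst_mem_of_mem_cycEdges hp
    obtain ⟨x, y, z, hx, hy, hz, hxy, hxz, hyz⟩ := exists_three_exposed (V := V)
      (hVL (fst_mem_of_mem_cycEdges e1)) (hVL (snd_mem_of_mem_cycEdges e1)) (hVL hqL)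
      (by rw [det_rot]; exact d1.ne')
    have hexu : ¬ Exposed (V : Set Plane) u := by
      rintro ⟨-, w', hw'⟩
      exact not_halfplane_of_spanning d1 d2 d3
        (hw' q (hVL hqL) (h1.joined _ hq).ne.symm)
        (hw' u' (hVL' (snd_mem_of_mem_cycEdges e2)) huu'.symm)
        (hw' p (hVL' hpL) (h2.joined _ hp).ne)
    have c1 : ∀ t, Exposed (V : Set Plane) t → t ∈ L → t ∈ corners L := fun t ht htL =>
      h1.pos.mem_corners_of_exposed (ht.mono hVL htL)
    have c2 : ∀ t, Exposed (V : Set Plane) t → t ∈ L' → t ∈ corners L' := fun t ht htL =>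
      h2.pos.mem_corners_of_exposed (ht.mono hVL' htL)
    have c3 : ∀ t, t ∈ L → t ∈ L' → t ∈ corners L ∪ corners L' := fun t ht ht' =>
      Finset.mem_union.2 (h1.corner_of_common h2 hd ht ht')
    set E : Finset Plane := {x, y, z} with hE
    have hEx : ∀ t ∈ E, Exposed (V : Set Plane) t := by
      intro t ht
      simp only [hE, Finset.mem_insert, Finset.mem_singleton] at ht
      rcases ht with rfl | rfl | rfl <;> assumption
    have hEc : E.card = 3 := Finset.card_eq_three.2 ⟨x, y, z, hxy, hxz, hyz, rfl⟩
    set W : Finset Plane := {u', v} with hW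
    have hWc : W.card = 2 := Finset.card_pair hvu'.symm
    have huE : u ∉ E := fun h => hexu (hEx u h)
    have huW : u ∉ W := by simp [hW, huu', hvu.symm]
    have u1 : u ∈ corners L := by
      rw [mem_corners_iff h1.pos.nodup e1 hq, det_rot]; exact d1
    have u2 : u ∈ corners L' := by
      rw [mem_corners_iff h2.pos.nodup hp e2, det_rot]; exact d2
    have s1 : insert u (E ∪ W) ⊆ corners L ∪ corners L' := by
      intro t ht
      rcases Finset.mem_insert.1 ht with rfl | ht
      · exact Finset.mem_union_left _ u1
      rcases Finset.mem_union.1 ht with ht | ht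
      · have := (hEx t ht).1
        simp only [hV, Finset.coe_union, List.coe_toFinset, Set.mem_union, Set.mem_ofPred_eq] at this
        rcases this with h | h
        · exact Finset.mem_union_left _ (c1 t (hEx t ht) h)
        · exact Finset.mem_union_right _ (c2 t (hEx t ht) h)
      · simp only [hW, Finset.mem_insert, Finset.mem_singleton] at ht
        rcases ht with rfl | rfl
        · exact c3 _ (fst_mem_of_mem_cycEdges e1) (snd_mem_of_mem_cycEdges e2)
        · exact c3 _ hv hv'
    have s2 : insert u (E ∩ W) ⊆ corners L ∩ corners L' := by
      intro t ht
      rcases Finset.mem_insert.1 ht with rfl | ht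
      · exact Finset.mem_inter.2 ⟨u1, u2⟩
      obtain ⟨ht, htW⟩ := Finset.mem_inter.1 ht
      simp only [hW, Finset.mem_insert, Finset.mem_singleton] at htW
      have : t ∈ L ∧ t ∈ L' := by
        rcases htW with rfl | rfl
        · exact ⟨fst_mem_of_mem_cycEdges e1, snd_mem_of_mem_cycEdges e2⟩
        · exact ⟨hv, hv'⟩
      exact Finset.mem_inter.2 ⟨c1 t (hEx t ht) this.1, c2 t (hEx t ht) this.2⟩
    have t1 := Finset.card_le_card s1
    have t2 := Finset.card_le_card s2
    rw [Finset.card_insert_of_notMem (by simp [huE, huW])] at t1 t2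
    have t3 := Finset.card_union_add_card_inter E W
    have t4 := Finset.card_union_add_card_inter (corners L) (corners L')
    omega
  have n1 := h1.pos.nodup
  have n2 := h2.pos.nodup
  simp only [hL, List.cons_append, List.nodup_cons, List.mem_append, List.nodup_append] at n1
  simp only [hL', List.cons_append, List.nodup_cons, List.mem_append, List.nodup_append] at n2
  have hul1 : u ∉ l₁ := fun h => n1.1 (Or.inl h)
  have hul2 : u ∉ l₂ := fun h => n2.2.2.2 u h u (by simp) rfl
  have hu'l1 : u' ∉ l₁ := fun h => n1.2.2.2 u' h u' (by simp) rfl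
  have hu'l2 : u' ∉ l₂ := fun h => n2.1 (Or.inl h)
  rw [List.nodup_append]
  refine ⟨List.nodup_cons.2 ⟨hul1, n1.2.1⟩, List.nodup_cons.2 ⟨hu'l2, n2.2.1⟩, ?_⟩
  rintro a ha b hb rfl
  rcases List.mem_cons.1 ha with rfl | ha'
  · rcases List.mem_cons.1 hb with h | h
    · exact huu' h
    · exact hul2 h
  · rcases List.mem_cons.1 hb with h | h
    · exact hu'l1 (h ▸ ha')
    · rcases key a (by simp [hL, ha']) (by simp [hL', h]) with rfl | rfl
      · exact hul1 ha'
      · exact hu'l1 ha'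

/-- If one of the two faces at `u'` is reflex there, then so is their union. -/
lemma not_corner_of_reflex_left {p q : Plane} (hr : ¬ 0 < det u u' q)
    (hD : det u' u q ≠ 0) (hn : p ∉ cocone u' u q) : ¬ 0 < det p u' q := by
  intro h
  have e1 : det u' u q = -det u u' q := det_swap' _ _ _
  have e2 : det u' q u = -det u' u q := det_swap _ _ _
  have e3 : det p u' q = det u' q p := det_rot _ _ _
  have hpos : 0 < det u' u q := lt_of_le_of_ne (by linarith) hD.symm
  apply hn
  left
  change 0 < -det u' q u * det u' q p
  rw [e2, neg_neg, ← e3]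
  exact mul_pos hpos h

lemma not_corner_of_reflex_right {p q : Plane} (hr : ¬ 0 < det p u' u)
    (hD : det u' p u ≠ 0) (hn : q ∉ cocone u' p u) : ¬ 0 < det p u' q := by
  intro h
  have e1 : det u' p u = -det p u' u := det_swap' _ _ _
  have e3 : det p u' q = -det u' p q := det_swap' _ _ _
  have hpos : 0 < det u' p u := lt_of_le_of_ne (by linarith) hD.symm
  apply hn
  right
  change 0 < -det u' p u * det u' p q
  have := mul_pos hpos h
  rw [e3] at this
  linarith

include hg h1 h2 k1 k2 hnp hw in
open scoped Classical in
-- The union loses both corners at `u`. If `u'` is a corner of only one face, it is lost as well and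
-- three corners remain. If `u'` is a corner of both, two corners remain besides it, and it must be
-- the third because every polygon has at least three.
lemma card_corners_of_faces (hM : Pos (u :: l₁ ++ u' :: l₂)) :
    (corners (u :: l₁ ++ u' :: l₂)).card = 3 := by
  have hnd := hM.nodup
  have hd := disjoint_faces_at_edge h1 h2
  have e1 : (u', u) ∈ cycEdges (u :: l₁ ++ [u']) := mem_cycEdges_part.2 (Or.inr rfl)
  have e2 : (u, u') ∈ cycEdges (u' :: l₂ ++ [u]) := mem_cycEdges_part.2 (Or.inr rfl)
  obtain ⟨p, q, hq, hp, -, -, -, d1, d2, d3⟩ := exists_sides_of_faces hg h1 h2 hnp hw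
  obtain ⟨p0, q0, m1, m2, -, m4, m5, -⟩ := exists_sides_at_chord hnd
  obtain rfl := next_unique h1.pos.nodup hq m4
  obtain rfl := prev_unique h2.pos.nodup hp m5
  have hnd' : (u' :: l₂ ++ u :: l₁).Nodup := List.perm_append_comm.nodup_iff.1 hnd
  obtain ⟨p', q', m6, m7, -, m9, m10, -⟩ := exists_sides_at_chord hnd'
  rw [cycEdges_split_comm.mem_iff] at m6 m7
  have u1 : u ∈ corners (u :: l₁ ++ [u']) := by
    rw [mem_corners_iff h1.pos.nodup e1 hq, det_rot]; exact d1
  have u2 : u ∈ corners (u' :: l₂ ++ [u]) := by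
    rw [mem_corners_iff h2.pos.nodup hp e2, det_rot]; exact d2
  have uM : u ∉ corners (u :: l₁ ++ u' :: l₂) := by
    rw [mem_corners_iff hnd m1 m2, det_swap']; linarith
  have hor := h1.corner_of_common h2 hd (v := u') (by simp) (by simp)
  obtain ⟨c₁, c₂, f0, f1, f2⟩ := card_corners_split hnd
  have f3 := hM.three_le_card_corners
  rw [k1] at f1
  rw [k2] at f2
  simp only [u1, u2, uM, if_true, if_false] at f0 f1 f2
  by_cases g1 : u' ∈ corners (u :: l₁ ++ [u'])
  · by_cases g2 : u' ∈ corners (u' :: l₂ ++ [u])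
    · simp only [g1, g2, if_true] at f1 f2
      split_ifs at f0 <;> omega
    · have g3 : u' ∉ corners (u :: l₁ ++ u' :: l₂) := by
        rw [mem_corners_iff h1.pos.nodup m10 e1] at g1
        rw [mem_corners_iff h2.pos.nodup e2 m9] at g2
        rw [mem_corners_iff hnd m6 m7]
        exact not_corner_of_reflex_left g2 (det_ne_at_vertex h2.pos.toSP e2 m9)
          (h2.notMem_cocone e2 m9 g2 (h1.joined _ m10).symm)
      simp only [g1, g2, g3, if_true, if_false] at f0 f1 f2
      omega
  · have g2 := hor.resolve_left g1
    have g3 : u' ∉ corners (u :: l₁ ++ u' :: l₂) := by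
      rw [mem_corners_iff h1.pos.nodup m10 e1] at g1
      rw [mem_corners_iff h2.pos.nodup e2 m9] at g2
      rw [mem_corners_iff hnd m6 m7]
      exact not_corner_of_reflex_right g1 (det_ne_at_vertex h1.pos.toSP m10 e1)
        (h1.notMem_cocone m10 e1 g1 (h2.joined _ m9))
    simp only [g1, g2, g3, if_true, if_false] at f0 f1 f2
    omega

end MergeFaces

/-! ### Deleting an edge from a pseudo-triangulation -/

namespace Pointgon

variable {X : Pointgon} {T D : SimpleGraph X.pts}

/-- Removing an inner edge whose removal makes an end pointed leaves a pseudo-triangulation. -/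
lemma IsPseudoTriangulation.of_delete (hT : X.IsPseudoTriangulation T) {u u' w : Plane}
    (hD : ∀ a b, Joined D a b ↔ Joined T a b ∧ s(a, b) ≠ s(u, u')) (huu : Joined T u u')
    (hnb : ∀ i, s(u, u') ≠ s(X.poly i, X.poly (finRotate X.n i))) (hnp : ¬ PointedAt T u)
    (hw : ∀ r, Joined T u r → r ≠ u' → 0 < dotp w (r - u)) : X.IsPseudoTriangulation D := by
  have hg := X.generalPosition
  have hTc := hT.compat
  have hins := hT.openSegment_subset huu hnb
  obtain ⟨L, hL, k1, heL⟩ := hT.exists_face_of_edge huu.symm (by rwa [openSegment_symm])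
  obtain ⟨L', hL', k2, heL'⟩ := hT.exists_face_of_edge huu hins
  obtain ⟨l₁, hp1, hc1⟩ := exists_rotation_edge hL.pos.nodup
    (by have := hL.pos.three_le; omega) heL
  obtain ⟨l₂, hp2, hc2⟩ := exists_rotation_edge hL'.pos.nodup
    (by have := hL'.pos.three_le; omega) heL'
  have h1 := hL.congr hp1 hc1
  have h2 := hL'.congr hp2 hc2
  rw [← corners_congr hc1] at k1
  rw [← corners_congr hc2] at k2
  clear hp1 hc1 hp2 hc2 heL heL' hL hL' L L'
  have hdisj := disjoint_faces_at_edge h1 h2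
  have hnd := nodup_of_faces hg h1 h2 k1 k2 hnp hw
  have hnd' : (u' :: l₂ ++ u :: l₁).Nodup := List.perm_append_comm.nodup_iff.1 hnd
  obtain ⟨p, q, hq, hp, hpu', hqu', -⟩ := exists_sides_of_faces hg h1 h2 hnp hw
  obtain ⟨p0, q0, m1, m2, -, m4, m5, -⟩ := exists_sides_at_chord hnd
  obtain rfl := next_unique h1.pos.nodup hq m4
  obtain rfl := prev_unique h2.pos.nodup hp m5
  have hsub : ∀ e ∈ cycEdges (u :: l₁ ++ u' :: l₂), Joined D e.1 e.2 := by
    rintro ⟨a, b⟩ he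
    rw [hD]
    constructor
    · rcases mem_cycEdges_split.1 he with h | h
      · exact h1.joined _ (mem_cycEdges_part.2 (Or.inl h))
      · exact h2.joined _ (mem_cycEdges_part.2 (Or.inl h))
    · intro h
      rw [Sym2.eq_iff] at h
      rcases h with ⟨rfl, rfl⟩ | ⟨rfl, rfl⟩
      · exact hqu' (next_unique hnd m2 he)
      · exact hpu' (prev_unique hnd m1 he)
  have hDT : ∀ a b, Joined D a b → Joined T a b := fun a b h => ((hD a b).1 h).1
  have hDc : Compat (Joined D) := fun a b c d x hab hcd => hTc a b c d x (hDT _ _ hab) (hDT _ _ hcd)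
  have hMsp : SP (u :: l₁ ++ u' :: l₂) := by
    refine hDc.sp hnd ?_ (hg.mono ?_) hsub
    · have := h1.pos.three_le
      simp at this ⊢; omega
    · intro x hx
      have hx' : x ∈ u :: l₁ ++ u' :: l₂ := hx
      simp only [List.mem_append, List.mem_cons] at hx'
      rcases hx' with (rfl | h) | rfl | h
      · exact huu.left_mem
      · exact h1.mem (by simp [h])
      · exact huu.right_mem
      · exact h2.mem (by simp [h])
  obtain ⟨hM, hsub1⟩ := Pos.merge hMsp h1.pos h2.pos hdisj
  have hM3 := card_corners_of_faces hg h1 h2 k1 k2 hnp hw hM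
  have hdraw : drawing D ⊆ drawing T := by
    intro x hx
    rcases mem_drawing_iff.1 hx with h | ⟨a, b, h, hx⟩
    · exact mem_drawing_iff.2 (Or.inl h)
    · exact (hDT _ _ h).segment_subset hx
  have hdraw' : ∀ x ∈ drawing T, x ∈ drawing D ∨ x ∈ openSegment ℝ u u' := by
    intro x hx
    rcases mem_drawing_iff.1 hx with h | ⟨a, b, h, hx⟩
    · exact Or.inl (mem_drawing_iff.2 (Or.inl h))
    · by_cases hs : s(a, b) = s(u, u')
      · have hx' : x ∈ segment ℝ u u' := by
          rw [Sym2.eq_iff] at hs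
          rcases hs with ⟨rfl, rfl⟩ | ⟨rfl, rfl⟩
          · exact hx
          · rwa [segment_symm]
        rw [← insert_endpoints_openSegment] at hx'
        rcases hx' with rfl | rfl | h
        · exact Or.inl (mem_drawing_iff.2 (Or.inl huu.left_mem))
        · exact Or.inl (mem_drawing_iff.2 (Or.inl huu.right_mem))
        · exact Or.inr h
      · exact Or.inl (((hD a b).2 ⟨h, hs⟩).segment_subset hx)
  have hopenD : ∀ x ∈ openSegment ℝ u u', x ∉ drawing D := by
    intro x hx hxd
    have hxs := openSegment_subset_segment ℝ _ _ hx
    have hxu : x ≠ u := by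
      rintro rfl; exact huu.ne ((left_mem_openSegment_iff (𝕜 := ℝ)).1 hx)
    have hxu' : x ≠ u' := by
      rintro rfl; exact huu.ne ((right_mem_openSegment_iff (𝕜 := ℝ)).1 hx)
    rcases mem_drawing_iff.1 hxd with h | ⟨a, b, h, hx'⟩
    · rcases hg.eq_or_eq_of_mem_segment huu.left_mem huu.right_mem h hxs with h | h
      · exact hxu h
      · exact hxu' h
    · obtain ⟨h3, h4⟩ := (hD a b).1 h
      rcases hTc _ _ _ _ x h3 huu hx' hxs with h5 | ⟨-, h5 | h5⟩
      · exact h4 h5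
      · exact hxu h5
      · exact hxu' h5
  -- The only part of the drawing of `T` inside the union is the removed edge.
  have hMF : IsFace D (u :: l₁ ++ u' :: l₂) := by
    refine ⟨hM, hsub, ?_⟩
    rw [Set.disjoint_left]
    intro x hx hxd
    by_cases hxs : x ∈ segment ℝ u u'
    · rw [← insert_endpoints_openSegment] at hxs
      rcases hxs with rfl | rfl | h
      · exact hx.1 (mem_bd_of_mem (by simp))
      · exact hx.1 (mem_bd_of_mem (by simp))
      · exact hopenD x h hxd
    · rcases ins_split_subset hM h1.pos h2.pos hx hxs with h | h
      · exact Set.disjoint_left.1 h1.disjoint h (hdraw hxd)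
      · exact Set.disjoint_left.1 h2.disjoint h (hdraw hxd)
  -- The inner points of the removed edge are now off the closed drawing, so a face that has one of
  -- them in its closure contains it.
  have hball : ∀ {F : Set Plane} {x m : Plane}, F = connectedComponentIn (drawing D)ᶜ x →
      m ∈ openSegment ℝ u u' → m ∈ closure F → m ∈ F := by
    rintro F x m rfl hm hmc
    obtain ⟨r, hr, hb⟩ := Metric.isOpen_iff.1 isClosed_drawing.isOpen_compl m (hopenD m hm)
    obtain ⟨y, hy, hyF⟩ := mem_closure_iff.1 hmc _ Metric.isOpen_ball (Metric.mem_ball_self hr)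
    rw [connectedComponentIn_eq hyF]
    exact (convex_ball m r).isPreconnected.subset_connectedComponentIn hy hb
      (Metric.mem_ball_self hr)
  refine ⟨?_, nonCrossing_of_compat hDc, ?_, ?_, ?_⟩
  · have hreach : D.Reachable ⟨u, huu.left_mem⟩ ⟨u', huu.right_mem⟩ :=
      reachable_of_pathEdges _ _ fun e he => hsub e (mem_cycEdges_split.2 (Or.inl he))
    have hadj : ∀ x y, T.Adj x y → D.Reachable x y := by
      intro x y hxy
      by_cases hs : s((x : Plane), (y : Plane)) = s(u, u')
      · rw [Sym2.eq_iff] at hs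
        rcases hs with ⟨rfl, rfl⟩ | ⟨rfl, rfl⟩
        · exact hreach
        · exact hreach.symm
      · exact (((hD x y).2 ⟨⟨x.2, y.2, hxy⟩, hs⟩).adj).reachable
    have := hT.connected.nonempty
    refine SimpleGraph.Connected.mk fun x y => ?_
    obtain ⟨W⟩ := hT.connected.preconnected x y
    induction W with
    | nil => exact SimpleGraph.Reachable.refl _
    | cons h _ ih => exact (hadj _ _ h).trans ih
  · intro i
    exact (hD _ _).2 ⟨hT.boundary i, (hnb i).symm⟩
  · intro a b h
    exact hT.subset_region a b (Joined.adj (hDT a b ⟨a.2, b.2, h⟩))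
  · rintro F ⟨x, hx, hF, hFb⟩
    -- A face that meets the removed edge is the union of the two old faces; any other face was
    -- already a face of `T`.
    by_cases hFo : ∃ y ∈ F, y ∈ openSegment ℝ u u'
    · obtain ⟨y, hyF, hyo⟩ := hFo
      have hyc : y ∈ closure (ins (bd (u :: l₁ ++ u' :: l₂))) := by
        refine closure_mono hsub1 (h1.pos.toSP.bd_subset_closure_ins ?_)
        exact segment_subset_bd_part (openSegment_subset_segment ℝ _ _ hyo)
      obtain ⟨z, hz⟩ := hM.toSP.jordan.2.2.2
      have hyi := hball (hMF.component_eq hz).symm hyo hyc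
      have hFe : F = ins (bd (u :: l₁ ++ u' :: l₂)) := by
        rw [← hMF.component_eq hyi, hF]
        exact connectedComponentIn_eq (hF ▸ hyF)
      obtain ⟨m, Q, hQ, hQi, hQe⟩ := hM.exists_polygon
      exact ⟨m, Q, hM3 ▸ hQ, fun i => hsub _ (hQe i), hFe.trans hQi.symm⟩
    · push Not at hFo
      have hxF : x ∈ F := by rw [hF]; exact mem_connectedComponentIn hx
      have hFT : F ⊆ (drawing T)ᶜ := by
        intro y hy hyd
        rcases hdraw' y hyd with h | h
        · rw [hF] at hy
          exact connectedComponentIn_subset _ _ hy h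
        · exact hFo y hy h
      have hFe : F = connectedComponentIn (drawing T)ᶜ x := by
        apply Set.Subset.antisymm
        · refine IsPreconnected.subset_connectedComponentIn ?_ hxF hFT
          rw [hF]; exact isPreconnected_connectedComponentIn
        · rw [hF]
          exact connectedComponentIn_mono _ (Set.compl_subset_compl.2 hdraw)
      obtain ⟨m, Q, hQ, hQj, hQi⟩ := hT.faces F ⟨x, hFT hxF, hFe, hFb⟩
      -- The bounding polygon does not use the removed edge, since otherwise the midpoint of this
      -- edge would be in the closure of `F`, hence in `F`.
      refine ⟨m, Q, hQ, fun i => (hD _ _).2 ⟨hQj i, fun hs => ?_⟩, hQi⟩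
      have hgQ : GeneralPosition (Set.range Q.vertices) := by
        refine hg.mono ?_
        rintro _ ⟨i, rfl⟩
        exact (hQj i).left_mem
      have hm := midpoint_mem u u' huu.ne
      refine hFo _ (hball hF hm ?_) hm
      rw [hQi, inside_eq]
      refine ((sp_ofFn_iff Q).2 ⟨hQ.1, hgQ⟩).bd_subset_closure_ins ⟨_, mem_cycEdges_ofFn.2 ⟨i, rfl⟩, ?_⟩
      have hms := openSegment_subset_segment ℝ _ _ hm
      rw [Sym2.eq_iff] at hs
      rcases hs with ⟨hs1, hs2⟩ | ⟨hs1, hs2⟩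
      · change _ ∈ segment ℝ (Q i) (Q (finRotate m i))
        rwa [hs1, hs2]
      · change _ ∈ segment ℝ (Q i) (Q (finRotate m i))
        rwa [hs1, hs2, segment_symm]

end Pointgon

/-! ### Two flips that insert the same edge -/

section Flip

variable {P : Finset Plane} {T : SimpleGraph P} {e f : Sym2 P} {x y : Plane}

/-- The pair of points of the plane underlying a pair of points of a finite set. -/
def planePair (f : Sym2 P) : Sym2 Plane := f.map (fun p : P => (p : Plane))

lemma planePair_injective : Function.Injective (planePair (P := P)) :=
  Sym2.map.injective Subtype.val_injective

@[simp] lemma planePair_mk (a b : P) : planePair s(a, b) = s((a : Plane), (b : Plane)) := rfl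

lemma joined_iff_mem_edgeSet : Joined T x y ↔ ∃ f ∈ T.edgeSet, planePair f = s(x, y) := by
  constructor
  · rintro ⟨hx, hy, h⟩
    exact ⟨s(⟨x, hx⟩, ⟨y, hy⟩), h, rfl⟩
  · rintro ⟨f, hf, h⟩
    induction f with | _ a b
    rw [planePair_mk, Sym2.eq_iff] at h
    rcases h with ⟨rfl, rfl⟩ | ⟨rfl, rfl⟩
    · exact ⟨a.2, b.2, hf⟩
    · exact ⟨b.2, a.2, hf.symm⟩

lemma joined_delete : Joined (T.deleteEdges {f}) x y ↔ Joined T x y ∧ s(x, y) ≠ planePair f := by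
  simp only [joined_iff_mem_edgeSet, SimpleGraph.edgeSet_deleteEdges, Set.mem_sdiff,
    Set.mem_singleton_iff]
  constructor
  · rintro ⟨g, ⟨hg, hgf⟩, h⟩
    exact ⟨⟨g, hg, h⟩, fun h' => hgf (planePair_injective (h.trans h'))⟩
  · rintro ⟨⟨g, hg, h⟩, hgf⟩
    exact ⟨g, ⟨hg, by rintro rfl; exact hgf h.symm⟩, h⟩

/-- A loop has to be excluded because `SimpleGraph.fromEdgeSet` discards it. -/
lemma joined_flip (he : ¬ e.IsDiag) :
    Joined (T.deleteEdges {f} ⊔ SimpleGraph.fromEdgeSet {e}) x y ↔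
      (Joined T x y ∧ s(x, y) ≠ planePair f) ∨ s(x, y) = planePair e := by
  rw [← joined_delete]
  simp only [joined_iff_mem_edgeSet, SimpleGraph.edgeSet_sup, SimpleGraph.edgeSet_fromEdgeSet,
    Set.mem_union]
  constructor
  · rintro ⟨g, hg | hg, h⟩
    · exact Or.inl ⟨g, hg, h⟩
    · right
      rw [← h, hg.1]
  · rintro (⟨g, hg, h⟩ | h)
    · exact ⟨g, Or.inl hg, h⟩
    · exact ⟨e, Or.inr ⟨rfl, he⟩, h.symm⟩

end Flip

namespace Pointgon

variable {X : Pointgon} {T : SimpleGraph X.pts} {e f f₁ f₂ : Sym2 X.pts}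

lemma isBoundaryEdge_iff : X.IsBoundaryEdge f ↔
    ∃ i, planePair f = s(X.poly i, X.poly (finRotate X.n i)) := Iff.rfl

lemma not_boundary_of_notMem (hT : X.IsPseudoTriangulation T) (heT : e ∉ T.edgeSet) (i : Fin X.n) :
    planePair e ≠ s(X.poly i, X.poly (finRotate X.n i)) := by
  intro h
  obtain ⟨g, hg, hgi⟩ := joined_iff_mem_edgeSet.1 (hT.boundary i)
  exact heT (planePair_injective (h.trans hgi.symm) ▸ hg)

/-- After a diagonal flip, the ends of the new edge at which `T` is pointed remain pointed. -/
lemma IsDiagonalFlip.pointedAt (hf : X.IsDiagonalFlip T f e) (he : ¬ e.IsDiag)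
    (hT : X.IsPseudoTriangulation T) (heT : e ∉ T.edgeSet) {v v' : Plane}
    (hv : s(v, v') = planePair e) {w : Plane} (hw : ∀ r, Joined T v r → 0 < dotp w (r - v)) :
    PointedAt (T.deleteEdges {f} ⊔ SimpleGraph.fromEdgeSet {e}) v := by
  by_contra hnp
  -- Removing `e` from the result of the flip leaves `T` without `f`. If `v` were not pointed in the
  -- result, this removal would make it pointed, and `of_delete` would show that `f` is deletable.
  refine hf.not_deletion (hf.result.of_delete (u := v) (u' := v') (w := w) ?_ ?_ ?_ hnp ?_)
  · intro a b
    rw [joined_delete, joined_flip he, hv]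
    constructor
    · rintro ⟨h, h'⟩
      refine ⟨Or.inl ⟨h, h'⟩, fun hab => heT ?_⟩
      obtain ⟨g, hg, hgi⟩ := joined_iff_mem_edgeSet.1 h
      exact planePair_injective (hgi.trans hab) ▸ hg
    · rintro ⟨h | h, h'⟩
      · exact h
      · exact absurd h h'
  · exact (joined_flip he).2 (Or.inr hv)
  · intro i
    rw [hv]
    exact not_boundary_of_notMem hT heT i
  · intro r hr hrv'
    rcases (joined_flip he).1 hr with h | h
    · exact hw r h.1
    · rw [← hv] at h
      exact absurd (Sym2.congr_right.1 h) hrv'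

/-- Two flips that insert the same edge remove the two edges at an end of degree two. -/
lemma exists_degree_two (hT : X.IsPseudoTriangulation T) (he : ¬ e.IsDiag) (heT : e ∉ T.edgeSet)
    (h1 : X.IsDiagonalFlip T f₁ e) (h2 : X.IsDiagonalFlip T f₂ e) (hne : f₁ ≠ f₂) :
    ∃ v p q, v ∈ planePair e ∧ (∀ r, Joined T v r ↔ r = p ∨ r = q) ∧ p ≠ q ∧
      ∀ f, X.IsDiagonalFlip T f e → planePair f = s(v, p) ∨ planePair f = s(v, q) := by
  have hg := X.generalPosition
  obtain ⟨a, b, hab⟩ : ∃ a b : X.pts, e = s(a, b) := by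
    induction e with | _ a b
    exact ⟨a, b, rfl⟩
  have hab' : (a : Plane) ≠ b := by
    rintro h
    exact he (by rw [hab, Sym2.mk_isDiag_iff]; exact Subtype.ext h)
  have hpe : planePair e = s((a : Plane), (b : Plane)) := by rw [hab]; rfl
  have hnj : ¬ Joined T a b := fun h => heT (by rw [hab]; exact h.adj)
  have j1 : Joined (T.deleteEdges {f₁} ⊔ SimpleGraph.fromEdgeSet {e}) a b :=
    (joined_flip he).2 (Or.inr hpe.symm)
  have hins : openSegment ℝ (a : Plane) b ⊆ inside X.poly :=
    h1.result.openSegment_subset j1 fun i => hpe ▸ not_boundary_of_notMem hT heT i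
  -- An edge of `T` that meets the interior of `e` is kept by one of the two flips and would cross
  -- `e` there.
  have hdis : Disjoint (openSegment ℝ (a : Plane) b) (drawing T) := by
    rw [Set.disjoint_left]
    intro x hx hxd
    have hxs := openSegment_subset_segment ℝ _ _ hx
    have hxa : x ≠ a := by
      rintro rfl; exact hab' ((left_mem_openSegment_iff (𝕜 := ℝ)).1 hx)
    have hxb : x ≠ b := by
      rintro rfl; exact hab' ((right_mem_openSegment_iff (𝕜 := ℝ)).1 hx)
    rcases mem_drawing_iff.1 hxd with h | ⟨c, d, h, hx'⟩
    · rcases hg.eq_or_eq_of_mem_segment a.2 b.2 h hxs with h | h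
      · exact hxa h
      · exact hxb h
    · have key : ∀ f, X.IsDiagonalFlip T f e → s(c, d) ≠ planePair f → False := by
        intro f hf hcd
        rcases hf.result.compat a b c d x ((joined_flip he).2 (Or.inr hpe.symm))
          ((joined_flip he).2 (Or.inl ⟨h, hcd⟩)) hxs hx' with h5 | ⟨h5 | h5, -⟩
        · obtain ⟨g, hg, hgi⟩ := joined_iff_mem_edgeSet.1 h
          exact heT (planePair_injective (hgi.trans (h5.symm.trans hpe.symm)) ▸ hg)
        · exact hxa h5
        · exact hxb h5
      by_cases hcd : s(c, d) = planePair f₁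
      · exact key f₂ h2 fun h => hne (planePair_injective (hcd.symm.trans h))
      · exact key f₁ h1 hcd
  obtain ⟨v, v', p, q, hvv, hp, hq, d1, d2, d3, hr⟩ :=
    hT.exists_reflex_end a.2 b.2 hab' hnj hins hdis
  rw [← hpe] at hvv
  have hD := d1.ne'
  obtain ⟨w, hwp, hwq⟩ := exists_halfplane_of_det_ne hD
  have hw : ∀ r, Joined T v r → 0 < dotp w (r - v) := fun r h =>
    dotp_pos_of_notMem_cocone hD h.ne.symm (hr r h) hwp hwq
  -- A flip cannot keep two edges at `v` that positively span the plane together with `e`.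
  have span : ∀ f r s, X.IsDiagonalFlip T f e → Joined T v r → Joined T v s →
      planePair f ≠ s(v, r) → planePair f ≠ s(v, s) → 0 < det v r s → 0 < det v s v' →
      0 < det v v' r → False := by
    intro f r s hf jr js hfr hfs g1 g2 g3
    obtain ⟨w', hw'⟩ := hf.pointedAt he hT heT hvv hw
    exact not_halfplane_of_spanning g1 g2 g3 (hw' r ((joined_flip he).2 (Or.inl ⟨jr, hfr.symm⟩)))
      (hw' s ((joined_flip he).2 (Or.inl ⟨js, hfs.symm⟩)))
      (hw' v' ((joined_flip he).2 (Or.inr hvv)))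
  have hcase : ∀ f, X.IsDiagonalFlip T f e → planePair f = s(v, p) ∨ planePair f = s(v, q) := by
    intro f hf
    by_contra! hcon
    exact span f p q hf hp hq hcon.1 hcon.2 d1 d2 d3
  have hpq : p ≠ q := by
    rintro rfl; simp at d1
  obtain ⟨g1, g2, hg1, hg2, e1, e2⟩ : ∃ g1 g2, X.IsDiagonalFlip T g1 e ∧ X.IsDiagonalFlip T g2 e ∧
      planePair g1 = s(v, p) ∧ planePair g2 = s(v, q) := by
    rcases hcase f₁ h1 with h | h <;> rcases hcase f₂ h2 with h' | h'
    · exact absurd (planePair_injective (h.trans h'.symm)) hne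
    · exact ⟨f₁, f₂, h1, h2, h, h'⟩
    · exact ⟨f₂, f₁, h2, h1, h', h⟩
    · exact absurd (planePair_injective (h.trans h'.symm)) hne
  refine ⟨v, p, q, by rw [← hvv]; exact Sym2.mem_mk_left _ _, fun r => ⟨fun hvr => ?_, ?_⟩, hpq, hcase⟩
  · by_contra! hcon
    obtain ⟨hrp, hrq⟩ := hcon
    have hv'P : v' ∈ X.pts := by
      have : v' ∈ planePair e := by rw [← hvv]; exact Sym2.mem_mk_right _ _
      rw [hpe, Sym2.mem_iff] at this
      rcases this with rfl | rfl
      · exact a.2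
      · exact b.2
    have hvv' : v ≠ v' := by
      rintro rfl; simp at d2
    have hrv' : r ≠ v' := by
      rintro rfl
      obtain ⟨g, hg, hgi⟩ := joined_iff_mem_edgeSet.1 hvr
      exact heT (planePair_injective (hgi.trans hvv) ▸ hg)
    have n1 := hg.det_ne hvr.left_mem hp.right_mem hvr.right_mem hp.ne hvr.ne hrp.symm
    have n2 := hg.det_ne hvr.left_mem hvr.right_mem hq.right_mem hvr.ne hq.ne hrq
    have n3 := hg.det_ne hvr.left_mem hv'P hvr.right_mem hvv' hvr.ne hrv'.symm
    have hrc := hr r hvr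
    simp only [cocone, Set.mem_union, Set.mem_ofPred_eq, not_or, not_lt] at hrc
    have s1 : 0 < det v p r := lt_of_le_of_ne (by nlinarith [hrc.2]) n1.symm
    have s2 : 0 < det v r q := by
      refine lt_of_le_of_ne ?_ n2.symm
      have := hrc.1
      rw [det_swap v q p, det_swap v q r] at this
      nlinarith
    have ne1 : s(v, p) ≠ s(v, r) := fun h => hrp (Sym2.congr_right.1 h).symm
    have ne2 : s(v, q) ≠ s(v, r) := fun h => hrq (Sym2.congr_right.1 h).symm
    have ne3 : s(v, p) ≠ s(v, q) := fun h => hpq (Sym2.congr_right.1 h)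
    -- The direction to `r` lies between those to `p` and `q`. According to the side of the line `v
    -- v'` on which `r` lies, either `p, r, v'` or `r, q, v'` span the plane, and the flip that
    -- removes the edge to the remaining vertex `q` or `p` keeps these edges.
    rcases lt_or_gt_of_ne n3 with s3 | s3
    · exact span g2 p r hg2 hp hvr (e2 ▸ ne3.symm) (e2 ▸ ne2) s1
        (by rw [det_swap]; linarith) d3
    · exact span g1 r q hg1 hvr hq (e1 ▸ ne1) (e1 ▸ ne3) s2 d2 s3
  · rintro (rfl | rfl)
    · exact hp
    · exact hq

/-- The two flips remove the only two edges at `v`. If `v` were a vertex of `R`, one of these would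
be a side of `R`, which no flip removes. -/
lemma hasInteriorDegreeTwoEnd_of_two_flips (hT : X.IsPseudoTriangulation T) (he : ¬ e.IsDiag)
    (heT : e ∉ T.edgeSet) (h1 : X.IsDiagonalFlip T f₁ e) (h2 : X.IsDiagonalFlip T f₂ e)
    (hne : f₁ ≠ f₂) : X.HasInteriorDegreeTwoEnd T e := by
  obtain ⟨v, p, q, hve, hnb, hpq, hcase⟩ := exists_degree_two hT he heT h1 h2 hne
  obtain ⟨v, hv, rfl⟩ := Sym2.mem_map.1 hve
  have jp := (hnb p).2 (Or.inl rfl)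
  have jq := (hnb q).2 (Or.inr rfl)
  refine ⟨v, hv, ?_, ?_⟩
  · rcases X.mem_pts v v.2 with ⟨i, hi⟩ | h
    · exfalso
      have hb : ∀ f, X.IsDiagonalFlip T f e → planePair f ≠ s(X.poly i, X.poly (finRotate X.n i)) :=
        fun f hf h => hf.interior (isBoundaryEdge_iff.2 ⟨i, h⟩)
      have := hT.boundary i
      rw [← hi, hnb] at this
      rw [← hi] at hb
      have hor : (planePair f₁ = s((v : Plane), p) ∧ planePair f₂ = s((v : Plane), q)) ∨
          (planePair f₁ = s((v : Plane), q) ∧ planePair f₂ = s((v : Plane), p)) := by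
        rcases hcase f₁ h1 with h | h <;> rcases hcase f₂ h2 with h' | h'
        · exact absurd (planePair_injective (h.trans h'.symm)) hne
        · exact Or.inl ⟨h, h'⟩
        · exact Or.inr ⟨h, h'⟩
        · exact absurd (planePair_injective (h.trans h'.symm)) hne
      rcases this with h | h <;> rcases hor with ⟨h3, h4⟩ | ⟨h3, h4⟩
      · exact hb f₁ h1 (h ▸ h3)
      · exact hb f₂ h2 (h ▸ h4)
      · exact hb f₂ h2 (h ▸ h4)
      · exact hb f₁ h1 (h ▸ h3)
    · exact h
  · have : T.neighborSet v = {⟨p, jp.right_mem⟩, ⟨q, jq.right_mem⟩} := by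
      ext r
      rw [SimpleGraph.mem_neighborSet]
      have h3 : T.Adj v r ↔ Joined T v r := ⟨fun h => ⟨v.2, r.2, h⟩, Joined.adj⟩
      rw [h3, hnb]
      simp [Subtype.ext_iff]
    rw [this, Set.ncard_pair]
    simpa using hpq

lemma numFlipsInserting_le_one (hT : X.IsPseudoTriangulation T) (he : ¬ e.IsDiag)
    (heT : e ∉ T.edgeSet) (hdeg : ¬ X.HasInteriorDegreeTwoEnd T e) :
    X.numFlipsInserting T e ≤ 1 := by
  refine (Set.ncard_le_one (Set.toFinite _)).2 fun f₁ h1 f₂ h2 => ?_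
  by_contra hne
  exact hdeg (hasInteriorDegreeTwoEnd_of_two_flips hT he heT h1 h2 hne)

lemma numFlipsInserting_le_two (hT : X.IsPseudoTriangulation T) (he : ¬ e.IsDiag)
    (heT : e ∉ T.edgeSet) : X.numFlipsInserting T e ≤ 2 := by
  by_cases h : ∃ f₁ f₂, X.IsDiagonalFlip T f₁ e ∧ X.IsDiagonalFlip T f₂ e ∧ f₁ ≠ f₂
  · obtain ⟨f₁, f₂, h1, h2, hne⟩ := h
    obtain ⟨v, p, q, -, -, -, hcase⟩ := exists_degree_two hT he heT h1 h2 hne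
    have : planePair '' {f | X.IsDiagonalFlip T f e} ⊆ {s(v, p), s(v, q)} := by
      rintro _ ⟨f, hf, rfl⟩
      exact hcase f hf
    rw [numFlipsInserting, ← Set.ncard_image_of_injective _ planePair_injective]
    exact (Set.ncard_le_ncard this).trans ((Set.ncard_insert_le _ _).trans (by simp))
  · push Not at h
    refine ((Set.ncard_le_one (Set.toFinite _)).2 fun f₁ h1 f₂ h2 => ?_).trans one_le_two
    exact h f₁ f₂ h1 h2

end Pointgon

/-! ### Triangles -/

/-- The open triangle with counterclockwise vertices `a b c`. -/
def openTri (a b c : Plane) : Set Plane := {x | 0 < det a b x ∧ 0 < det b c x ∧ 0 < det c a x}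

lemma openTri_rot (a b c : Plane) : openTri b c a = openTri a b c := by
  ext x; simp only [openTri, Set.mem_ofPred_eq]; tauto

lemma det_sum (a b c x : Plane) : det a b x + det b c x + det c a x = det a b c := by
  unfold det; ring

lemma det_pos_of_mem_openTri {a b c x : Plane} (h : x ∈ openTri a b c) : 0 < det a b c := by
  rw [← det_sum a b c x]; exact add_pos (add_pos h.1 h.2.1) h.2.2

lemma convex_openTri (a b c : Plane) : Convex ℝ (openTri a b c) := by
  intro x hx y hy s t hs ht hst
  have key : ∀ p q : Plane, 0 < det p q x → 0 < det p q y → 0 < det p q (s • x + t • y) := by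
    intro p q h1 h2
    rw [det_comb p q x y hst]
    rcases hs.eq_or_lt with rfl | hs'
    · obtain rfl : t = 1 := by linarith
      simpa using h2
    · nlinarith [mul_pos hs' h1, mul_nonneg ht h2.le]
  exact ⟨key _ _ hx.1 hy.1, key _ _ hx.2.1 hy.2.1, key _ _ hx.2.2 hy.2.2⟩

lemma det_mem_segment_nonneg {p q a b x : Plane} (ha : 0 ≤ det p q a) (hb : 0 ≤ det p q b)
    (hx : x ∈ segment ℝ a b) : 0 ≤ det p q x := by
  obtain ⟨s, t, hs, ht, hst, rfl⟩ := hx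
  rw [det_comb p q a b hst]
  positivity

lemma cycEdges_triangle (a b c : Plane) : cycEdges [a, b, c] = [(a, b), (b, c), (c, a)] := rfl

lemma nodup_of_det_ne {a b c : Plane} (h : det a b c ≠ 0) : a ≠ b ∧ a ≠ c ∧ b ≠ c := by
  refine ⟨?_, ?_, ?_⟩ <;> rintro rfl <;> simp at h

lemma sp_triangle {a b c : Plane} (h : det a b c ≠ 0) : SP [a, b, c] := by
  obtain ⟨hab, hac, hbc⟩ := nodup_of_det_ne h
  have h1 : det b c a ≠ 0 := by rwa [← det_rot]
  have h2 : det c a b ≠ 0 := by rwa [← det_rot, ← det_rot]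
  have h3 : det a c b ≠ 0 := by rw [det_swap, neg_ne_zero]; exact h
  have h4 : det b a c ≠ 0 := by rw [det_swap, neg_ne_zero]; exact h1
  have h5 : det c b a ≠ 0 := by rw [det_swap, neg_ne_zero]; exact h2
  refine ⟨by simp [hab, hac, hbc], le_rfl, ?_, ?_⟩
  · rw [generalPosition_iff_det]
    intro x hx y hy z hz hxy hxz hyz
    simp only [List.mem_cons, List.not_mem_nil, or_false, Set.mem_ofPred_eq] at hx hy hz
    rcases hx with rfl | rfl | rfl <;> rcases hy with rfl | rfl | rfl <;>
      rcases hz with rfl | rfl | rfl <;> first | contradiction | assumption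
  · intro e he e' he' hne x hx
    obtain ⟨hx, hx'⟩ := hx
    simp only [cycEdges_triangle, List.mem_cons, List.not_mem_nil, or_false] at he he'
    rcases he with rfl | rfl | rfl <;> rcases he' with rfl | rfl | rfl <;>
      simp only at hx hx' <;> first
      | exact absurd rfl hne
      | (have := segment_inter_of_det_ne h4 (by rwa [segment_symm]) hx'; simp [this])
      | (have := segment_inter_of_det_ne h3 (by rwa [segment_symm]) hx'; simp [this])
      | (have := segment_inter_of_det_ne h5 (by rwa [segment_symm]) hx'; simp [this])
      | (have := segment_inter_of_det_ne h hx (by rwa [segment_symm]); simp [this])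
      | (have := segment_inter_of_det_ne h1 hx (by rwa [segment_symm]); simp [this])
      | (have := segment_inter_of_det_ne h2 hx (by rwa [segment_symm]); simp [this])

/-- In the opposite case the reversed triangle would be counterclockwise, and its exposed vertex `a`
would have a determinant of the wrong sign. -/
lemma pos_triangle {a b c : Plane} (h : 0 < det a b c) : Pos [a, b, c] := by
  rcases (sp_triangle h.ne').pos_or_reverse with hp | hp
  · exact hp
  exfalso
  have ha : (b, a) ∈ cycEdges [a, b, c].reverse := mem_cycEdges_reverse.2 (by simp [cycEdges_triangle])
  have hc : (a, c) ∈ cycEdges [a, b, c].reverse := mem_cycEdges_reverse.2 (by simp [cycEdges_triangle])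
  obtain ⟨w, hw1, hw2⟩ := exists_halfplane_of_det_ne h.ne'
  have := hp.det_pos_of_exposed ha hc ⟨by simp, w, by
    intro y hy hne
    simp only [List.mem_reverse, List.mem_cons, List.not_mem_nil, or_false, Set.mem_ofPred_eq] at hy
    rcases hy with rfl | rfl | rfl
    · exact absurd rfl hne
    · exact hw1
    · exact hw2⟩
  rw [det_swap'] at this
  linarith

lemma rotate_triangle (a b c : Plane) : (cycEdges [b, c, a]).Perm (cycEdges [a, b, c]) :=
  cycEdges_rotate_perm a [b, c]

lemma disjoint_openTri_bd (a b c : Plane) : Disjoint (openTri a b c) (bd [a, b, c]) := by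
  rw [Set.disjoint_left]
  rintro x ⟨h1, h2, h3⟩ ⟨e, he, hx⟩
  have := det_eq_zero_of_mem_segment hx
  simp only [cycEdges_triangle, List.mem_cons, List.not_mem_nil, or_false] at he
  rcases he with rfl | rfl | rfl <;> simp only at this <;> linarith

/-- The interior of a triangle is the open triangle. -/
lemma ins_triangle {a b c : Plane} (h : 0 < det a b c) : ins (bd [a, b, c]) = openTri a b c := by
  have hP := pos_triangle h
  apply Set.Subset.antisymm
  -- The open half-plane to the right of `p q` misses the boundary and has exterior points next to
  -- the side, so it contains no interior point.
  · have side : ∀ p q r : Plane, 0 < det p q r → bd [p, q, r] = bd [a, b, c] → Pos [p, q, r] →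
        ∀ x ∈ ins (bd [a, b, c]), 0 < det p q x := by
      intro p q r hr hb hP x hx
      rw [← hb] at hx
      have he : (p, q) ∈ cycEdges [p, q, r] := by simp [cycEdges_triangle]
      have hpq := hP.toSP.edge_ne he
      have hm := midpoint_mem p q hpq
      have hm0 := det_eq_zero_of_mem_segment (openSegment_subset_segment ℝ _ _ hm)
      obtain ⟨y, hy, -, hy'⟩ := ((frequently_side hpq hm0 (Or.inr rfl)).and_eventually
        (hP.near_edge he hm)).exists
      have hsub : {z | 0 < -1 * det p q z} ⊆ (bd [p, q, r])ᶜ := by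
        rintro z hz ⟨e, he, hze⟩
        have : 0 ≤ det p q z := by
          simp only [cycEdges_triangle, List.mem_cons, List.not_mem_nil, or_false] at he
          rcases he with rfl | rfl | rfl
          · exact (det_eq_zero_of_mem_segment hze).ge
          · exact det_mem_segment_nonneg (by simp) hr.le hze
          · exact det_mem_segment_nonneg hr.le (by simp) hze
        simp only [Set.mem_ofPred_eq] at hz
        linarith
      have hno : ∀ z ∈ {z | 0 < -1 * det p q z}, z ∉ ins (bd [p, q, r]) :=
        hP.toSP.not_ins_of_preconnected (convex_halfplane (-1) p q).isPreconnected hsub hy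
          (hy' (by linarith)).2
      by_contra hx0
      rcases (not_lt.1 hx0).lt_or_eq with h0 | h0
      · exact hno x (by simp only [Set.mem_ofPred_eq]; linarith) hx
      -- The interior is open, so an interior point on the line itself would have interior points to
      -- its right.
      · obtain ⟨z, hz, hzi⟩ := ((frequently_side hpq h0 (Or.inr rfl)).and_eventually
          ((isOpen_ins (isClosed_bd _)).mem_nhds hx)).exists
        exact hno z hz hzi
    intro x hx
    have r1 := rotate_triangle a b c
    have r2 := (rotate_triangle b c a).trans r1
    exact ⟨side a b c h rfl hP x hx,
      side b c a (by rwa [← det_rot]) (bd_congr r1) (pos_triangle (by rwa [← det_rot])) x hx,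
      side c a b (by rwa [← det_rot, ← det_rot]) (bd_congr r2)
        (pos_triangle (by rwa [← det_rot, ← det_rot])) x hx⟩
  -- Conversely the open triangle is connected and off the boundary, and it contains interior points
  -- close to the midpoint of `a b`.
  · have he : (a, b) ∈ cycEdges [a, b, c] := by simp [cycEdges_triangle]
    have hab := hP.toSP.edge_ne he
    have hm := midpoint_mem a b hab
    have hm0 := det_eq_zero_of_mem_segment (openSegment_subset_segment ℝ _ _ hm)
    obtain ⟨t, ht0, ht1, hmt⟩ := mem_openSegment_iff.1 hm
    have m1 : 0 < det b c (midpoint ℝ a b) := by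
      have : det b c (midpoint ℝ a b) = (1 - t) * det a b c := by rw [hmt]; simp [det]; ring
      rw [this]; exact mul_pos (by linarith) h
    have m2 : 0 < det c a (midpoint ℝ a b) := by
      have : det c a (midpoint ℝ a b) = t * det a b c := by rw [hmt]; simp [det]; ring
      rw [this]; exact mul_pos ht0 h
    obtain ⟨x, hx, ⟨hx1, -⟩, hx2, hx3⟩ := ((frequently_side hab hm0 (Or.inl rfl)).and_eventually
      ((hP.near_edge he hm).and (((continuous_det b c).continuousAt.eventually_const_lt m1).and
        ((continuous_det c a).continuousAt.eventually_const_lt m2)))).exists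
    rw [one_mul] at hx
    exact hP.toSP.ins_of_preconnected (convex_openTri a b c).isPreconnected
      (fun y hy hyb => Set.disjoint_left.1 (disjoint_openTri_bd a b c) hy hyb) ⟨hx, hx2, hx3⟩ (hx1 hx)

lemma card_corners_triangle {a b c : Plane} (h : 0 < det a b c) : (corners [a, b, c]).card = 3 := by
  classical
  refine le_antisymm ?_ (pos_triangle h).three_le_card_corners
  have : corners [a, b, c] ⊆ [a, b, c].toFinset := fun x hx =>
    List.mem_toFinset.2 (mem_of_mem_corners hx)
  exact (Finset.card_le_card this).trans (List.toFinset_card_le _)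

/-- The closed triangle consists of the interior and the boundary. -/
lemma mem_triangle_of_nonneg {a b c x : Plane} (h : 0 < det a b c) (h1 : 0 ≤ det a b x)
    (h2 : 0 ≤ det b c x) (h3 : 0 ≤ det c a x) : x ∈ openTri a b c ∨ x ∈ bd [a, b, c] := by
  have key : ∀ p q r : Plane, 0 < det p q r → det p q x = 0 → 0 ≤ det q r x → 0 ≤ det r p x →
      x ∈ segment ℝ p q := by
    intro p q r hr h0 h2 h3
    obtain ⟨t, rfl⟩ := exists_param_of_det_eq_zero (nodup_of_det_ne hr.ne').1 h0
    have e1 : det q r (p + t • (q - p)) = (1 - t) * det p q r := by simp [det]; ring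
    have e2 : det r p (p + t • (q - p)) = t * det p q r := by simp [det]; ring
    rw [e1] at h2; rw [e2] at h3
    exact mem_segment_iff.2 ⟨t, nonneg_of_mul_nonneg_left h3 hr,
      by linarith [nonneg_of_mul_nonneg_left h2 hr], rfl⟩
  rcases h1.eq_or_lt with h1' | h1'
  · exact Or.inr ⟨(a, b), by simp [cycEdges_triangle], key a b c h h1'.symm h2 h3⟩
  rcases h2.eq_or_lt with h2' | h2'
  · exact Or.inr ⟨(b, c), by simp [cycEdges_triangle],
      key b c a (by rwa [← det_rot]) h2'.symm h3 h1⟩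
  rcases h3.eq_or_lt with h3' | h3'
  · exact Or.inr ⟨(c, a), by simp [cycEdges_triangle],
      key c a b (by rwa [← det_rot, ← det_rot]) h3'.symm h1 h2⟩
  exact Or.inl ⟨h1', h2', h3'⟩

/-! ### A triangle with one interior point -/

/-- The pointgon is the triangle `a b c` with the interior vertex `o`. -/
structure IsStar (X : Pointgon) (a b c o : Plane) : Prop where
  bd_eq : X.poly.boundary ℝ = bd [a, b, c]
  ne : ∀ i, X.poly i ≠ o
  mem : ∀ x, x ∈ X.pts ↔ x = a ∨ x = b ∨ x = c ∨ x = o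
  tri : o ∈ openTri a b c

namespace IsStar

variable {X : Pointgon} {a b c o : Plane}

lemma rot (h : IsStar X a b c o) : IsStar X b c a o where
  bd_eq := h.bd_eq.trans (bd_congr (rotate_triangle a b c)).symm
  ne := h.ne
  mem := fun x => by rw [h.mem]; tauto
  tri := by rw [openTri_rot]; exact h.tri

lemma joined_top {x y : Plane} : Joined (⊤ : SimpleGraph X.pts) x y ↔ x ∈ X.pts ∧ y ∈ X.pts ∧ x ≠ y := by
  constructor
  · exact fun h => ⟨h.left_mem, h.right_mem, h.ne⟩
  · rintro ⟨hx, hy, h⟩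
    exact ⟨hx, hy, by simpa using h⟩

lemma det_pos (h : IsStar X a b c o) : 0 < det a b c := det_pos_of_mem_openTri h.tri

lemma nodup (h : IsStar X a b c o) :
    a ≠ b ∧ b ≠ c ∧ c ≠ a ∧ a ≠ o ∧ b ≠ o ∧ c ≠ o := by
  obtain ⟨h1, h2, h3⟩ := nodup_of_det_ne h.det_pos.ne'
  obtain ⟨-, h4, h5⟩ := nodup_of_det_ne h.tri.1.ne'
  obtain ⟨-, h6, -⟩ := nodup_of_det_ne h.tri.2.2.ne'
  exact ⟨h1, h3, h2.symm, h4, h5, h6⟩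

lemma inside_eq (h : IsStar X a b c o) : inside X.poly = openTri a b c := by
  rw [inside_eq_ins, h.bd_eq, ins_triangle h.det_pos]

lemma segment_subset (h : IsStar X a b c o) {x y : Plane} (hx : x ∈ X.pts) (hy : y ∈ X.pts) :
    segment ℝ x y ⊆ openTri a b c ∪ bd [a, b, c] := by
  have key : ∀ {a b c : Plane}, IsStar X a b c o → ∀ z ∈ X.pts, 0 ≤ det a b z := by
    intro a b c h z hz
    rcases (h.mem z).1 hz with rfl | rfl | rfl | rfl
    · simp
    · simp
    · exact h.det_pos.le
    · exact h.tri.1.le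
  intro z hz
  exact mem_triangle_of_nonneg h.det_pos
    (det_mem_segment_nonneg (key h x hx) (key h y hy) hz)
    (det_mem_segment_nonneg (key h.rot x hx) (key h.rot y hy) hz)
    (det_mem_segment_nonneg (key h.rot.rot x hx) (key h.rot.rot y hy) hz)

lemma mem_drawing_top {x : Plane} (hx : x ∈ drawing (⊤ : SimpleGraph X.pts)) :
    ∃ y ∈ X.pts, ∃ z ∈ X.pts, x ∈ segment ℝ y z := by
  rcases mem_drawing_iff.1 hx with h | ⟨y, z, h, hx⟩
  · exact ⟨x, h, x, h, left_mem_segment ℝ x x⟩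
  · exact ⟨y, h.left_mem, z, h.right_mem, hx⟩

/-- The triangles at the interior vertex are faces of the complete graph. -/
lemma isFace (h : IsStar X a b c o) : IsFace (⊤ : SimpleGraph X.pts) [a, b, o] := by
  obtain ⟨hab, hbc, hca, hao, hbo, hco⟩ := h.nodup
  obtain ⟨t1, t2, t3⟩ := h.tri
  refine ⟨pos_triangle t1, ?_, ?_⟩
  · intro e he
    simp only [cycEdges_triangle, List.mem_cons, List.not_mem_nil, or_false] at he
    rw [joined_top, h.mem, h.mem]
    rcases he with rfl | rfl | rfl <;> simp [hab, hbo, hao.symm]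
  · rw [ins_triangle t1, Set.disjoint_left]
    rintro x ⟨x1, x2, x3⟩ hx
    obtain ⟨y, hy, z, hz, hxs⟩ := mem_drawing_top hx
    have n1 : ∀ p q s t : Plane, det q p s ≥ 0 → det q p t ≥ 0 → 0 < det p q x →
        x ∈ segment ℝ s t → False := by
      intro p q s t hs ht hx hxs
      have := det_mem_segment_nonneg hs ht hxs
      rw [det_swap'] at this
      linarith
    have e1 : 0 ≤ det o b c := by rw [det_rot]; exact t2.le
    have e2 : 0 ≤ det a o c := by rw [← det_rot]; exact t3.le
    rw [h.mem] at hy hz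
    -- Each segment stays on the far side of one of the three lines bounding the small triangle: of
    -- `a b` if it joins `a` and `b`, of `o a` if it avoids `b`, and of `b o` if it avoids `a`.
    by_cases ha : y = a ∨ z = a
    · by_cases hb : y = b ∨ z = b
      · refine n1 a b y z ?_ ?_ x1 hxs
        · rcases ha with rfl | rfl <;> rcases hb with rfl | rfl <;> simp_all
        · rcases ha with rfl | rfl <;> rcases hb with rfl | rfl <;> simp_all
      · push Not at hb
        refine n1 o a y z ?_ ?_ x3 hxs
        · rcases hy with rfl | rfl | rfl | rfl <;> simp_all
        · rcases hz with rfl | rfl | rfl | rfl <;> simp_all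
    · push Not at ha
      refine n1 b o y z ?_ ?_ x2 hxs
      · rcases hy with rfl | rfl | rfl | rfl <;> simp_all
      · rcases hz with rfl | rfl | rfl | rfl <;> simp_all

/-- By the relation with positive coefficients, the position of `x` relative to the three lines
through `o` cannot have the same strict sign for all of them. Going around, the sign changes from
nonnegative to nonpositive somewhere, and this singles out the triangle. -/
lemma exists_small_triangle (h : IsStar X a b c o) {x : Plane} (hx : x ∈ openTri a b c)
    (hxd : x ∉ drawing (⊤ : SimpleGraph X.pts)) :
    x ∈ openTri a b o ∨ x ∈ openTri b c o ∨ x ∈ openTri c a o := by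
  have key : ∀ {a b c : Plane}, IsStar X a b c o → x ∈ openTri a b c → 0 ≤ det o a x →
      det o b x ≤ 0 → x ∈ openTri a b o := by
    intro a b c h hx h1 h2
    refine (mem_triangle_of_nonneg h.tri.1 hx.1.le ?_ h1).resolve_right
      fun hb => hxd (h.isFace.bd_subset hb)
    rw [det_swap']; linarith
  have e : det o b c * det o a x + det o c a * det o b x + det o a b * det o c x = 0 := by
    unfold det; ring
  have t1 : 0 < det o a b := by rw [det_rot]; exact h.tri.1
  have t2 : 0 < det o b c := by rw [det_rot]; exact h.tri.2.1
  have t3 : 0 < det o c a := by rw [det_rot]; exact h.tri.2.2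
  by_cases g1 : 0 ≤ det o a x ∧ det o b x ≤ 0
  · exact Or.inl (key h hx g1.1 g1.2)
  by_cases g2 : 0 ≤ det o b x ∧ det o c x ≤ 0
  · exact Or.inr (Or.inl (key h.rot (by rwa [openTri_rot]) g2.1 g2.2))
  by_cases g3 : 0 ≤ det o c x ∧ det o a x ≤ 0
  · exact Or.inr (Or.inr (key h.rot.rot (by rwa [openTri_rot, openTri_rot]) g3.1 g3.2))
  exfalso
  push Not at g1 g2 g3
  by_cases hA : 0 ≤ det o a x
  · have hB := g1 hA
    have hC := g2 hB.le
    have := mul_pos t3 hB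
    have := mul_pos t1 hC
    have := mul_nonneg t2.le hA
    linarith
  · have hC : det o c x < 0 := by
      by_contra hC
      exact hA (g3 (not_lt.1 hC)).le
    have hB : det o b x < 0 := by
      by_contra hB
      linarith [g2 (not_lt.1 hB)]
    have := mul_neg_of_pos_of_neg t3 hB
    have := mul_neg_of_pos_of_neg t1 hC
    have := mul_neg_of_pos_of_neg t2 (not_le.1 hA)
    linarith

/-- The complete graph on a triangle with one interior point is a pseudo-triangulation. -/
lemma isPseudoTriangulation_top (h : IsStar X a b c o) :
    X.IsPseudoTriangulation (⊤ : SimpleGraph X.pts) := by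
  have hsp : SP (List.ofFn X.poly.vertices) := by
    refine (sp_ofFn_iff _).2 ⟨X.simple, X.generalPosition.mono ?_⟩
    rintro _ ⟨i, rfl⟩
    exact X.vertices_mem i
  have hbound : ∀ i, Joined (⊤ : SimpleGraph X.pts) (X.poly i) (X.poly (finRotate X.n i)) :=
    fun i => joined_top.2 ⟨X.vertices_mem _, X.vertices_mem _,
      hsp.edge_ne (mem_cycEdges_ofFn.2 ⟨i, rfl⟩)⟩
  have hreg : region X.poly = openTri a b c ∪ bd [a, b, c] := by
    rw [region, h.inside_eq, h.bd_eq]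
  have hbd : bd [a, b, c] ⊆ drawing (⊤ : SimpleGraph X.pts) :=
    h.bd_eq ▸ Pointgon.boundary_subset_drawing hbound
  have hface : ∀ {a b c : Plane}, IsStar X a b c o → ∀ {x : Plane}, x ∈ openTri a b o →
      ∃ (m : ℕ) (Q : Polygon Plane m), IsPseudoGon 3 Q ∧
      (∀ i : Fin m, Joined (⊤ : SimpleGraph X.pts) (Q i) (Q (finRotate m i))) ∧
      connectedComponentIn (drawing (⊤ : SimpleGraph X.pts))ᶜ x = inside Q := by
    intro a b c h x hx
    obtain ⟨m, Q, hQ, hQi, hQe⟩ := h.isFace.pos.exists_polygon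
    rw [card_corners_triangle h.tri.1] at hQ
    refine ⟨m, Q, hQ, fun i => h.isFace.joined _ (hQe i), ?_⟩
    rw [hQi]
    exact h.isFace.component_eq (by rwa [ins_triangle h.tri.1])
  have hne : Nonempty X.pts := ⟨⟨o, (h.mem o).2 (by simp)⟩⟩
  refine ⟨SimpleGraph.connected_top, ?_, hbound, ?_, ?_⟩
  · obtain ⟨t1, t2, t3⟩ := h.tri
    -- The only pairs of edges without common endpoint consist of a side and the spoke to the
    -- opposite vertex.
    have main : ∀ {a b c : Plane}, IsStar X a b c o →
        Disjoint (segment ℝ a b) (segment ℝ c o) := by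
      intro a b c h
      rw [Set.disjoint_left]
      intro x hx hx'
      have h0 := det_eq_zero_of_mem_segment hx
      obtain ⟨s, t, hs, ht, hst, rfl⟩ := hx'
      rw [det_comb a b c o hst] at h0
      have h1 := h.det_pos
      have h2 := h.tri.1
      rcases hs.eq_or_lt with rfl | hs'
      · obtain rfl : t = 1 := by linarith
        simp at h0; linarith
      · linarith [mul_pos hs' h1, mul_nonneg ht h2.le]
    have m1 := main h
    have m2 := main h.rot
    have m3 := main h.rot.rot
    intro u v w z huv hwz g1 g2 g3 g4
    have q1 := huv.ne
    have q2 := hwz.ne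
    obtain ⟨u, hu⟩ := u
    obtain ⟨v, hv⟩ := v
    obtain ⟨w, hw⟩ := w
    obtain ⟨z, hz⟩ := z
    rw [h.mem] at hu hv hw hz
    simp only [ne_eq, Subtype.mk.injEq] at q1 q2 g1 g2 g3 g4 ⊢
    rcases hu with rfl | rfl | rfl | rfl <;> rcases hv with rfl | rfl | rfl | rfl <;>
      first
      | exact absurd rfl q1
      | (rcases hw with rfl | rfl | rfl | rfl <;>
          first
          | contradiction
          | (rcases hz with rfl | rfl | rfl | rfl <;>
              first
              | contradiction
              | assumption
              | (rw [segment_symm ℝ w z]; assumption)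
              | (rw [segment_symm ℝ u v]; assumption)
              | (rw [segment_symm ℝ u v, segment_symm ℝ w z]; assumption)
              | (rw [disjoint_comm]; assumption)
              | (rw [disjoint_comm, segment_symm ℝ w z]; assumption)
              | (rw [disjoint_comm, segment_symm ℝ u v]; assumption)
              | (rw [disjoint_comm, segment_symm ℝ u v, segment_symm ℝ w z]; assumption)))
  · intro u v _
    rw [hreg]
    exact h.segment_subset u.2 v.2
  · rintro F ⟨x, hx, rfl, hF⟩
    by_cases hxt : x ∈ openTri a b c
    · rcases h.exists_small_triangle hxt hx with g | g | g
      · exact hface h g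
      · exact hface h.rot g
      · exact hface h.rot.rot g
    · exfalso
      have hxb : x ∉ bd [a, b, c] := fun hb => hx (hbd hb)
      have hxi : x ∉ ins (bd [a, b, c]) := by rwa [ins_triangle h.det_pos]
      -- The drawing stays in the closed triangle. Hence the component of an outer point with
      -- respect to the boundary alone avoids the drawing, and it would be bounded if the face were.
      refine hxi ⟨hxb, hF.subset ?_⟩
      refine isPreconnected_connectedComponentIn.subset_connectedComponentIn
        (mem_connectedComponentIn hxb) ?_
      intro y hy hyd
      obtain ⟨p, hp, q, hq, hys⟩ := mem_drawing_top hyd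
      rcases h.segment_subset hp hq hys with hyt | hyb
      · rw [← ins_triangle h.det_pos] at hyt
        refine hxi ⟨hxb, ?_⟩
        rw [connectedComponentIn_eq hy]
        exact hyt.2
      · exact connectedComponentIn_subset _ _ hy hyb

/-- Without one of its inner edges, the complete graph is still a pseudo-triangulation. -/
lemma isPseudoTriangulation_of_joined (h : IsStar X a b c o) {D : SimpleGraph X.pts}
    (hD : ∀ x y, Joined D x y ↔ Joined (⊤ : SimpleGraph X.pts) x y ∧ s(x, y) ≠ s(o, c)) :
    X.IsPseudoTriangulation D := by
  obtain ⟨hab, hbc, hca, hao, hbo, hco⟩ := h.nodup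
  obtain ⟨t1, t2, t3⟩ := h.tri
  have joc : ∀ {x : Plane}, x ∈ X.pts → x ≠ o → Joined (⊤ : SimpleGraph X.pts) o x := fun hx hxo =>
    joined_top.2 ⟨(h.mem o).2 (by simp), hx, hxo.symm⟩
  rw [← det_rot] at t1 t2 t3
  -- The three spokes surround `o`, and any two of them lie in an open half-plane; so `of_delete`
  -- applies to the third.
  obtain ⟨w, hwa, hwb⟩ := exists_halfplane_of_det_ne t1.ne'
  refine h.isPseudoTriangulation_top.of_delete (w := w) hD (joc ((h.mem c).2 (by simp)) hco) ?_ ?_ ?_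
  · intro i hi
    rw [Sym2.eq_iff] at hi
    rcases hi with ⟨h1, -⟩ | ⟨h1, -⟩
    · exact h.ne _ h1.symm
    · exact h.ne _ h1.symm
  · rintro ⟨w', hw'⟩
    exact not_halfplane_of_spanning t1 t2 t3 (hw' a (joc ((h.mem a).2 (by simp)) hao))
      (hw' b (joc ((h.mem b).2 (by simp)) hbo)) (hw' c (joc ((h.mem c).2 (by simp)) hco))
  · intro r hr hrc
    rcases (h.mem r).1 hr.right_mem with rfl | rfl | rfl | rfl
    · exact hwa
    · exact hwb
    · exact absurd rfl hrc
    · exact absurd rfl hr.ne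

/-- An interior vertex of degree one does not occur in a pseudo-triangulation. -/
lemma not_isPseudoTriangulation (hne : ∀ i, X.poly i ≠ o) {D : SimpleGraph X.pts}
    (hb : Joined D o b) (hD : ∀ x, Joined D o x → x = b) : ¬ X.IsPseudoTriangulation D := by
  intro hT
  have hins := hT.openSegment_subset hb (by
    intro i hi
    rw [Sym2.eq_iff] at hi
    rcases hi with ⟨h1, -⟩ | ⟨h1, -⟩
    · exact hne _ h1.symm
    · exact hne _ h1.symm)
  obtain ⟨L, hL, -, he⟩ := hT.exists_face_of_edge hb hins
  -- The face next to the edge needs a second side at `o`.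
  obtain ⟨p, hp⟩ := exists_prev (fst_mem_of_mem_cycEdges he)
  exact hL.pos.toSP.prev_ne_next hp he (hD p (hL.joined _ hp).symm)

/-- The diagonal flip that turns the triangle with the spokes to `a` and `b` into the triangle with
the spokes to `b` and `c`. -/
lemma isDiagonalFlip {T : SimpleGraph X.pts} {e f : Sym2 X.pts} (hnd : [a, b, c, o].Nodup)
    (hmem : ∀ x, x ∈ X.pts ↔ x = a ∨ x = b ∨ x = c ∨ x = o) (hne : ∀ i, X.poly i ≠ o)
    (hPT : ∀ D : SimpleGraph X.pts, (∀ x y, Joined D x y ↔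
      Joined (⊤ : SimpleGraph X.pts) x y ∧ s(x, y) ≠ s(o, a)) → X.IsPseudoTriangulation D)
    (he : planePair e = s(o, c)) (hf : planePair f = s(o, a))
    (hT : ∀ x y, Joined T x y ↔ Joined (⊤ : SimpleGraph X.pts) x y ∧ s(x, y) ≠ s(o, c)) :
    X.IsDiagonalFlip T f e := by
  obtain ⟨⟨hab, hca', hao⟩, ⟨hbc, hbo⟩, hco⟩ : (a ≠ b ∧ a ≠ c ∧ a ≠ o) ∧ (b ≠ c ∧ b ≠ o) ∧ c ≠ o := by
    simpa using hnd
  have hca := hca'.symm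
  have ha : a ∈ X.pts := (hmem a).2 (by simp)
  have hb : b ∈ X.pts := (hmem b).2 (by simp)
  have hc : c ∈ X.pts := (hmem c).2 (by simp)
  have ho : o ∈ X.pts := (hmem o).2 (by simp)
  have noac : s(o, a) ≠ s(o, c) := fun h => hca (Sym2.congr_right.1 h).symm
  have noba : s(o, b) ≠ s(o, a) := fun h => hab (Sym2.congr_right.1 h).symm
  have nobc : s(o, b) ≠ s(o, c) := fun h => hbc (Sym2.congr_right.1 h)
  have hed : ¬ e.IsDiag := by
    induction e with | _ p q
    rw [planePair_mk, Sym2.eq_iff] at he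
    rw [Sym2.mk_isDiag_iff]
    rintro rfl
    rcases he with ⟨h1, h2⟩ | ⟨h1, h2⟩
    · exact hco (h2.symm.trans h1)
    · exact hco (h1.symm.trans h2)
  refine ⟨?_, ?_, ?_, ?_, ?_⟩
  · obtain ⟨g, hg, hgf⟩ := joined_iff_mem_edgeSet.1 ((hT o a).2 ⟨joined_top.2 ⟨ho, ha, hao.symm⟩, noac⟩)
    exact planePair_injective (hgf.trans hf.symm) ▸ hg
  · rintro ⟨i, hi⟩
    have hi' : planePair f = s(X.poly i, X.poly (finRotate X.n i)) := hi
    rw [hf, Sym2.eq_iff] at hi'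
    rcases hi' with ⟨h1, -⟩ | ⟨h1, -⟩
    · exact hne _ h1.symm
    · exact hne _ h1.symm
  · refine not_isPseudoTriangulation (b := b) hne ?_ ?_
    · rw [joined_delete, hT, hf]
      exact ⟨⟨joined_top.2 ⟨ho, hb, hbo.symm⟩, nobc⟩, noba⟩
    · intro x hx
      rw [joined_delete, hT, hf] at hx
      obtain ⟨⟨h1, h2⟩, h3⟩ := hx
      rcases (hmem x).1 h1.right_mem with rfl | rfl | rfl | rfl
      · exact absurd rfl h3
      · rfl
      · exact absurd rfl h2
      · exact absurd rfl h1.ne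
  · rintro rfl
    exact noac (hf.symm.trans he)
  · refine hPT _ fun x y => ?_
    rw [joined_flip hed, hT, he, hf]
    constructor
    · rintro (⟨⟨h1, -⟩, h3⟩ | h1)
      · exact ⟨h1, h3⟩
      · refine ⟨?_, by rw [h1]; exact noac.symm⟩
        rw [Sym2.eq_iff] at h1
        rcases h1 with ⟨rfl, rfl⟩ | ⟨rfl, rfl⟩
        · exact joined_top.2 ⟨ho, hc, hco.symm⟩
        · exact joined_top.2 ⟨hc, ho, hco⟩
    · rintro ⟨h1, h2⟩
      by_cases h3 : s(x, y) = s(o, c)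
      · exact Or.inr h3
      · exact Or.inl ⟨⟨h1, h3⟩, h2⟩

/-- The graph is the complete graph without the spoke to `c`; exchanging this spoke for the one to
`a` or to `b` gives the same configuration up to rotation. -/
lemma exists_two_flips (h : IsStar X a b c o) : ∃ (T : SimpleGraph X.pts) (e : Sym2 X.pts),
    X.IsPseudoTriangulation T ∧ ¬ e.IsDiag ∧ e ∉ T.edgeSet ∧
      X.HasInteriorDegreeTwoEnd T e ∧ X.numFlipsInserting T e = 2 := by
  obtain ⟨hab, hbc, hca, hao, hbo, hco⟩ := h.nodup
  have ha : a ∈ X.pts := (h.mem a).2 (by simp)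
  have hb : b ∈ X.pts := (h.mem b).2 (by simp)
  have hc : c ∈ X.pts := (h.mem c).2 (by simp)
  have ho : o ∈ X.pts := (h.mem o).2 (by simp)
  set e : Sym2 X.pts := s(⟨o, ho⟩, ⟨c, hc⟩) with he
  set f₁ : Sym2 X.pts := s(⟨o, ho⟩, ⟨a, ha⟩) with hf₁
  set f₂ : Sym2 X.pts := s(⟨o, ho⟩, ⟨b, hb⟩) with hf₂
  have hT : ∀ x y, Joined ((⊤ : SimpleGraph X.pts).deleteEdges {e}) x y ↔
      Joined (⊤ : SimpleGraph X.pts) x y ∧ s(x, y) ≠ s(o, c) := fun x y => joined_delete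
  have hed : ¬ e.IsDiag := by
    rw [he, Sym2.mk_isDiag_iff]
    simpa using hco.symm
  have heT : e ∉ ((⊤ : SimpleGraph X.pts).deleteEdges {e}).edgeSet := by
    rw [SimpleGraph.edgeSet_deleteEdges]
    exact fun h => h.2 rfl
  have hPT := h.isPseudoTriangulation_of_joined hT
  have h1 : X.IsDiagonalFlip _ f₁ e := 
    isDiagonalFlip (by simp [hab, hca.symm, hao, hbc, hbo, hco]) h.mem h.ne
      (fun _ => h.rot.isPseudoTriangulation_of_joined) rfl rfl hT
  have h2 : X.IsDiagonalFlip ((⊤ : SimpleGraph X.pts).deleteEdges {e}) f₂ e :=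
    isDiagonalFlip (a := b) (b := a) (by simp [hab.symm, hca.symm, hao, hbc, hbo, hco])
      (fun x => by rw [h.mem]; tauto) h.ne
      (fun _ => h.rot.rot.isPseudoTriangulation_of_joined) rfl rfl hT
  have hne : f₁ ≠ f₂ := by
    intro h
    exact hab (Sym2.congr_right.1 (congrArg planePair h))
  refine ⟨_, e, hPT, hed, heT, Pointgon.hasInteriorDegreeTwoEnd_of_two_flips hPT hed heT h1 h2 hne,
    le_antisymm (Pointgon.numFlipsInserting_le_two hPT hed heT) ?_⟩
  rw [Pointgon.numFlipsInserting, ← Set.ncard_pair hne]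
  refine Set.ncard_le_ncard ?_ (Set.toFinite _)
  rintro f (rfl | rfl)
  · exact h1
  · exact h2

end IsStar

lemma exists_star : ∃ (X : Pointgon) (a b c o : Plane), IsStar X a b c o := by
  set a : Plane := !₂[1, 0] with ha
  set b : Plane := !₂[0, 1] with hb
  set c : Plane := !₂[-1, -1] with hc
  set o : Plane := !₂[0, 0] with ho
  have ht : o ∈ openTri a b c := by
    refine ⟨?_, ?_, ?_⟩ <;> simp [det, ha, hb, hc, ho]
  set Q : Polygon Plane 3 := ⟨![a, b, c]⟩ with hQ
  have hL : List.ofFn Q.vertices = [a, b, c] := by simp [hQ]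
  have hsp : SP (List.ofFn Q.vertices) := by
    rw [hL]; exact sp_triangle (det_pos_of_mem_openTri ht).ne'
  have hin : inside Q = openTri a b c := by
    rw [inside_eq, hL, ins_triangle (det_pos_of_mem_openTri ht)]
  have hnd : a ≠ b ∧ a ≠ c ∧ b ≠ c := nodup_of_det_ne (det_pos_of_mem_openTri ht).ne'
  have hgp : GeneralPosition ({a, b, c, o} : Set Plane) := by
    rw [generalPosition_iff_det]
    intro x hx y hy z hz hxy hxz hyz
    simp only [Set.mem_insert_iff, Set.mem_singleton_iff] at hx hy hz
    rcases hx with rfl | rfl | rfl | rfl <;> rcases hy with rfl | rfl | rfl | rfl <;>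
      first
      | exact absurd rfl hxy
      | (rcases hz with rfl | rfl | rfl | rfl <;>
          first
          | exact absurd rfl hxz
          | exact absurd rfl hyz
          | norm_num [det, ha, hb, hc, ho])
  classical
  refine ⟨⟨3, Q, {a, b, c, o}, ((sp_ofFn_iff Q).1 hsp).1, ?_, ?_, ?_⟩, a, b, c, o, ?_, ?_, ?_, ht⟩
  · intro i
    fin_cases i <;> simp [hQ]
  · intro p hp
    simp only [Finset.mem_insert, Finset.mem_singleton] at hp
    rcases hp with rfl | rfl | rfl | rfl
    · exact Or.inl ⟨0, rfl⟩
    · exact Or.inl ⟨1, rfl⟩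
    · exact Or.inl ⟨2, rfl⟩
    · right; rw [hin]; exact ht
  · simpa using hgp
  · change Q.boundary ℝ = _
    rw [boundary_eq_bd, hL]
  · intro i hi
    have hi' : Q i ∈ List.ofFn Q.vertices := List.mem_ofFn.2 ⟨i, rfl⟩
    have hi2 : Q i = o := hi
    rw [hi2, hL] at hi'
    exact Set.disjoint_left.1 (disjoint_openTri_bd a b c) ht (mem_bd_of_mem hi')
  · intro x
    simp

/-! ### Existence of diagonals -/

/-- The segment between two vertices is a diagonal. -/
structure Diag (L : List Plane) (a b : Plane) : Prop where
  left_mem : a ∈ L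
  right_mem : b ∈ L
  ne : a ≠ b
  subset : openSegment ℝ a b ⊆ ins (bd L)

lemma Diag.symm {L : List Plane} {a b : Plane} (h : Diag L a b) : Diag L b a :=
  ⟨h.right_mem, h.left_mem, h.ne.symm, by rw [openSegment_symm]; exact h.subset⟩

lemma Diag.notMem_cycEdges {L : List Plane} {a b : Plane} (h : Diag L a b) :
    (a, b) ∉ cycEdges L := fun he =>
  have hm := midpoint_mem a b h.ne
  (h.subset hm).1 ⟨(a, b), he, openSegment_subset_segment ℝ _ _ hm⟩

section Wedge

variable {L : List Plane} {p v q : Plane}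

/-- A side at the corner `v` does not contain points of the open wedge at `v`. -/
lemma not_side_at_vertex (hL : L.Nodup) (hp : (p, v) ∈ cycEdges L) (hq : (v, q) ∈ cycEdges L)
    {t x : Plane} (hst : (v, t) ∈ cycEdges L ∨ (t, v) ∈ cycEdges L) (hx : x ∈ segment ℝ v t)
    (hA : 0 < det v q x) (hB : 0 < det p v x) : False := by
  rcases hst with h | h
  · obtain rfl := next_unique hL hq h
    exact hA.ne' (det_eq_zero_of_mem_segment hx)
  · obtain rfl := prev_unique hL hp h
    rw [segment_symm] at hx
    exact hB.ne' (det_eq_zero_of_mem_segment hx)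

/-- A side cannot enter the triangle at a corner through the two sides at this corner. -/
lemma SP.not_side_in_wedge (hL : SP L) (hp : (p, v) ∈ cycEdges L) (hq : (v, q) ∈ cycEdges L)
    (hD : 0 < det v q p) {s t x : Plane} (hst : (s, t) ∈ cycEdges L ∨ (t, s) ∈ cycEdges L)
    (hx : x ∈ segment ℝ s t) (hA : 0 < det v q x) (hB : 0 < det p v x)
    (hHs : det v q s + det p v s < det v q p) (hHx : det v q x + det p v x ≤ det v q p)
    (hs : det v q s < 0 ∨ det p v s < 0) : False := by
  -- In the coordinates `det v q` and `det p v` the wedge is the positive quadrant, and their sum is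
  -- a height that vanishes at `v` and is `det v q p` on the line `p q`. The smaller coordinate
  -- changes sign between `s` and `x`. At its zero `y`, which is below the line `p q`, the given
  -- side meets one of the two sides at `v`.
  set f : ℝ → ℝ := fun τ => min (det v q ((1 - τ) • s + τ • x)) (det p v ((1 - τ) • s + τ • x)) with hf
  have hfc : ContinuousOn f (Set.Icc 0 1) := by
    have h1 := continuous_det v q
    have h2 := continuous_det p v
    exact Continuous.continuousOn (by fun_prop)
  have hf0 : f 0 ≤ 0 := by
    simp only [hf, sub_zero, one_smul, zero_smul, add_zero]
    rcases hs with h | h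
    · exact (min_le_left _ _).trans h.le
    · exact (min_le_right _ _).trans h.le
  have hf1 : 0 < f 1 := by
    simp only [hf, sub_self, one_smul, zero_smul, zero_add]
    exact lt_min hA hB
  obtain ⟨τ, ⟨h0, h1⟩, hτ⟩ := intermediate_value_Icc zero_le_one hfc ⟨hf0, hf1.le⟩
  have hτ1 : τ < 1 := by
    rcases h1.lt_or_eq with h | h
    · exact h
    · rw [h] at hτ; linarith
  set y := (1 - τ) • s + τ • x with hy
  have hys : y ∈ segment ℝ s t := by
    refine (convex_segment s t) (left_mem_segment ℝ s t) hx ?_ h0 ?_ <;> linarith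
  have hAy := det_comb v q s x (show (1 - τ) + τ = 1 by ring)
  have hBy := det_comb p v s x (show (1 - τ) + τ = 1 by ring)
  rw [← hy] at hAy hBy
  have hH : det v q y + det p v y < det v q p := by
    rw [hAy, hBy]
    nlinarith [mul_lt_mul_of_pos_left hHs (sub_pos.2 hτ1), mul_le_mul_of_nonneg_left hHx h0]
  have hmin : min (det v q y) (det p v y) = 0 := hτ
  have hvend : y = v → (y = s ∨ y = t) → False := by
    intro hyv hor
    rcases hor with h | h
    · rw [← h, hyv] at hst hx
      exact not_side_at_vertex hL.nodup hp hq hst hx hA hB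
    · rw [← h, hyv] at hst hx
      rw [segment_symm] at hx
      exact not_side_at_vertex hL.nodup hp hq hst.symm hx hA hB
  have hqy : y ≠ q := by
    rintro h
    rw [h, det_rot p v q] at hH; simp at hH
  have hpy : y ≠ p := by
    rintro h
    rw [h] at hH; simp at hH
  rcases min_choice (det v q y) (det p v y) with h | h
  · have hA0 : det v q y = 0 := h ▸ hmin
    have hB0 : 0 ≤ det p v y := by rw [← hmin]; exact min_le_right _ _
    have hyq : y ∈ segment ℝ v q := by
      have hvq := hL.edge_ne hq
      obtain ⟨r, hr⟩ := exists_param_of_det_eq_zero hvq hA0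
      have e : det p v y = r * det v q p := by rw [hr]; simp [det]; ring
      rw [e] at hB0 hH
      rw [hA0, zero_add] at hH
      exact mem_segment_iff.2 ⟨r, nonneg_of_mul_nonneg_left hB0 hD, by nlinarith, hr⟩
    rcases hL.compat s t v q y hst (Or.inl hq) hys hyq with h2 | ⟨h2, h3⟩
    · have : x ∈ segment ℝ v q := by
        rw [Sym2.eq_iff] at h2
        rcases h2 with ⟨rfl, rfl⟩ | ⟨rfl, rfl⟩
        · exact hx
        · rwa [segment_symm]
      exact hA.ne' (det_eq_zero_of_mem_segment this)
    · exact hvend (h3.resolve_right hqy) h2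
  · have hB0 : det p v y = 0 := h ▸ hmin
    have hA0 : 0 ≤ det v q y := by rw [← hmin]; exact min_le_left _ _
    have hyp : y ∈ segment ℝ p v := by
      have hpv := hL.edge_ne hp
      obtain ⟨r, hr⟩ := exists_param_of_det_eq_zero hpv hB0
      have e : det v q y = (1 - r) * det v q p := by rw [hr]; simp [det]; ring
      rw [e] at hA0 hH
      rw [hB0, add_zero] at hH
      have := nonneg_of_mul_nonneg_left hA0 hD
      exact mem_segment_iff.2 ⟨r, by nlinarith, by linarith, hr⟩
    rcases hL.compat s t p v y hst (Or.inl hp) hys hyp with h2 | ⟨h2, h3⟩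
    · have : x ∈ segment ℝ p v := by
        rw [Sym2.eq_iff] at h2
        rcases h2 with ⟨rfl, rfl⟩ | ⟨rfl, rfl⟩
        · exact hx
        · rwa [segment_symm]
      exact hB.ne' (det_eq_zero_of_mem_segment this)
    · exact hvend (h3.resolve_left hpy) h2

/-- If the part of the wedge at a corner below some height is free of the boundary, then it is
part of the interior. -/
lemma Pos.wedge_subset (hL : Pos L) (hp : (p, v) ∈ cycEdges L) (hq : (v, q) ∈ cycEdges L)
    (hD : 0 < det v q p) {c : ℝ} (hc : 0 < c)
    (hfree : ∀ x, 0 < det v q x → 0 < det p v x → det v q x + det p v x ≤ c → x ∉ bd L) {x : Plane}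
    (hA : 0 < det v q x) (hB : 0 < det p v x) (hH : det v q x + det p v x ≤ c) : x ∈ ins (bd L) := by
  set S : Set Plane := {x | 0 < det v q x ∧ 0 < det p v x ∧ det v q x + det p v x ≤ c} with hS
  have hconv : Convex ℝ S := by
    rintro x ⟨x1, x2, x3⟩ y ⟨y1, y2, y3⟩ s t hs ht hst
    refine ⟨?_, ?_, ?_⟩
    · rw [det_comb v q x y hst]
      rcases hs.eq_or_lt with rfl | hs'
      · obtain rfl : t = 1 := by linarith
        simpa using y1
      · linarith [mul_pos hs' x1, mul_nonneg ht y1.le]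
    · rw [det_comb p v x y hst]
      rcases hs.eq_or_lt with rfl | hs'
      · obtain rfl : t = 1 := by linarith
        simpa using y2
      · linarith [mul_pos hs' x2, mul_nonneg ht y2.le]
    · rw [det_comb v q x y hst, det_comb p v x y hst]
      have h1 := mul_le_mul_of_nonneg_left x3 hs
      have h2 := mul_le_mul_of_nonneg_left y3 ht
      have h3 : s * c + t * c = c := by rw [← add_mul, hst, one_mul]
      linarith
  have hcor : 0 < det p v q := by rwa [det_rot]
  -- The point with parameter `ε` on the inner ray at the corner has height `2 * ε * det v q p`,
  -- which should be below `c`.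
  have hsmall : ∀ᶠ ε : ℝ in 𝓝[>] 0, ε < c / (2 * det v q p) :=
    (gt_mem_nhds (by positivity)).filter_mono nhdsWithin_le_nhds
  obtain ⟨ε, h1, h2, h3⟩ := (((hL.corner_iff hp hq).2 hcor).and
    (hsmall.and self_mem_nhdsWithin)).exists
  have h3' : 0 < ε := h3
  set y := v + ε • ((p - v) + (q - v)) with hy
  have e1 : det v q y = ε * det v q p := by rw [hy]; simp [det]; ring
  have e2 : det p v y = ε * det v q p := by rw [hy]; simp [det]; ring
  have hyS : y ∈ S := by
    refine ⟨by rw [e1]; positivity, by rw [e2]; positivity, ?_⟩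
    rw [e1, e2]
    rw [lt_div_iff₀ (by positivity)] at h2
    linarith
  exact hL.toSP.ins_of_preconnected hconv.isPreconnected (fun z hz => hfree z hz.1 hz.2.1 hz.2.2)
    hyS h1 ⟨hA, hB, hH⟩

lemma length_eq_three_of_triangle (hL : L.Nodup) (hp : (p, v) ∈ cycEdges L)
    (hq : (v, q) ∈ cycEdges L) (hc : (q, p) ∈ cycEdges L) (h2 : 3 ≤ L.length) : L.length = 3 := by
  obtain ⟨l, hl, hcy⟩ := exists_rotation_edge hL (by omega) hp
  have hnd := hl.nodup_iff.2 hL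
  rw [← hl.length_eq] at h2 ⊢
  rw [← hcy.mem_iff] at hq hc
  match l, hnd, hq, hc, h2 with
  | [], _, _, _, h2 => simp at h2
  | [_], _, _, _, _ => rfl
  | a :: b :: l, hnd, hq, hc, _ =>
    exfalso
    have h1 : (v, a) ∈ cycEdges (v :: (a :: b :: l) ++ [p]) := by simp [cycEdges]
    obtain rfl := next_unique hnd hq h1
    have h2 : (q, b) ∈ cycEdges (v :: (q :: b :: l) ++ [p]) := by simp [cycEdges]
    obtain rfl := next_unique hnd hc h2
    simp at hnd

/-- A polygon with at least four vertices has a diagonal. -/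
lemma Pos.exists_diag (hL : Pos L) (h4 : 4 ≤ L.length) : ∃ a b, Diag L a b := by
  classical
  obtain ⟨v, hv⟩ : (corners L).Nonempty := by
    rw [← Finset.card_pos]; have := hL.three_le_card_corners; omega
  obtain ⟨p, q, hp, hq, hd⟩ := mem_corners.1 hv
  have hD : 0 < det v q p := by rwa [← det_rot]
  have hpL := fst_mem_of_mem_cycEdges hp
  have hvL := snd_mem_of_mem_cycEdges hp
  have hqL := snd_mem_of_mem_cycEdges hq
  simp only at hpL hvL hqL
  have hpv := hL.edge_ne hp
  have hvq := hL.edge_ne hq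
  have hpq := hL.toSP.prev_ne_next hp hq
  have hqp0 : det p v q = det v q p := det_rot _ _ _
  -- A lowest vertex `z` of the closed wedge other than `v` decides: if it is `p` or `q`, then `p q`
  -- is a diagonal, otherwise `v z` is.
  set Z := L.toFinset.filter fun z => z ≠ v ∧ 0 ≤ det v q z ∧ 0 ≤ det p v z with hZ
  have hpZ : p ∈ Z := by
    simp only [hZ, Finset.mem_filter, List.mem_toFinset]
    exact ⟨hpL, hpv, hD.le, by simp⟩
  obtain ⟨z, hzZ, hzmin⟩ := Finset.exists_min_image Z (fun z => det v q z + det p v z) ⟨p, hpZ⟩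
  have hzp := hzmin p hpZ
  simp only [det_self_outer, add_zero] at hzp
  obtain ⟨hzL, hzv, hzA, hzB⟩ : z ∈ L ∧ z ≠ v ∧ 0 ≤ det v q z ∧ 0 ≤ det p v z := by
    simpa [hZ] using hzZ
  -- A vertex lower than `z` is `v` or lies off the closed wedge, so a side that starts there cannot
  -- enter the wedge below the line `p q`.
  have hlow : ∀ s t x, ((s, t) ∈ cycEdges L ∨ (t, s) ∈ cycEdges L) → x ∈ segment ℝ s t →
      0 < det v q x → 0 < det p v x → det v q s + det p v s < det v q z + det p v z →
      det v q x + det p v x ≤ det v q p → False := by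
    intro s t x hst hx hA hB hs hHx
    by_cases hsv : s = v
    · rw [hsv] at hst hx
      exact not_side_at_vertex hL.nodup hp hq hst hx hA hB
    · have hsL : s ∈ L := by
        rcases hst with h | h
        · exact fst_mem_of_mem_cycEdges h
        · exact snd_mem_of_mem_cycEdges h
      have hsZ : s ∉ Z := fun h => by linarith [hzmin s h]
      have : det v q s < 0 ∨ det p v s < 0 := by
        by_contra! hcon
        apply hsZ
        simp only [hZ, Finset.mem_filter, List.mem_toFinset]
        exact ⟨hsL, hsv, hcon.1, hcon.2⟩
      exact hL.toSP.not_side_in_wedge hp hq hD hst hx hA hB (by linarith) hHx this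
  by_cases hzpq : z = p ∨ z = q
  · have hHz : det v q z + det p v z = det v q p := by
      rcases hzpq with rfl | rfl
      · simp
      · rw [hqp0]; simp
    have hline : ∀ s ∈ L, det v q s + det p v s = det v q p → s = p ∨ s = q := by
      intro s hs he
      by_contra! hcon
      have := det_sum v q p s
      exact hL.toSP.det_ne hqL hpL hs hpq.symm hcon.2.symm hcon.1.symm (by linarith)
    -- A side with both ends at least as high as the line `p q` can reach down to it only by lying
    -- on it. By general position it then joins `p` and `q`, and the polygon would be a triangle.
    have hfree : ∀ x, 0 < det v q x → 0 < det p v x → det v q x + det p v x ≤ det v q p →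
        x ∉ bd L := by
      rintro x hA hB hH ⟨⟨s, t⟩, hst, hx⟩
      simp only at hx
      by_cases hs : det v q s + det p v s < det v q p
      · exact hlow s t x (Or.inl hst) hx hA hB (by rwa [hHz]) hH
      by_cases ht : det v q t + det p v t < det v q p
      · exact hlow t s x (Or.inr hst) (by rwa [segment_symm]) hA hB (by rwa [hHz]) hH
      push Not at hs ht
      obtain ⟨σ, τ, hσ, hτ, hστ, hxe⟩ := hx
      have e1 := det_comb v q s t hστ
      have e2 := det_comb p v s t hστ
      rw [hxe] at e1 e2
      have hsL : s ∈ L := fst_mem_of_mem_cycEdges hst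
      have htL : t ∈ L := snd_mem_of_mem_cycEdges hst
      have e3 : σ * (det v q s + det p v s - det v q p) + τ * (det v q t + det p v t - det v q p) ≤ 0 := by
        have : det v q p = σ * det v q p + τ * det v q p := by rw [← add_mul, hστ, one_mul]
        linarith
      have g1 := mul_nonneg hσ (sub_nonneg.2 hs)
      have g2 := mul_nonneg hτ (sub_nonneg.2 ht)
      have hσ0 : σ ≠ 0 := by
        rintro rfl
        obtain rfl : τ = 1 := by linarith
        have hxt : t = x := by simpa using hxe
        rcases hline t htL (by linarith) with rfl | rfl
        · rw [← hxt] at hB; simp at hB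
        · rw [← hxt] at hA; simp at hA
      have hτ0 : τ ≠ 0 := by
        rintro rfl
        obtain rfl : σ = 1 := by linarith
        have hxt : s = x := by simpa using hxe
        rcases hline s hsL (by linarith) with rfl | rfl
        · rw [← hxt] at hB; simp at hB
        · rw [← hxt] at hA; simp at hA
      have f1 : σ * (det v q s + det p v s - det v q p) = 0 := by linarith
      have f2 : τ * (det v q t + det p v t - det v q p) = 0 := by linarith
      have k1 := hline s hsL (by linarith [(mul_eq_zero.1 f1).resolve_left hσ0])
      have k2 := hline t htL (by linarith [(mul_eq_zero.1 f2).resolve_left hτ0])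
      have hst' := hL.edge_ne hst
      rcases k1 with rfl | rfl <;> rcases k2 with rfl | rfl
      · exact hst' rfl
      · exact hvq (next_unique hL.nodup hp hst)
      · have := length_eq_three_of_triangle hL.nodup hp hq hst hL.three_le
        omega
      · exact hst' rfl
    refine ⟨p, q, hpL, hqL, hpq, fun x hx => ?_⟩
    obtain ⟨t, ht0, ht1, rfl⟩ := mem_openSegment_iff.1 hx
    have e1 : det v q (p + t • (q - p)) = (1 - t) * det v q p := by simp [det]; ring
    have e2 : det p v (p + t • (q - p)) = t * det v q p := by simp [det]; ring
    exact hL.wedge_subset hp hq hD hD hfree (by rw [e1]; exact mul_pos (by linarith) hD)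
      (by rw [e2]; exact mul_pos ht0 hD) (by rw [e1, e2]; linarith)
  · push Not at hzpq
    have hzA' : 0 < det v q z := lt_of_le_of_ne hzA
      (hL.toSP.det_ne hvL hqL hzL hvq hzv.symm hzpq.2.symm).symm
    have hzB' : 0 < det p v z := lt_of_le_of_ne hzB
      (hL.toSP.det_ne hpL hvL hzL hpv hzpq.1.symm hzv.symm).symm
    refine ⟨v, z, hvL, hzL, hzv.symm, fun x hx => ?_⟩
    obtain ⟨t, ht0, ht1, rfl⟩ := mem_openSegment_iff.1 hx
    have e1 : det v q (v + t • (z - v)) = t * det v q z := by simp [det]; ring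
    have e2 : det p v (v + t • (z - v)) = t * det p v z := by simp [det]; ring
    -- The whole wedge strictly below `z` is free of sides; it is used here up to the height of the
    -- given point of the segment `v z`.
    have hc : 0 < t * (det v q z + det p v z) := by positivity
    refine hL.wedge_subset hp hq hD hc ?_ (by rw [e1]; positivity) (by rw [e2]; positivity)
      (by rw [e1, e2]; linarith)
    rintro x hA hB hH ⟨⟨s, t'⟩, hst, hx⟩
    have hHz : det v q x + det p v x < det v q z + det p v z := by nlinarith
    simp only at hx
    by_cases hs : det v q s + det p v s < det v q z + det p v z
    · exact hlow s t' x (Or.inl hst) hx hA hB hs (by linarith)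
    by_cases ht : det v q t' + det p v t' < det v q z + det p v z
    · exact hlow t' s x (Or.inr hst) (by rwa [segment_symm]) hA hB ht (by linarith)
    push Not at hs ht
    obtain ⟨σ, τ, hσ, hτ, hστ, hxe⟩ := hx
    have e1 := det_comb v q s t' hστ
    have e2 := det_comb p v s t' hστ
    rw [hxe] at e1 e2
    have g1 := mul_le_mul_of_nonneg_left hs hσ
    have g2 := mul_le_mul_of_nonneg_left ht hτ
    have g3 : σ * (det v q z + det p v z) + τ * (det v q z + det p v z) = det v q z + det p v z := by
      rw [← add_mul, hστ, one_mul]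
    linarith

end Wedge

/-! ### Splitting along a diagonal -/

lemma Diag.congr {L L' : List Plane} {a b : Plane} (h : Diag L a b) (hp : L'.Perm L)
    (hc : (cycEdges L').Perm (cycEdges L)) : Diag L' a b :=
  ⟨hp.mem_iff.2 h.left_mem, hp.mem_iff.2 h.right_mem, h.ne, by rw [bd_congr hc]; exact h.subset⟩

/-- A diagonal is not a side, so both paths between its ends have an inner vertex and the parts are
polygons with at least three vertices. -/
lemma Pos.exists_split {L : List Plane} (hL : Pos L) {a b : Plane} (hd : Diag L a b) :
    ∃ l₁ l₂, (a :: l₁ ++ b :: l₂).Perm L ∧ (cycEdges (a :: l₁ ++ b :: l₂)).Perm (cycEdges L) ∧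
      Pos (a :: l₁ ++ [b]) ∧ Pos (b :: l₂ ++ [a]) := by
  obtain ⟨l, hl, hc⟩ := exists_rotation hd.left_mem
  have hbl : b ∈ l := by
    have := hl.mem_iff.2 hd.right_mem
    simpa [hd.ne.symm] using this
  obtain ⟨l₁, l₂, rfl⟩ := List.append_of_mem hbl
  refine ⟨l₁, l₂, hl, hc, ?_⟩
  have hM : Pos (a :: l₁ ++ b :: l₂) := hL.congr hl hc
  have hd : Diag (a :: l₁ ++ b :: l₂) a b := hd.congr hl hc
  obtain ⟨n1, n2, -, -⟩ := nodup_parts hM.nodup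
  have hl1 : l₁ ≠ [] := by
    rintro rfl
    exact hd.notMem_cycEdges (mem_cycEdges_split.2 (Or.inl (by simp)))
  have hl2 : l₂ ≠ [] := by
    rintro rfl
    exact hd.symm.notMem_cycEdges (mem_cycEdges_split.2 (Or.inr (by simp)))
  have hlen1 : 0 < l₁.length := List.length_pos_iff.2 hl1
  have hlen2 : 0 < l₂.length := List.length_pos_iff.2 hl2
  have hJ := hM.toSP.compat.insert (S := {x | x ∈ a :: l₁ ++ b :: l₂}) hM.gp
    (fun c d h => h.elim
      (fun h => ⟨fst_mem_of_mem_cycEdges h, snd_mem_of_mem_cycEdges h⟩)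
      (fun h => ⟨snd_mem_of_mem_cycEdges h, fst_mem_of_mem_cycEdges h⟩))
    hd.left_mem hd.right_mem (fun c d x hcd hx hxo => (hd.subset hxo).1 (hcd.elim
      (fun h => ⟨_, h, hx⟩) (fun h => ⟨_, h, by rwa [segment_symm]⟩)))
  have s1 : SP (a :: l₁ ++ [b]) := by
    refine hJ.sp n1 (by simp; omega) (hM.gp.mono ?_) ?_
    · intro x hx; simp at hx ⊢; tauto
    · intro e he
      rcases mem_cycEdges_part.1 he with h | rfl
      · exact Or.inl (Or.inl (mem_cycEdges_split.2 (Or.inl h)))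
      · exact Or.inr Sym2.eq_swap
  have s2 : SP (b :: l₂ ++ [a]) := by
    refine hJ.sp n2 (by simp; omega) (hM.gp.mono ?_) ?_
    · intro x hx; simp at hx ⊢; tauto
    · intro e he
      rcases mem_cycEdges_part.1 he with h | rfl
      · exact Or.inl (Or.inl (mem_cycEdges_split.2 (Or.inr h)))
      · exact Or.inr rfl
  obtain ⟨P1, P2, -⟩ := hM.split s1 s2 hd.subset
  exact ⟨P1, P2⟩

/-- The (unordered) diagonals of a polygon. -/
def diags (L : List Plane) : Set (Sym2 Plane) := {d | ∃ a b, Diag L a b ∧ d = s(a, b)}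

lemma mk_mem_diags {L : List Plane} {a b : Plane} : s(a, b) ∈ diags L ↔ Diag L a b := by
  constructor
  · rintro ⟨c, d, h, he⟩
    rw [Sym2.eq_iff] at he
    rcases he with ⟨rfl, rfl⟩ | ⟨rfl, rfl⟩
    · exact h
    · exact h.symm
  · exact fun h => ⟨a, b, h, rfl⟩

lemma diags_congr {L L' : List Plane} (hp : L'.Perm L) (hc : (cycEdges L').Perm (cycEdges L)) :
    diags L' = diags L := by
  ext d
  induction d with | _ a b
  rw [mk_mem_diags, mk_mem_diags]
  exact ⟨fun h => h.congr hp.symm hc.symm, fun h => h.congr hp hc⟩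

lemma finite_diags (L : List Plane) : (diags L).Finite := by
  classical
  refine (L.toFinset.sym2.finite_toSet).subset ?_
  rintro _ ⟨a, b, h, rfl⟩
  simpa using ⟨h.left_mem, h.right_mem⟩

section Split

variable {a b : Plane} {l₁ l₂ : List Plane} (hM : Pos (a :: l₁ ++ b :: l₂))
  (h1 : Pos (a :: l₁ ++ [b])) (h2 : Pos (b :: l₂ ++ [a])) (hd : Diag (a :: l₁ ++ b :: l₂) a b)

include hM h1 h2 hd

lemma diag_of_part₁ {c d : Plane} (h : Diag (a :: l₁ ++ [b]) c d) :
    Diag (a :: l₁ ++ b :: l₂) c d := by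
  obtain ⟨-, -, hs1, -⟩ := hM.split h1.toSP h2.toSP hd.subset
  refine ⟨?_, ?_, h.ne, h.subset.trans hs1⟩
  · have := h.left_mem; simp at this ⊢; tauto
  · have := h.right_mem; simp at this ⊢; tauto

lemma diag_of_part₂ {c d : Plane} (h : Diag (b :: l₂ ++ [a]) c d) :
    Diag (a :: l₁ ++ b :: l₂) c d := by
  obtain ⟨-, -, -, hs2, -⟩ := hM.split h1.toSP h2.toSP hd.subset
  refine ⟨?_, ?_, h.ne, h.subset.trans hs2⟩
  · have := h.left_mem; simp at this ⊢; tauto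
  · have := h.right_mem; simp at this ⊢; tauto

/-- The diagonals of the parts and the splitting diagonal are different diagonals, and further
diagonals are those that cross the splitting diagonal. -/
lemma ncard_diags_split {E : Set (Sym2 Plane)} (hE : E ⊆ diags (a :: l₁ ++ b :: l₂))
    (hEd : ∀ c d, s(c, d) ∈ E → s(c, d) ≠ s(a, b) ∧
      ∃ x ∈ openSegment ℝ c d, x ∈ openSegment ℝ a b) :
    (diags (a :: l₁ ++ [b])).ncard + (diags (b :: l₂ ++ [a])).ncard + 1 + E.ncard ≤
      (diags (a :: l₁ ++ b :: l₂)).ncard := by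
  obtain ⟨-, -, -, -, hdis⟩ := hM.split h1.toSP h2.toSP hd.subset
  have hfin := finite_diags (a :: l₁ ++ b :: l₂)
  have f1 := finite_diags (a :: l₁ ++ [b])
  have f2 := finite_diags (b :: l₂ ++ [a])
  have hEf := hfin.subset hE
  have hb2 : segment ℝ a b ⊆ bd (b :: l₂ ++ [a]) := by
    rw [segment_symm]; exact segment_subset_bd_part
  have d12 : Disjoint (diags (a :: l₁ ++ [b])) (diags (b :: l₂ ++ [a])) := by
    rw [Set.disjoint_left]
    intro d
    induction d with | _ c d
    rw [mk_mem_diags, mk_mem_diags]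
    intro g1 g2
    have hm := midpoint_mem c d g1.ne
    exact Set.disjoint_left.1 hdis (g1.subset hm) (g2.subset hm)
  have d3 : Disjoint (diags (a :: l₁ ++ [b]) ∪ diags (b :: l₂ ++ [a])) {s(a, b)} := by
    rw [Set.disjoint_singleton_right]
    have hm := openSegment_subset_segment ℝ _ _ (midpoint_mem a b hd.ne)
    rintro (h | h)
    · exact ((mk_mem_diags.1 h).subset (midpoint_mem a b hd.ne)).1 (segment_subset_bd_part hm)
    · exact ((mk_mem_diags.1 h).subset (midpoint_mem a b hd.ne)).1 (hb2 hm)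
  -- A crossing diagonal passes through a point of the cut, which is on the boundary of both parts.
  have d4 : Disjoint (diags (a :: l₁ ++ [b]) ∪ diags (b :: l₂ ++ [a]) ∪ {s(a, b)}) E := by
    rw [Set.disjoint_left]
    intro d
    induction d with | _ c d
    intro hcd hcdE
    obtain ⟨hne, x, hx, hx'⟩ := hEd c d hcdE
    have hxs := openSegment_subset_segment ℝ _ _ hx'
    rcases hcd with (h | h) | h
    · exact ((mk_mem_diags.1 h).subset hx).1 (segment_subset_bd_part hxs)
    · exact ((mk_mem_diags.1 h).subset hx).1 (hb2 hxs)
    · exact hne h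
  rw [← Set.ncard_union_eq d12 f1 f2, ← Set.ncard_singleton s(a, b),
    ← Set.ncard_union_eq d3 (f1.union f2) (Set.finite_singleton _),
    ← Set.ncard_union_eq d4 ((f1.union f2).union (Set.finite_singleton _)) hEf]
  refine Set.ncard_le_ncard ?_ hfin
  rintro d (((h | h) | h) | h)
  · induction d with | _ c d
    rw [mk_mem_diags] at h ⊢
    exact diag_of_part₁ hM h1 h2 hd h
  · induction d with | _ c d
    rw [mk_mem_diags] at h ⊢
    exact diag_of_part₂ hM h1 h2 hd h
  · rw [Set.mem_singleton_iff.1 h]; exact mk_mem_diags.2 hd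
  · exact hE h

end Split

/-- A diagonal at a corner lies in the angle of the corner, and a diagonal at a reflex vertex lies
outside of the angle spanned by the two sides. -/
lemma Diag.mem_angle {L : List Plane} (hL : Pos L) {v p q r : Plane} (hp : (p, v) ∈ cycEdges L)
    (hq : (v, q) ∈ cycEdges L) (hr : Diag L v r) :
    (0 < det p v q → r ∉ cocone v p q) ∧ (¬ 0 < det p v q → r ∉ cone v p q) := by
  have key : ∀ ε : ℝ, 0 < ε → ε < 1 → v + ε • (r - v) ∈ ins (bd L) := fun ε h0 h1 =>
    hr.subset (mem_openSegment_iff.2 ⟨ε, h0, h1, rfl⟩)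
  have hsm : ∀ᶠ ε : ℝ in 𝓝[>] 0, ε < 1 := (gt_mem_nhds one_pos).filter_mono nhdsWithin_le_nhds
  obtain ⟨ε, h1, h2, h3⟩ := ((eventually_ray (r - v) (hL.near_vertex hp hq)).and
    (hsm.and self_mem_nhdsWithin)).exists
  have h3' : 0 < ε := h3
  constructor
  · intro hd hc
    exact (h1.2 ((ray_mem_cocone_iff h3').2 hc)).2.1 (key ε h3' h2) hd
  · intro hd hc
    exact hd ((h1.1 ((ray_mem_cone_iff h3').2 hc)).2.1 (key ε h3' h2))

section Corners

variable {a b : Plane} {l₁ l₂ : List Plane}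

/-- A diagonal cuts an angle below `π` into two such angles. If both angles at a reflex vertex were
reflex, then `b` would lie in the cone of the two sides, where the diagonal does not run. -/
lemma corner_at_chord (hM : Pos (a :: l₁ ++ b :: l₂)) (h1 : Pos (a :: l₁ ++ [b]))
    (h2 : Pos (b :: l₂ ++ [a])) (hd : Diag (a :: l₁ ++ b :: l₂) a b) :
    (a ∈ corners (a :: l₁ ++ b :: l₂) → a ∈ corners (a :: l₁ ++ [b]) ∧ a ∈ corners (b :: l₂ ++ [a])) ∧
      (a ∈ corners (a :: l₁ ++ [b]) ∨ a ∈ corners (b :: l₂ ++ [a])) := by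
  obtain ⟨p, q, e1, e2, e3, e4, e5, e6⟩ := exists_sides_at_chord hM.nodup
  rw [mem_corners_iff hM.nodup e1 e2, mem_corners_iff h1.nodup e3 e4, mem_corners_iff h2.nodup e5 e6]
  have hbq := h1.toSP.prev_ne_next e3 e4
  have hpb := h2.toSP.prev_ne_next e5 e6
  have hqM := snd_mem_of_mem_cycEdges e2
  have hpM := fst_mem_of_mem_cycEdges e1
  have n1 : det a q b ≠ 0 := hM.toSP.det_ne hd.left_mem hqM hd.right_mem (hM.edge_ne e2) hd.ne hbq.symm
  have n2 : det a p b ≠ 0 := hM.toSP.det_ne hd.left_mem hpM hd.right_mem (hM.edge_ne e1).symm hd.ne hpb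
  have n3 := hM.toSP.det_ne_of_edges e1 e2
  obtain ⟨g1, g2⟩ := hd.mem_angle hM e1 e2
  simp only [cocone, cone, Set.mem_union, Set.mem_inter_iff, Set.mem_ofPred_eq, not_or, not_lt,
    not_and] at g1 g2
  have r1 : det b a q = det a q b := det_rot _ _ _
  have r2 : det p a b = -det a p b := det_swap' _ _ _
  have r3 : det a q p = det p a q := (det_rot _ _ _).symm
  have r4 : det a p q = -det p a q := det_swap' _ _ _
  rw [r3, r4] at g1 g2
  rw [r1, r2]
  constructor
  · intro hc
    obtain ⟨g3, g4⟩ := g1 hc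
    exact ⟨lt_of_le_of_ne (by nlinarith) n1.symm,
      lt_of_le_of_ne (by nlinarith) (neg_ne_zero.2 n2).symm⟩
  · by_cases hc : 0 < det p a q
    · obtain ⟨g3, g4⟩ := g1 hc
      exact Or.inl (lt_of_le_of_ne (by nlinarith) n1.symm)
    · have hc' := lt_of_le_of_ne (not_lt.1 hc) n3
      by_contra! hcon
      have k1 := lt_of_le_of_ne hcon.1 n1
      have k2 : 0 < det a p b := lt_of_le_of_ne (by linarith [hcon.2]) n2.symm
      have := g2 (not_lt.1 hc) (mul_pos_of_neg_of_neg hc' k1)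
      linarith [mul_neg_of_neg_of_pos hc' k2]

open scoped Classical in
/-- Cutting a polygon along a diagonal produces at least two new corners. -/
lemma card_corners_split_le (hM : Pos (a :: l₁ ++ b :: l₂)) (h1 : Pos (a :: l₁ ++ [b]))
    (h2 : Pos (b :: l₂ ++ [a])) (hd : Diag (a :: l₁ ++ b :: l₂) a b) :
    (corners (a :: l₁ ++ b :: l₂)).card + 2 ≤
      (corners (a :: l₁ ++ [b])).card + (corners (b :: l₂ ++ [a])).card := by
  obtain ⟨g1, g2⟩ := corner_at_chord hM h1 h2 hd
  obtain ⟨g3, g4⟩ := corner_at_chord (hM.congr List.perm_append_comm cycEdges_split_comm) h2 h1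
    (hd.symm.congr List.perm_append_comm cycEdges_split_comm)
  rw [corners_congr cycEdges_split_comm] at g3
  obtain ⟨c₁, c₂, f0, f1, f2⟩ := card_corners_split hM.nodup
  -- At each end of the chord the number of corners increases by at least one.
  have key : ∀ (p q r : Prop) [Decidable p] [Decidable q] [Decidable r], (p → q ∧ r) → (q ∨ r) →
      (if p then 1 else 0) + 1 ≤ (if q then 1 else 0) + (if r then 1 else 0) := by
    intro p q r _ _ _ h1 h2
    by_cases hp : p <;> by_cases hq : q <;> by_cases hr : r <;> simp_all
  have k1 : (if a ∈ corners (a :: l₁ ++ b :: l₂) then 1 else 0) + 1 ≤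
      (if a ∈ corners (a :: l₁ ++ [b]) then 1 else 0) +
      (if a ∈ corners (b :: l₂ ++ [a]) then 1 else 0) := key _ _ _ g1 g2
  have k2 : (if b ∈ corners (a :: l₁ ++ b :: l₂) then 1 else 0) + 1 ≤
      (if b ∈ corners (b :: l₂ ++ [a]) then 1 else 0) +
      (if b ∈ corners (a :: l₁ ++ [b]) then 1 else 0) := key _ _ _ g3 g4
  omega

/-- A polygon with `n` vertices has at least `n - 3` diagonals. -/
lemma Pos.length_le_ncard_diags {L : List Plane} (hL : Pos L) : L.length ≤ (diags L).ncard + 3 := by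
  induction hn : L.length using Nat.strong_induction_on generalizing L with
  | _ n ih =>
    by_cases h4 : n ≤ 3
    · omega
    obtain ⟨a, b, hd⟩ := hL.exists_diag (by omega)
    obtain ⟨l₁, l₂, hl, hc, h1, h2⟩ := hL.exists_split hd
    have hM := hL.congr hl hc
    -- The parts have `n + 2` vertices together, and the cut is one more diagonal, so `3` is
    -- subtracted only once in total.
    have hcard := ncard_diags_split hM h1 h2 (hd.congr hl hc) (E := ∅) (Set.empty_subset _) (by simp)
    rw [diags_congr hl hc, Set.ncard_empty] at hcard
    have hlen := hl.length_eq
    have t1 := h1.three_le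
    have t2 := h2.three_le
    simp only [List.length_append, List.length_cons, List.length_nil] at hlen t1 t2
    have i1 := ih _ (by simp only [List.length_append, List.length_cons, List.length_nil]; omega) h1 rfl
    have i2 := ih _ (by simp only [List.length_append, List.length_cons, List.length_nil]; omega) h2 rfl
    simp only [List.length_append, List.length_cons, List.length_nil] at i1 i2
    omega

end Corners

/-! ### Triangles on sides -/

/-- Two vertices are joined by a side or by a diagonal. -/
def Visible (L : List Plane) (a b : Plane) : Prop :=
  ((a, b) ∈ cycEdges L ∨ (b, a) ∈ cycEdges L) ∨ Diag L a b

lemma Visible.symm {L : List Plane} {a b : Plane} (h : Visible L a b) : Visible L b a :=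
  h.imp Or.symm Diag.symm

lemma Visible.congr {L L' : List Plane} {a b : Plane} (h : Visible L a b) (hp : L'.Perm L)
    (hc : (cycEdges L').Perm (cycEdges L)) : Visible L' a b := by
  rcases h with (h | h) | h
  · exact Or.inl (Or.inl (hc.mem_iff.2 h))
  · exact Or.inl (Or.inr (hc.mem_iff.2 h))
  · exact Or.inr (h.congr hp hc)

lemma visible_of_part₁ {a b c d : Plane} {l₁ l₂ : List Plane} (hM : Pos (a :: l₁ ++ b :: l₂))
    (h1 : Pos (a :: l₁ ++ [b])) (h2 : Pos (b :: l₂ ++ [a])) (hd : Diag (a :: l₁ ++ b :: l₂) a b)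
    (h : Visible (a :: l₁ ++ [b]) c d) : Visible (a :: l₁ ++ b :: l₂) c d := by
  have key : ∀ {c d}, (c, d) ∈ cycEdges (a :: l₁ ++ [b]) → Visible (a :: l₁ ++ b :: l₂) c d := by
    intro c d h
    rcases mem_cycEdges_part.1 h with h | h
    · exact Or.inl (Or.inl (mem_cycEdges_split.2 (Or.inl h)))
    · obtain ⟨rfl, rfl⟩ := Prod.mk.inj h
      exact Or.inr hd.symm
  rcases h with (h | h) | h
  · exact key h
  · exact (key h).symm
  · exact Or.inr (diag_of_part₁ hM h1 h2 hd h)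

lemma visible_of_part₂ {a b c d : Plane} {l₁ l₂ : List Plane} (hM : Pos (a :: l₁ ++ b :: l₂))
    (h1 : Pos (a :: l₁ ++ [b])) (h2 : Pos (b :: l₂ ++ [a])) (hd : Diag (a :: l₁ ++ b :: l₂) a b)
    (h : Visible (b :: l₂ ++ [a]) c d) : Visible (a :: l₁ ++ b :: l₂) c d :=
  (visible_of_part₁ (hM.congr List.perm_append_comm cycEdges_split_comm) h2 h1
    (hd.symm.congr List.perm_append_comm cycEdges_split_comm) h).congr List.perm_append_comm.symm
    cycEdges_split_comm.symm

/-- On every side of a polygon there is a triangle with a third vertex of the polygon. -/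
lemma Pos.exists_triangle {L : List Plane} (hL : Pos L) {a b : Plane} (he : (a, b) ∈ cycEdges L) :
    ∃ c ∈ L, 0 < det a b c ∧ openTri a b c ⊆ ins (bd L) ∧ Visible L b c ∧ Visible L c a := by
  induction hn : L.length using Nat.strong_induction_on generalizing L with
  | _ n ih =>
    by_cases h4 : n ≤ 3
    · obtain ⟨l, hl, hc⟩ := exists_rotation_edge hL.nodup (by have := hL.three_le; omega) he
      have h3 : (b :: l ++ [a]).length = 3 := by
        rw [hl.length_eq]; have := hL.three_le; omega
      obtain ⟨c, rfl⟩ : ∃ c, l = [c] := by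
        apply List.length_eq_one_iff.1
        simpa using h3
      have hP : Pos [b, c, a] := hL.congr hl hc
      have k1 : (b, c) ∈ cycEdges [b, c, a] := by simp [cycEdges_triangle]
      have k2 : (c, a) ∈ cycEdges [b, c, a] := by simp [cycEdges_triangle]
      have hn0 := hP.toSP.det_ne_of_edges k1 k2
      obtain ⟨w, hw1, hw2⟩ := exists_halfplane_of_det_ne (v := c) (p := a) (q := b)
        (by rwa [← det_rot])
      have hpos := hP.det_pos_of_exposed k1 k2 ⟨by simp, w, by
        intro y hy hne
        simp only [List.mem_cons, List.not_mem_nil, or_false, Set.mem_ofPred_eq] at hy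
        rcases hy with rfl | rfl | rfl
        · exact hw2
        · exact absurd rfl hne
        · exact hw1⟩
      refine ⟨c, hl.mem_iff.1 (by simp), by rwa [det_rot], ?_,
        Or.inl (Or.inl (hc.mem_iff.1 k1)), Or.inl (Or.inl (hc.mem_iff.1 k2))⟩
      rw [← bd_congr hc]
      change openTri a b c ⊆ ins (bd [b, c, a])
      rw [ins_triangle hpos]
      exact (openTri_rot a b c).ge
    -- Cutting along any diagonal leaves the side `a b` in one of the parts, and a pair visible in a
    -- part is visible in the whole polygon.
    · obtain ⟨u, w, hd⟩ := hL.exists_diag (by omega)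
      obtain ⟨l₁, l₂, hl, hc, h1, h2⟩ := hL.exists_split hd
      have hM := hL.congr hl hc
      have hd' := hd.congr hl hc
      obtain ⟨-, -, hs1, hs2, -⟩ := hM.split h1.toSP h2.toSP hd'.subset
      have hlen := hl.length_eq
      have t1 := h1.three_le
      have t2 := h2.three_le
      simp only [List.length_append, List.length_cons, List.length_nil] at hlen t1 t2
      have len1 : (u :: l₁ ++ [w]).length < n := by simp; omega
      have len2 : (w :: l₂ ++ [u]).length < n := by simp; omega
      rw [← hc.mem_iff] at he
      rw [← bd_congr hc]
      rcases mem_cycEdges_split.1 he with h | h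
      · obtain ⟨c, hcm, hp, ht, v1, v2⟩ := ih _ len1 h1 (mem_cycEdges_part.2 (Or.inl h)) rfl
        refine ⟨c, hl.mem_iff.1 ?_, hp, ht.trans hs1,
          (visible_of_part₁ hM h1 h2 hd' v1).congr hl.symm hc.symm,
          (visible_of_part₁ hM h1 h2 hd' v2).congr hl.symm hc.symm⟩
        simp at hcm ⊢; tauto
      · obtain ⟨c, hcm, hp, ht, v1, v2⟩ := ih _ len2 h2 (mem_cycEdges_part.2 (Or.inl h)) rfl
        refine ⟨c, hl.mem_iff.1 ?_, hp, ht.trans hs2,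
          (visible_of_part₂ hM h1 h2 hd' v1).congr hl.symm hc.symm,
          (visible_of_part₂ hM h1 h2 hd' v2).congr hl.symm hc.symm⟩
        simp at hcm ⊢; tauto

/-! ### Polygons without crossing diagonals -/

/-- No two diagonals cross. -/
def NoCross (L : List Plane) : Prop :=
  ∀ a b c d x, Diag L a b → Diag L c d → x ∈ openSegment ℝ a b → x ∈ openSegment ℝ c d →
    s(a, b) = s(c, d)

lemma Visible.left_mem {L : List Plane} {a b : Plane} (h : Visible L a b) : a ∈ L := by
  rcases h with (h | h) | h
  · exact fst_mem_of_mem_cycEdges h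
  · exact snd_mem_of_mem_cycEdges h
  · exact h.left_mem

lemma Visible.right_mem {L : List Plane} {a b : Plane} (h : Visible L a b) : b ∈ L :=
  h.symm.left_mem

lemma Visible.ne {L : List Plane} (hL : SP L) {a b : Plane} (h : Visible L a b) : a ≠ b := by
  rcases h with (h | h) | h
  · exact hL.edge_ne h
  · exact (hL.edge_ne h).symm
  · exact h.ne

/-- Sides do not cross sides, diagonals do not cross diagonals by assumption, and a diagonal runs in
the interior, off all sides. -/
lemma NoCross.compat {L : List Plane} (hL : SP L) (hN : NoCross L) : Compat (Visible L) := by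
  intro a b c d x h h' hx hx'
  by_cases hxL : x ∈ L
  · exact Or.inr ⟨hL.gp.eq_or_eq_of_mem_segment h.left_mem h.right_mem hxL hx,
      hL.gp.eq_or_eq_of_mem_segment h'.left_mem h'.right_mem hxL hx'⟩
  have hopen : ∀ {a b}, a ∈ L → b ∈ L → x ∈ segment ℝ a b → x ∈ openSegment ℝ a b := by
    intro a b ha hb hx
    rw [← insert_endpoints_openSegment] at hx
    rcases hx with rfl | rfl | h
    · exact absurd ha hxL
    · exact absurd hb hxL
    · exact h
  have hside : ∀ {a b}, (a, b) ∈ cycEdges L ∨ (b, a) ∈ cycEdges L → x ∈ segment ℝ a b → x ∈ bd L := by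
    rintro a b (h | h) hx
    · exact ⟨_, h, hx⟩
    · exact ⟨_, h, by rwa [segment_symm]⟩
  have ho := hopen h.left_mem h.right_mem hx
  have ho' := hopen h'.left_mem h'.right_mem hx'
  rcases h with h | h <;> rcases h' with h' | h'
  · exact hL.compat a b c d x h h' hx hx'
  · exact absurd (hside h hx) (h'.subset ho').1
  · exact absurd (hside h' hx') (h.subset ho).1
  · exact Or.inl (hN a b c d x h h' ho ho')

/-- The third side of an empty triangle blocks the view into the triangle. -/
lemma not_visible_through {L : List Plane} (hc : Compat (Visible L)) {a b c r : Plane}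
    (har : Visible L a r) (hbc : Visible L b c) (hD : 0 < det a b c)
    (ht : openTri a b c ⊆ ins (bd L)) (h1 : 0 < det a b r) (h2 : 0 < det a r c) : False := by
  have e0 : det c a r = det a r c := det_rot _ _ _
  by_cases h3 : 0 < det b c r
  · exact (ht ⟨h1, h3, by rwa [e0]⟩).1 (mem_bd_of_mem har.right_mem)
  push Not at h3
  have hden : 0 < det a b c - det b c r := by linarith
  -- The parameter at which the segment from `a` to `r` meets the line `b c`; the meeting point
  -- turns out to lie strictly between `b` and `c`.
  set t := det a b c / (det a b c - det b c r) with htdef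
  have ht0 : 0 < t := div_pos hD hden
  have ht1 : t ≤ 1 := by rw [htdef, div_le_one hden]; linarith
  have htm : t * (det a b c - det b c r) = det a b c := div_mul_cancel₀ _ hden.ne'
  set y := a + t • (r - a) with hy
  have hyr : y ∈ segment ℝ a r := mem_segment_iff.2 ⟨t, ht0.le, ht1, rfl⟩
  have y1 : det b c y = 0 := by
    have : det b c y = det a b c - t * (det a b c - det b c r) := by rw [hy]; simp [det]; ring
    rw [this, htm, sub_self]
  have y2 : det a b y = t * det a b r := by rw [hy]; simp [det]; ring
  have y3 : det a y c = t * det a r c := by rw [hy]; simp [det]; ring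
  have y2' : 0 < det a b y := by rw [y2]; positivity
  have y3' : 0 < det a y c := by rw [y3]; positivity
  have hbc' : b ≠ c := (nodup_of_det_ne hD.ne').2.2
  obtain ⟨s, hs⟩ := exists_param_of_det_eq_zero hbc' y1
  have z1 : det a b y = s * det a b c := by rw [hs]; simp [det]; ring
  have z2 : det a y c = (1 - s) * det a b c := by rw [hs]; simp [det]; ring
  rw [z1] at y2'
  rw [z2] at y3'
  have hybc : y ∈ segment ℝ b c := mem_segment_iff.2
    ⟨s, (pos_of_mul_pos_left y2' hD.le).le, by linarith [pos_of_mul_pos_left y3' hD.le], hs⟩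
  rw [← z1] at y2'
  rw [← z2] at y3'
  rcases hc a r b c y har hbc hyr hybc with h | ⟨-, h | h⟩
  · rw [Sym2.eq_iff] at h
    rcases h with ⟨rfl, -⟩ | ⟨rfl, -⟩ <;> simp at hD
  · rw [h] at y2'; simp at y2'
  · rw [h] at y3'; simp at y3'

/-- The diagonal `a b` is blocked at `a`: together with two other sides or diagonals it destroys
the pointedness of `a`, and without it `a` is pointed. -/
structure Blocked (L : List Plane) (a b : Plane) : Prop where
  diag : Diag L a b
  spanning : ∃ c c', Visible L a c ∧ Visible L a c' ∧ 0 < det a b c ∧ 0 < det a c c' ∧ 0 < det a c' b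
  pointed : ∃ w, ∀ r, Visible L a r → r ≠ b → 0 < dotp w (r - a)

/-- The last determinant says that the two triangles form an angle larger than `π` at `a`, so `b`,
`c'` and `c` surround `a`. A visible vertex other than `b` cannot be seen through one of the
triangles, so its direction is in the closed cone of `c'` and `c`, which fits into an open
half-plane. -/
lemma blocked_of_triangles {L : List Plane} (hL : SP L) (hc : Compat (Visible L)) {a b c c' : Plane}
    (hd : Diag L a b) (vac : Visible L a c) (vac' : Visible L a c') (vbc : Visible L b c)
    (vbc' : Visible L b c') (d1 : 0 < det b a c) (d2 : 0 < det a b c')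
    (t1 : openTri b a c ⊆ ins (bd L)) (t2 : openTri a b c' ⊆ ins (bd L)) (d3 : 0 < det a c' c) :
    Blocked L a b := by
  have e1 : det a c b = det b a c := (det_rot _ _ _).symm
  have e2 : det a b c = -det b a c := det_swap' _ _ _
  refine ⟨hd, ⟨c', c, vac', vac, d2, d3, by rwa [e1]⟩, ?_⟩
  obtain ⟨w, hw1, hw2⟩ := exists_halfplane_of_det_ne d3.ne'
  refine ⟨w, fun r hr hrb => ?_⟩
  have n1 := hL.det_ne hd.left_mem hd.right_mem hr.right_mem hd.ne (hr.ne hL) hrb.symm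
  have g1 : ¬ (0 < det a b r ∧ 0 < det a r c') := fun h =>
    not_visible_through hc hr vbc' d2 t2 h.1 h.2
  have g2 : ¬ (0 < det a c r ∧ 0 < det a r b) := fun h =>
    not_visible_through hc hr vbc.symm (by rwa [e1]) (by rwa [openTri_rot]) h.1 h.2
  have pl : det a b c' * det a r c - det a b r * det a c' c + det a b c * det a c' r = 0 := by
    unfold det; ring
  have s1 : det a r b = -det a b r := det_swap _ _ _
  have s2 : det a r c' = -det a c' r := det_swap _ _ _
  have s3 : det a c r = -det a r c := det_swap _ _ _
  rw [e2] at pl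
  have id := det_smul_identity a c' c r w
  have main : 0 ≤ det a r c → 0 ≤ det a c' r → (0 < det a r c ∨ 0 < det a c' r) →
      0 < dotp w (r - a) := by
    intro h1 h2 h3
    have : 0 < det a c' c * dotp w (r - a) := by
      rw [id]
      rcases h3 with h3 | h3
      · exact add_pos_of_pos_of_nonneg (mul_pos h3 hw1) (mul_nonneg h2 hw2.le)
      · exact add_pos_of_nonneg_of_pos (mul_nonneg h1 hw1.le) (mul_pos h3 hw2)
    exact pos_of_mul_pos_right this d3.le
  rcases lt_or_gt_of_ne n1 with h | h
  · have h1 : 0 ≤ det a r c := by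
      by_contra hcon
      exact g2 ⟨by rw [s3]; linarith, by rw [s1]; linarith⟩
    have h2 : 0 < det a c' r := by
      by_contra hcon
      have k1 := mul_nonneg d2.le h1
      have k2 := mul_neg_of_neg_of_pos h d3
      have k3 := mul_nonneg d1.le (neg_nonneg.2 (not_lt.1 hcon))
      linarith
    exact main h1 h2.le (Or.inr h2)
  · have h2 : 0 ≤ det a c' r := by
      by_contra hcon
      exact g1 ⟨h, by rw [s2]; linarith⟩
    have h1 : 0 < det a r c := by
      by_contra hcon
      have k1 := mul_nonneg d2.le (neg_nonneg.2 (not_lt.1 hcon))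
      have k2 := mul_pos h d3
      have k3 := mul_nonneg d1.le h2
      linarith
    exact main h1.le h2 (Or.inl h1)

/-- Without crossing diagonals, every diagonal is blocked at one of its ends. -/
lemma NoCross.blocked {L : List Plane} (hL : Pos L) (hN : NoCross L) {a b : Plane}
    (hd : Diag L a b) : Blocked L a b ∨ Blocked L b a := by
  have hcomp := hN.compat hL.toSP
  obtain ⟨l₁, l₂, hl, hc, h1, h2⟩ := hL.exists_split hd
  have hM := hL.congr hl hc
  have hd' := hd.congr hl hc
  obtain ⟨-, -, hs1, hs2, -⟩ := hM.split h1.toSP h2.toSP hd'.subset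
  rw [bd_congr hc] at hs1 hs2
  obtain ⟨c, -, d1, t1, v1, v2⟩ := h1.exists_triangle (a := b) (b := a) (mem_cycEdges_part.2 (Or.inr rfl))
  obtain ⟨c', -, d2, t2, v3, v4⟩ := h2.exists_triangle (a := a) (b := b) (mem_cycEdges_part.2 (Or.inr rfl))
  replace v1 := (visible_of_part₁ hM h1 h2 hd' v1).congr hl.symm hc.symm
  replace v2 := (visible_of_part₁ hM h1 h2 hd' v2).congr hl.symm hc.symm
  replace v3 := (visible_of_part₂ hM h1 h2 hd' v3).congr hl.symm hc.symm
  replace v4 := (visible_of_part₂ hM h1 h2 hd' v4).congr hl.symm hc.symm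
  have t1' := t1.trans hs1
  have t2' := t2.trans hs2
  have e1 : det a b c = -det b a c := det_swap' _ _ _
  have hcc : c ≠ c' := by
    rintro rfl; linarith
  by_cases g1 : 0 < det a c' c
  · exact Or.inl (blocked_of_triangles hL.toSP hcomp hd v1 v4.symm v2.symm v3 d1 d2 t1' t2' g1)
  by_cases g2 : 0 < det b c c'
  · exact Or.inr (blocked_of_triangles hL.toSP hcomp hd.symm v3 v2.symm v4.symm v1 d2 d1 t2' t1' g2)
  -- Now the two triangles form a quadrilateral with angles below `π` at both `a` and `b`, and its
  -- other diagonal `c c'` crosses `a b`.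
  exfalso
  have n1 := hL.toSP.det_ne v1.left_mem v4.left_mem v1.right_mem (v4.ne hL.toSP).symm
    (v1.ne hL.toSP) hcc.symm
  have n2 := hL.toSP.det_ne v3.left_mem v2.left_mem v3.right_mem (v2.ne hL.toSP).symm
    (v3.ne hL.toSP) hcc
  have p1 : 0 < det a c c' := by
    rw [det_swap]; linarith [lt_of_le_of_ne (not_lt.1 g1) n1]
  have p2 : 0 < det b c' c := by
    rw [det_swap]; linarith [lt_of_le_of_ne (not_lt.1 g2) n2]
  have on : ∀ t : ℝ, 0 < t → t < 1 → det a b (c + t • (c' - c)) = 0 →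
      c + t • (c' - c) ∈ openSegment ℝ a b := by
    intro t ht0 ht1 h0
    obtain ⟨s, hs⟩ := exists_param_of_det_eq_zero hd.ne h0
    have f1 : det b c' (c + t • (c' - c)) = (1 - t) * det b c' c := by simp [det]; ring
    have f2 : det c' a (c + t • (c' - c)) = (1 - t) * det a c c' := by simp [det]; ring
    have f3 : det b c' (a + s • (b - a)) = (1 - s) * det a b c' := by simp [det]; ring
    have f4 : det c' a (a + s • (b - a)) = s * det a b c' := by simp [det]; ring
    rw [hs, f3] at f1
    rw [hs, f4] at f2
    have k1 : 0 < (1 - s) * det a b c' := by rw [f1]; exact mul_pos (by linarith) p2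
    have k2 : 0 < s * det a b c' := by rw [f2]; exact mul_pos (by linarith) p1
    exact mem_openSegment_iff.2 ⟨s, pos_of_mul_pos_left k2 d2.le,
      by linarith [pos_of_mul_pos_left k1 d2.le], hs⟩
  -- The open segment runs through the first triangle, crosses `a b`, and continues through the
  -- second triangle.
  have hdiag : Diag L c c' := by
    refine ⟨v1.right_mem, v3.right_mem, hcc, fun y hy => ?_⟩
    obtain ⟨t, ht0, ht1, rfl⟩ := mem_openSegment_iff.1 hy
    rcases lt_trichotomy (det a b (c + t • (c' - c))) 0 with h | h | h
    · refine t1' ⟨by rw [det_swap']; linarith, ?_, ?_⟩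
      · have : det a c (c + t • (c' - c)) = t * det a c c' := by simp [det]; ring
        rw [this]; exact mul_pos ht0 p1
      · have : det c b (c + t • (c' - c)) = t * det b c' c := by simp [det]; ring
        rw [this]; exact mul_pos ht0 p2
    · exact hd.subset (on t ht0 ht1 h)
    · refine t2' ⟨h, ?_, ?_⟩
      · have : det b c' (c + t • (c' - c)) = (1 - t) * det b c' c := by simp [det]; ring
        rw [this]; exact mul_pos (by linarith) p2
      · have : det c' a (c + t • (c' - c)) = (1 - t) * det a c c' := by simp [det]; ring
        rw [this]; exact mul_pos (by linarith) p1
  have hsum : 0 < det b a c + det a b c' := by linarith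
  -- The parameter at which `c c'` meets the line `a b`, determined by the distances of `c` and `c'`
  -- from it.
  set t := det b a c / (det b a c + det a b c') with ht
  have ht0 : 0 < t := div_pos d1 hsum
  have ht1 : t < 1 := by rw [ht, div_lt_one hsum]; linarith
  have htm : t * (det b a c + det a b c') = det b a c := div_mul_cancel₀ _ hsum.ne'
  have h0 : det a b (c + t • (c' - c)) = 0 := by
    have : det a b (c + t • (c' - c)) = t * (det b a c + det a b c') - det b a c := by
      simp [det]; ring
    rw [this, htm, sub_self]
  have heq := hN a b c c' _ hd hdiag (on t ht0 ht1 h0) (mem_openSegment_iff.2 ⟨t, ht0, ht1, rfl⟩)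
  rw [Sym2.eq_iff] at heq
  rcases heq with ⟨h, -⟩ | ⟨-, h⟩
  · rw [h] at d1; simp at d1
  · rw [h] at d1; simp at d1

/-- A corner blocks no diagonal. -/
lemma Blocked.notMem_corners {L : List Plane} (hL : Pos L) {a b : Plane} (h : Blocked L a b) :
    a ∉ corners L := by
  intro ha
  obtain ⟨p, q, hp, hq, hd⟩ := mem_corners.1 ha
  have hD := det_ne_at_vertex hL.toSP hp hq
  obtain ⟨w, hwp, hwq⟩ := exists_halfplane_of_det_ne hD
  -- At a corner everything visible lies in the closed convex cone of the two sides, hence in one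
  -- open half-plane.
  have hw : ∀ r, Visible L a r → 0 < dotp w (r - a) := by
    rintro r ((h | h) | h)
    · obtain rfl := next_unique hL.nodup hq h; exact hwq
    · obtain rfl := prev_unique hL.nodup hp h; exact hwp
    · exact dotp_pos_of_notMem_cocone hD h.ne.symm ((h.mem_angle hL hp hq).1 hd) hwp hwq
  obtain ⟨c, c', vc, vc', g1, g2, g3⟩ := h.spanning
  exact not_halfplane_of_spanning g1 g2 g3 (hw b (Or.inr h.diag)) (hw c vc) (hw c' vc')

/-- The direction opposite to `p` lies between two of the directions to `x`, `y`, `z`. These two and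
`p` positively span the plane at `a`, although `a` should be pointed without the third. -/
lemma false_of_three_blocked {L : List Plane} (hL : SP L) {a x y z p : Plane} (hx : Blocked L a x)
    (hy : Blocked L a y) (hz : Blocked L a z) (hp : Visible L a p) (hpx : p ≠ x) (hpy : p ≠ y)
    (hpz : p ≠ z) (d1 : 0 < det a x y) (d2 : 0 < det a y z) (d3 : 0 < det a z x) : False := by
  obtain ⟨hxy, hzx, hyz⟩ : x ≠ y ∧ z ≠ x ∧ y ≠ z :=
    ⟨(nodup_of_det_ne d1.ne').2.2, (nodup_of_det_ne d3.ne').2.2, (nodup_of_det_ne d2.ne').2.2⟩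
  have n : ∀ r, Blocked L a r → p ≠ r → det a r p ≠ 0 := fun r hr hpr =>
    hL.det_ne hr.diag.left_mem hr.diag.right_mem hp.right_mem hr.diag.ne (hp.ne hL) hpr.symm
  have key : ∀ {x y z}, Blocked L a x → Blocked L a y → Blocked L a z → p ≠ y → x ≠ y → z ≠ y →
      0 < det a z x → ¬ (0 < det a x p ∧ 0 < det a p z) := by
    intro x y z hx hy hz hpy hxy hzy d ⟨g1, g2⟩
    obtain ⟨w, hw⟩ := hy.pointed
    exact not_halfplane_of_spanning g1 g2 d (hw x (Or.inr hx.diag) hxy) (hw p hp hpy)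
      (hw z (Or.inr hz.diag) hzy)
  have k1 := key hx hy hz hpy hxy hyz.symm d3
  have k2 := key hy hz hx hpz hyz hzx.symm d1
  have k3 := key hz hx hy hpx hzx hxy.symm d2
  rw [det_swap a p z] at k1
  rw [det_swap a p x] at k2
  rw [det_swap a p y] at k3
  have id : det a y z * det a x p + det a z x * det a y p + det a x y * det a z p = 0 := by
    unfold det; ring
  rcases lt_or_gt_of_ne (n x hx hpx) with h1 | h1
  · have h2 : det a y p < 0 := by
      by_contra h
      exact k2 ⟨lt_of_le_of_ne (not_lt.1 h) (n y hy hpy).symm, by linarith⟩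
    have h3 : det a z p < 0 := by
      by_contra h
      exact k3 ⟨lt_of_le_of_ne (not_lt.1 h) (n z hz hpz).symm, by linarith⟩
    linarith [mul_neg_of_pos_of_neg d2 h1, mul_neg_of_pos_of_neg d3 h2, mul_neg_of_pos_of_neg d1 h3]
  · have h3 : 0 < det a z p := by
      by_contra h
      exact k1 ⟨h1, by linarith [lt_of_le_of_ne (not_lt.1 h) (n z hz hpz)]⟩
    have h2 : 0 < det a y p := by
      by_contra h
      exact k3 ⟨h3, by linarith [lt_of_le_of_ne (not_lt.1 h) (n y hy hpy)]⟩
    linarith [mul_pos d2 h1, mul_pos d3 h2, mul_pos d1 h3]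

/-- A vertex blocks at most two diagonals. -/
lemma not_three_blocked {L : List Plane} (hL : SP L) {a x y z : Plane} (hx : Blocked L a x)
    (hy : Blocked L a y) (hz : Blocked L a z) (hxy : x ≠ y) (hxz : x ≠ z) (hyz : y ≠ z) : False := by
  obtain ⟨p, hp⟩ := exists_prev hx.diag.left_mem
  have hpv : Visible L a p := Or.inl (Or.inr hp)
  have hpn : ∀ r, Blocked L a r → p ≠ r := by
    rintro r hr rfl
    exact hr.diag.symm.notMem_cycEdges hp
  obtain ⟨c, c', vc, vc', g1, g2, g3⟩ := hx.spanning
  -- Omitting a diagonal other than `a x`, `a c`, `a c'` leaves a spanning triple. So three blocked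
  -- diagonals form the spanning triple themselves, and a side at `a` supplies the fourth direction.
  have key : ∀ r, Blocked L a r → x ≠ r → r = c ∨ r = c' := by
    intro r hr hxr
    by_contra! hcon
    obtain ⟨w, hw⟩ := hr.pointed
    exact not_halfplane_of_spanning g1 g2 g3 (hw x (Or.inr hx.diag) hxr) (hw c vc hcon.1.symm)
      (hw c' vc' hcon.2.symm)
  rcases key y hy hxy with rfl | rfl <;> rcases key z hz hxz with rfl | rfl
  · exact hyz rfl
  · exact false_of_three_blocked hL hx hy hz hpv (hpn _ hx) (hpn _ hy) (hpn _ hz) g1 g2 g3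
  · exact false_of_three_blocked hL hx hz hy hpv (hpn _ hx) (hpn _ hz) (hpn _ hy) g1 g2 g3
  · exact hyz rfl

/-! ### Counting diagonals -/

open scoped Classical in
-- Every diagonal is charged to an end that blocks it. This is a reflex vertex, of which there are
-- `n - k`, and each is charged at most twice.
lemma NoCross.ncard_diags_le {L : List Plane} (hL : Pos L) (hN : NoCross L) :
    (diags L).ncard + 2 * (corners L).card ≤ 2 * L.length := by
  set B : Plane → Finset (Sym2 Plane) := fun a =>
    (L.toFinset.filter fun b => Blocked L a b).image fun b => s(a, b) with hB
  have hBc : ∀ a, (B a).card ≤ 2 := by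
    intro a
    refine Finset.card_image_le.trans ?_
    by_contra! hcon
    obtain ⟨x, y, z, hx, hy, hz, h1, h2, h3⟩ := Finset.two_lt_card_iff.1 hcon
    exact not_three_blocked hL.toSP (Finset.mem_filter.1 hx).2 (Finset.mem_filter.1 hy).2
      (Finset.mem_filter.1 hz).2 h1 h2 h3
  have hsub : diags L ⊆ ((L.toFinset \ corners L).biUnion B : Finset (Sym2 Plane)) := by
    rintro d ⟨a, b, hd, rfl⟩
    simp only [hB, Finset.coe_biUnion, Set.mem_iUnion, Finset.mem_coe, Finset.mem_image,
      Finset.mem_filter, Finset.mem_sdiff, List.mem_toFinset, exists_prop]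
    rcases hN.blocked hL hd with h | h
    · exact ⟨a, ⟨hd.left_mem, h.notMem_corners hL⟩, b, ⟨hd.right_mem, h⟩, rfl⟩
    · exact ⟨b, ⟨hd.right_mem, h.notMem_corners hL⟩, a, ⟨hd.left_mem, h⟩, Sym2.eq_swap⟩
  have h1 := Set.ncard_le_ncard hsub (Finset.finite_toSet _)
  rw [Set.ncard_coe_finset] at h1
  have h2 := Finset.card_biUnion_le_card_mul (L.toFinset \ corners L) B 2 fun a _ => hBc a
  have hcs : corners L ⊆ L.toFinset := fun x hx => List.mem_toFinset.2 (mem_of_mem_corners hx)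
  have h3 := Finset.card_sdiff_add_card_eq_card hcs
  rw [List.toFinset_card_of_nodup hL.nodup] at h3
  omega

/-- A polygon with `k` corners has at least `2 (k - 3)` diagonals. -/
lemma Pos.two_mul_card_corners_le {L : List Plane} (hL : Pos L) :
    2 * (corners L).card ≤ (diags L).ncard + 6 := by
  classical
  induction hn : L.length using Nat.strong_induction_on generalizing L with
  | _ n ih =>
    by_cases hN : NoCross L
    -- Here `d ≤ 2 n - 2 k` and `n ≤ d + 3` combine to the claim.
    · have h1 := hN.ncard_diags_le hL
      have h2 := hL.length_le_ncard_diags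
      omega
    · unfold NoCross at hN
      push Not at hN
      obtain ⟨a, b, c, d, x, hd, hcd, hx, hx', hne⟩ := hN
      obtain ⟨l₁, l₂, hl, hc, h1, h2⟩ := hL.exists_split hd
      have hM := hL.congr hl hc
      have hd' := hd.congr hl hc
      have hcard := ncard_diags_split hM h1 h2 hd' (E := {s(c, d)}) (by
        rw [Set.singleton_subset_iff, mk_mem_diags]
        exact hcd.congr hl hc) (by
        intro c' d' h
        rw [Set.mem_singleton_iff] at h
        refine ⟨by rw [h]; exact hne.symm, x, ?_, hx⟩
        rw [Sym2.eq_iff] at h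
        rcases h with ⟨rfl, rfl⟩ | ⟨rfl, rfl⟩
        · exact hx'
        · rwa [openSegment_symm])
      rw [diags_congr hl hc, Set.ncard_singleton] at hcard
      -- The parts have at least `k + 2` corners and at most `d - 2` diagonals together, so the two
      -- instances of the additive constant `6` reduce to one.
      have hcor := card_corners_split_le hM h1 h2 hd'
      rw [corners_congr hc] at hcor
      have hlen := hl.length_eq
      have t1 := h1.three_le
      have t2 := h2.three_le
      simp only [List.length_append, List.length_cons, List.length_nil] at hlen t1 t2
      have len1 : (a :: l₁ ++ [b]).length < n := by simp; omega
      have len2 : (b :: l₂ ++ [a]).length < n := by simp; omega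
      have i1 := ih _ len1 h1 rfl
      have i2 := ih _ len2 h2 rfl
      omega

/-- A pseudo-`k`-gon in general position has at least `2 (k - 3)` diagonals. -/
lemma IsPseudoGon.le_ncard_diagonals {n k : ℕ} {R : Polygon Plane n} (hR : IsPseudoGon k R)
    (hg : GeneralPosition (Set.range R.vertices)) :
    2 * ((k : ℤ) - 3) ≤ ((diagonals R).ncard : ℤ) := by
  obtain ⟨L, hL, hbd, hcard, hmem, -, -⟩ := exists_pos_list hR.1 hg
  rw [hR.2] at hcard
  have hin : inside R = ins (bd L) := by rw [inside_eq_ins, hbd]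
  have hsub : diags L ⊆ Sym2.map R.vertices '' diagonals R := by
    rintro _ ⟨a, b, hd, rfl⟩
    obtain ⟨i, rfl⟩ := (hmem a).1 hd.left_mem
    obtain ⟨j, rfl⟩ := (hmem b).1 hd.right_mem
    exact ⟨s(i, j), ⟨i, j, fun h => hd.ne (h ▸ rfl), rfl, hin ▸ hd.subset⟩, rfl⟩
  have h1 := Set.ncard_le_ncard hsub (Set.toFinite _)
  have h2 := Set.ncard_image_le (f := Sym2.map R.vertices) (Set.toFinite (diagonals R))
  have h3 := hL.two_mul_card_corners_le
  rw [hcard] at h3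
  omega

end PlanePT

theorem mainTheorem3 :
    (∀ (X : Pointgon) (T : SimpleGraph X.pts) (e : Sym2 X.pts),
      X.IsPseudoTriangulation T → ¬ e.IsDiag → e ∉ T.edgeSet →
        (¬ X.HasInteriorDegreeTwoEnd T e → X.numFlipsInserting T e ≤ 1) ∧
        X.numFlipsInserting T e ≤ 2) ∧
    (∃ (X : Pointgon) (T : SimpleGraph X.pts) (e : Sym2 X.pts),
      X.IsPseudoTriangulation T ∧ ¬ e.IsDiag ∧ e ∉ T.edgeSet ∧
        X.HasInteriorDegreeTwoEnd T e ∧ X.numFlipsInserting T e = 2) ∧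
    (∀ (n k : ℕ) (R : Polygon Plane n),
      IsPseudoGon k R → GeneralPosition (Set.range R.vertices) →
        2 * ((k : ℤ) - 3) ≤ ((diagonals R).ncard : ℤ)) := by
  refine ⟨fun X T e hT he heT => ⟨Pointgon.numFlipsInserting_le_one hT he heT,
    Pointgon.numFlipsInserting_le_two hT he heT⟩, ?_, ?_⟩
  · obtain ⟨X, a, b, c, o, h⟩ := exists_star
    exact ⟨X, h.exists_two_flips⟩
  · exact fun n k R hR hg => hR.le_ncard_diagonals hg
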